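/- **Setting.** Let $\Sigma=\{P_0,\dots,P_{n-1}\}$ be a finite set of unary predicates, used as an alphabet: in an $\omega$-word $w=w_0w_1\dots\in\Sigma^\omega$ exactly one predicate, namely $w_i$, holds at each position $i$ (the *unary alphabet restriction*). $\mathrm{FO}^2[<]$ is the set of first-order formulas over these predicates and the binary predicates $<$ and $=$ that use only the two variables $x$ and $y$; they are interpreted over the positions $\mathbb N$ of $\omega$-words, $|\varphi|$ denotes the length of $\varphi$, and for $\varphi$ with at most one free variable $L(\varphi)=\{w\in\Sigma^\omega : (w,0)\models\varphi\}$. A generalised Büchi automaton (GBA) over $\Sigma$ has a finite set of states, a set of initial states, a set of transitions labelled by letters, and a finite collection $\mathcal F$ of sets of states; a run is accepting if for each $F\in\mathcal F$ some state in $F$ is visited infinitely often. The language $L(A)$ is the set of words with an accepting run that starts at an initial state. A GBA is *unambiguous* if for each state $s$ each word is accepted along at most one run that starts at $s$, and each word has at most one accepting run from the initial states. A state is deterministic if it has at most one successor for each letter, and a GBA is *deterministic in the limit* if every state that lies in some $F\in\mathcal F$, and every state reachable from such a state, is deterministic (if $\mathcal F=\emptyset$, all states count as accepting here). The size of a GBA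 is the length of its description as a string. **Theorem.** There are a polynomial $p$ and a nondeterministic Turing machine $M$ with output such that for every $n=|\Sigma|$ and every $\mathrm{FO}^2[<]$ formula $\varphi$ over $\Sigma$ with at most one free variable there is a family $(A_i)_{i\in I}$ of generalised Büchi automata over $\Sigma$ with the following properties: 1. $|I|\le 2^{p(|\varphi|+|\Sigma|)}$, and each $A_i$ has size at most $p(|\varphi|+|\Sigma|)$; 2. the languages $L(A_i)$ are pairwise disjoint and $\bigcup_{i\in I}L(A_i)=L(\varphi)$; 3. each $A_i$ is unambiguous and deterministic in the limit; 4. on the input $(\Sigma,\varphi)$ every computation of $M$ ends after at most $p(|\varphi|+|\Sigma|)$ steps, and the outputs of the computations of $M$ that halt without rejecting are exactly the descriptions of the automata $A_i$, $i\in I$. -/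

import Mathlib

open Filter

namespace FO2Aut

/-! ### Two-variable first-order logic over the order, interpreted on infinite words -/

/-- The two variables of the logic. -/
inductive Var
  | x
  | y
  deriving DecidableEq

/-- Formulas of `FO²[<]` over the unary predicates `P_a`, `a : Fin n`: first-order formulas that
use only the two variables `x` and `y` and the binary predicates `<` and `=`. -/
inductive Formula (n : ℕ)
  | pred (a : Fin n) (u : Var)
  | lt (u v : Var)
  | eq (u v : Var)
  | neg (φ : Formula n)
  | and (φ ψ : Formula n)
  | or (φ ψ : Formula n)
  | ex (u : Var) (φ : Formula n)

namespace Formula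

variable {n : ℕ}

/-- The length `|φ|` of a formula: its number of connectives, quantifiers and atoms. -/
def size : Formula n → ℕ
  | pred _ _ => 1
  | lt _ _ => 1
  | eq _ _ => 1
  | neg φ => φ.size + 1
  | and φ ψ => φ.size + ψ.size + 1
  | or φ ψ => φ.size + ψ.size + 1
  | ex _ φ => φ.size + 1

/-- The free variables of a formula. -/
def freeVars : Formula n → Finset Var
  | pred _ u => {u}
  | lt u v => {u, v}
  | eq u v => {u, v}
  | neg φ => φ.freeVars
  | and φ ψ => φ.freeVars ∪ ψ.freeVars
  | or φ ψ => φ.freeVars ∪ ψ.freeVars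
  | ex u φ => φ.freeVars.erase u

/-- Satisfaction in the structure on the positions `ℕ` given by an `ω`-word `w` and an assignment
`v` of positions to the variables. The unary alphabet restriction is built in: the alphabet is
`Σ = {P_0, …, P_{n-1}}` and the letter `w i` is the one proposition that holds at position `i`. -/
def Sat (w : ℕ → Fin n) : (Var → ℕ) → Formula n → Prop
  | v, pred a u => w (v u) = a
  | v, lt s t => v s < v t
  | v, eq s t => v s = v t
  | v, neg φ => ¬ Sat w v φ
  | v, and φ ψ => Sat w v φ ∧ Sat w v ψ
  | v, or φ ψ => Sat w v φ ∨ Sat w v ψ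
  | v, ex u φ => ∃ i : ℕ, Sat w (Function.update v u i) φ

/-- The language `L(φ)`: the `ω`-words that satisfy `φ` at the initial position. -/
def lang (φ : Formula n) : Set (ℕ → Fin n) :=
  {w | Sat w (fun _ => 0) φ}

end Formula

/-! ### Generalised Büchi automata -/

/-- Generalised Büchi automata over the alphabet `Fin n`, with labels on the transitions. The
states are `Fin numStates`; the collection of accepting sets is listed as
`acc 0, …, acc (numAcc - 1)`. -/
structure GBA (n : ℕ) where
  numStates : ℕ
  numAcc : ℕ
  init : Fin numStates → Bool
  trans : Fin numStates → Fin n → Fin numStates → Bool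
  acc : Fin numAcc → Fin numStates → Bool

namespace GBA

variable {n : ℕ} (A : GBA n)

/-- `ρ` is an accepting run on `w` that starts at the state `s`: every accepting set contains a
state which is visited infinitely often. -/
def IsAcceptingRunFrom (s : Fin A.numStates) (w : ℕ → Fin n) (ρ : ℕ → Fin A.numStates) : Prop :=
  ρ 0 = s ∧ (∀ i, A.trans (ρ i) (w i) (ρ (i + 1)) = true) ∧
    ∀ j, ∃ q, A.acc j q = true ∧ ∃ᶠ i in atTop, ρ i = q

/-- `ρ` is an accepting run on `w`: one that starts at an initial state. -/
def IsAcceptingRun (w : ℕ → Fin n) (ρ : ℕ → Fin A.numStates) : Prop :=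
  ∃ s, A.init s = true ∧ A.IsAcceptingRunFrom s w ρ

/-- The language of the automaton. -/
def lang : Set (ℕ → Fin n) :=
  {w | ∃ ρ, A.IsAcceptingRun w ρ}

/-- Unambiguity: each word is accepted along at most one run from each state, and has at most one
accepting run. -/
def Unambiguous : Prop :=
  (∀ s w ρ ρ', A.IsAcceptingRunFrom s w ρ → A.IsAcceptingRunFrom s w ρ' → ρ = ρ') ∧
    ∀ w ρ ρ', A.IsAcceptingRun w ρ → A.IsAcceptingRun w ρ' → ρ = ρ'

/-- Accepting states: those in some accepting set. If there are no accepting sets, then every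
infinite run is accepting, and all states count as accepting. -/
def IsAcceptingState (s : Fin A.numStates) : Prop :=
  A.numAcc = 0 ∨ ∃ j, A.acc j s = true

/-- A state is deterministic if it has at most one successor for each letter. -/
def IsDeterministicState (s : Fin A.numStates) : Prop :=
  ∀ a t t', A.trans s a t = true → A.trans s a t' = true → t = t'

/-- Determinism in the limit: the accepting states and all their descendants are deterministic. -/
def DeterministicInLimit : Prop :=
  ∀ s t, A.IsAcceptingState s → Relation.ReflTransGen (fun q q' => ∃ a, A.trans q a q' = true) s t →
    A.IsDeterministicState t

end GBA

/-! ### Descriptions of formulas and automata as strings over a fixed finite alphabet -/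

/-- The alphabet for inputs and outputs of machines. -/
inductive Sym
  | zero
  | one
  | sep
  | varX
  | varY
  | pred
  | lt
  | eq
  | neg
  | and
  | or
  | ex

/-- The symbol for a variable. -/
def Var.code : Var → Sym
  | Var.x => Sym.varX
  | Var.y => Sym.varY

/-- Formulas in prefix notation; the index of a predicate is written in unary and delimited. -/
def Formula.code {n : ℕ} : Formula n → List Sym
  | .pred a u => Sym.pred :: u.code :: (List.replicate (a : ℕ) Sym.one ++ [Sym.sep])
  | .lt u v => [Sym.lt, u.code, v.code]
  | .eq u v => [Sym.eq, u.code, v.code]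
  | .neg φ => Sym.neg :: φ.code
  | .and φ ψ => Sym.and :: (φ.code ++ ψ.code)
  | .or φ ψ => Sym.or :: (φ.code ++ ψ.code)
  | .ex u φ => Sym.ex :: u.code :: φ.code

/-- The input `(Σ, φ)`: the number of letters in unary, followed by the formula. -/
def inputCode {n : ℕ} (φ : Formula n) : List Sym :=
  List.replicate n Sym.one ++ Sym.sep :: φ.code

/-- One bit. -/
def bitCode (b : Bool) : Sym :=
  if b then Sym.one else Sym.zero

/-- The description of an automaton: the numbers of states and of accepting sets in unary, then the
bit tables of the initial states, of the transition relation and of the accepting sets. -/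
def GBA.code {n : ℕ} (A : GBA n) : List Sym :=
  List.replicate A.numStates Sym.one ++ Sym.sep :: (List.replicate A.numAcc Sym.one ++ Sym.sep ::
    ((List.finRange A.numStates).map (fun s => bitCode (A.init s)) ++
      ((List.finRange A.numStates).flatMap (fun s => (List.finRange n).flatMap (fun a =>
          (List.finRange A.numStates).map (fun t => bitCode (A.trans s a t)))) ++
        (List.finRange A.numAcc).flatMap (fun j =>
          (List.finRange A.numStates).map (fun s => bitCode (A.acc j s))))))

/-- The size of an automaton: the length of its description. It is at least the number of states,
the number of transitions and the number of accepting sets. -/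
def GBA.size {n : ℕ} (A : GBA n) : ℕ :=
  A.code.length

/-! ### Nondeterministic Turing machines -/

/-- Nondeterministic Turing machines with output, in the format of Mathlib's multi-stack machines
`Turing.TM2` (the format in which Mathlib defines polynomial-time computability): finitely many
stacks over a finite alphabet `Γ` (a tape is a pair of stacks), finitely many labels `Λ`, and a
finite internal memory `σ`. In place of one statement there is at every label a finite list of
statements; a step chooses one of them. The input is given on the stack `kIn`, the output is left
on the stack `kOut`. -/
structure NTM (I : Type) where
  K : Type
  [decK : DecidableEq K]
  [finK : Finite K]
  kIn : K
  kOut : K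
  Γ : Type
  [finΓ : Finite Γ]
  /-- Input and output symbols, as symbols of the machine. -/
  sym : I ↪ Γ
  Λ : Type
  [finΛ : Finite Λ]
  main : Λ
  σ : Type
  [finσ : Finite σ]
  initVar : σ
  prog : Λ → List (Turing.TM2.Stmt (fun _ : K => Γ) Λ σ)

namespace NTM

variable {I : Type} (M : NTM I)

instance : DecidableEq M.K := M.decK

/-- Configurations: the current label (`none` after halting), the internal memory, the stacks. -/
abbrev Cfg : Type := Turing.TM2.Cfg (fun _ : M.K => M.Γ) M.Λ M.σ

/-- The initial configuration: the input on the stack `kIn`, first symbol on top, and all other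
stacks empty. -/
def initCfg (inp : List I) : M.Cfg :=
  ⟨some M.main, M.initVar, Function.update (fun _ => []) M.kIn (inp.map M.sym)⟩

/-- One step of the machine: some statement listed at the current label is executed. There is no
step from a halted configuration, nor from a label with an empty list. -/
def Step (c c' : M.Cfg) : Prop :=
  ∃ l, c.l = some l ∧ ∃ q ∈ M.prog l, c' = Turing.TM2.stepAux q c.var c.stk

/-- `M.ReachesIn t c c'`: some computation leads from `c` to `c'` in exactly `t` steps. -/
def ReachesIn : ℕ → M.Cfg → M.Cfg → Prop
  | 0, c, c' => c = c'
  | t + 1, c, c' => ∃ d, ReachesIn t c d ∧ M.Step d c'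

/-- Every computation on the input `inp`, whatever the choices, ends after at most `T` steps. -/
def RunsInTime (inp : List I) (T : ℕ) : Prop :=
  ∀ t c, M.ReachesIn t (M.initCfg inp) c → t ≤ T

/-- The set of outputs on the input `inp`: the contents of the output stack, read from the top, at
the end of the computations that halt. A computation that gets stuck in a label with an empty list
of statements is rejecting and has no output. -/
def outputs (inp : List I) : Set (List M.Γ) :=
  {S | ∃ t c, M.ReachesIn t (M.initCfg inp) c ∧ c.l = none ∧ c.stk M.kOut = S}

end NTM

end FO2Aut

/-! Every formula `φ` of `FO²[<]` is equivalent to a disjoint union of small unambiguous automata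
which a nondeterministic machine can enumerate. The reason is that, along the positions of a single
letter, the formula can tell only polynomially many kinds of positions apart.

The *type* of a position `i` records, for every subformula `∃ u, χ` of `φ`, whether `χ` holds for
some value of `u` in the future of `i`, and whether it does for some value in the past of `i`, where
the other variable is `i`. With two variables, the letter and the type of `i` determine the truth of
all subformulas with one free variable at `i`. A witness in the future of a position is also one for
every earlier position that has the same letter and satisfies the same subformulas of `χ`; a witness
in the past is one for every such later position. So the two properties are monotone except where a
subformula changes its truth value. Counting these changes naively would multiply the bound by a
constant at every quantifier and give exponential growth. But the largest subformula is either true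
or false, so between the changes of all other subformulas there are only two monotone sequences to
consider: its own changes count once (`HasCuts.heavy`), and the bound remains cubic in the size.
Summing over the subformulas, the type changes at most `4 * |φ| ^ 4` times along the positions of a
letter (`Formula.hasCuts_sameType`).

Hence a word is cut into polynomially many *runs*, maximal stretches of positions of one letter with
one type. The first and last positions of the runs are *markers*. A certificate (`Cert`) records the
letters of the runs and the order of the markers. This is enough to evaluate `φ`: whether some
position of a run lies after a given position of another depends, up to positions of the same type,
only on the order of their markers (`Cert.Abs`, `Cert.agree_of_const`). A certificate is valid if
evaluation confirms that the type is constant on each of its runs and differs between consecutive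
runs of a letter, and that `φ` holds at the initial position (`Cert.Valid`). The automaton
`Cert.aut` accepts the words of the shape described by the certificate: it guesses which positions
are the markers, checks the letters at and between them, and after the last one is deterministic and
checks that the letters of the infinite runs, and only these, recur forever.

For a valid certificate of a word the markers are exactly the positions whose type differs from that
of the previous position with the same letter, or from that of the next one, or which have no such
position before or after them (`Cert.Valid.isStart_iff`, `Cert.Valid.isEnd_iff`). These are
properties of the word alone. Hence two valid certificates of one word have the same automaton
(`Cert.Valid.aut_unique`), which makes the languages disjoint, and an accepting run is determined by
the word (`Cert.Valid.unambiguous`). Conversely, the runs of a word in `L(φ)` form a valid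
certificate (`certOf.valid`).

The machine guesses a certificate, the description of its automaton, the ends of all subformulas in
the input and the truth values of all subformulas, and then checks all of it
(`exists_machine_for_certificates`). The check refers only to single symbols of the tapes, positions
on them and quantifiers with polynomial bounds, so it is the value of an arithmetic expression with
bounded sums (`definable_tapeCheck`). Programs for such expressions are obtained by recursion on the
expression and run in polynomial time on stacks (`Ex.run_comp`), and programs are turned into
machines by taking the lists of pending commands as labels (`Cmd.machine_correct`). The index set of
the family is the set of outputs of the machine. -/


open Filter

namespace FO2Aut

/-! ### Nondeterministic stack programs and their machines -/

instance : Finite Sym :=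
  Finite.of_surjective
    (![.zero, .one, .sep, .varX, .varY, .pred, .lt, .eq, .neg, .and, .or, .ex] : Fin 12 → Sym) <| by
    intro s
    cases s
    exacts [⟨0, rfl⟩, ⟨1, rfl⟩, ⟨2, rfl⟩, ⟨3, rfl⟩, ⟨4, rfl⟩, ⟨5, rfl⟩, ⟨6, rfl⟩, ⟨7, rfl⟩,
      ⟨8, rfl⟩, ⟨9, rfl⟩, ⟨10, rfl⟩, ⟨11, rfl⟩]

/-- Structured nondeterministic programs over stacks numbered by `ℕ`. `pop k f` pops the stack `k`
and goes on with `f o`, where `o` is the popped symbol, if there is one; `loop k f` pops the stack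
`k` until it is empty and runs `f γ` for each popped symbol `γ`. -/
inductive Cmd
  | skip
  | push (k : ℕ) (γ : Sym)
  | pop (k : ℕ) (f : Option Sym → Cmd)
  | seq (a b : Cmd)
  | loop (k : ℕ) (f : Sym → Cmd)
  | choice (a b : Cmd)
  | fail

/-- The contents of all stacks. -/
abbrev Store := ℕ → List Sym

/-- Big-step semantics: `Run c s T R` says that all computations of `c` from `s` take at most `T`
steps and that `R` is the set of stores in which they can end. -/
inductive Run : Cmd → Store → ℕ → Set Store → Prop
  | skip (s) : Run .skip s 1 {s}
  | push (k γ s) : Run (.push k γ) s 1 {Function.update s k (γ :: s k)}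
  | pop {k f s T R} : Run (f (s k).head?) (Function.update s k (s k).tail) T R →
      Run (.pop k f) s (T + 1) R
  | seq {a b s T₁ T₂ R₁} {R₂ : Store → Set Store} : Run a s T₁ R₁ →
      (∀ s' ∈ R₁, Run b s' T₂ (R₂ s')) → Run (.seq a b) s (T₁ + T₂ + 1) (⋃ s' ∈ R₁, R₂ s')
  | loop_nil {k f s} : s k = [] → Run (.loop k f) s 1 {s}
  | loop_cons {k f s γ l T₁ T₂ R₁} {R₂ : Store → Set Store} : s k = γ :: l →
      Run (f γ) (Function.update s k l) T₁ R₁ →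
      (∀ s' ∈ R₁, Run (.loop k f) s' T₂ (R₂ s')) →
      Run (.loop k f) s (T₁ + T₂ + 1) (⋃ s' ∈ R₁, R₂ s')
  | choice {a b s T Ra Rb} : Run a s T Ra → Run b s T Rb → Run (.choice a b) s (T + 1) (Ra ∪ Rb)
  | fail (s) : Run .fail s 0 ∅
  | mono {c s T T' R} : Run c s T R → T ≤ T' → Run c s T' R

/-- Configurations of the small-step semantics: the commands still to be executed, and the stacks.
-/
abbrev LCfg := List Cmd × Store

/-- The successors of a configuration. -/
def LCfg.next : LCfg → List LCfg
  | ([], _) => []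
  | (.skip :: ks, s) => [(ks, s)]
  | (.push k γ :: ks, s) => [(ks, Function.update s k (γ :: s k))]
  | (.pop k f :: ks, s) => [(f (s k).head? :: ks, Function.update s k (s k).tail)]
  | (.seq a b :: ks, s) => [(a :: b :: ks, s)]
  | (.loop k f :: ks, s) =>
      [(match (s k).head? with
        | none => ks
        | some γ => f γ :: .loop k f :: ks, Function.update s k (s k).tail)]
  | (.choice a b :: ks, s) => [(a :: ks, s), (b :: ks, s)]
  | (.fail :: _, _) => []

/-- `Trace t c d`: there is a computation of length `t` from `c` to `d`. -/
def Trace : ℕ → LCfg → LCfg → Prop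
  | 0, c, d => c = d
  | t + 1, c, d => ∃ e, Trace t c e ∧ d ∈ e.next

theorem trace_succ_iff {t : ℕ} {c d : LCfg} :
    Trace (t + 1) c d ↔ ∃ e ∈ c.next, Trace t e d := by
  induction t generalizing d with
  | zero => simp [Trace]
  | succ t ih =>
    constructor
    · rintro ⟨e, he, hd⟩
      obtain ⟨e', h1, h2⟩ := ih.1 he
      exact ⟨e', h1, e, h2, hd⟩
    · rintro ⟨e', h1, e, h2, hd⟩
      exact ⟨e, ih.2 ⟨e', h1, h2⟩, hd⟩

/-- All computations from `c` have length at most `T`. -/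
def Bounded (T : ℕ) (c : LCfg) : Prop := ∀ t d, Trace t c d → t ≤ T

/-- The stores in which a computation from `c` can end. -/
def Ends (c : LCfg) : Set Store := {s | ∃ t, Trace t c ([], s)}

theorem Bounded.mono {T T' : ℕ} {c : LCfg} (h : Bounded T c) (hT : T ≤ T') : Bounded T' c :=
  fun t d ht => (h t d ht).trans hT

theorem bounded_succ {T : ℕ} {c : LCfg} (h : ∀ d ∈ c.next, Bounded T d) : Bounded (T + 1) c := by
  rintro (_ | t) d ht
  · omega
  · obtain ⟨e, he, h'⟩ := trace_succ_iff.1 ht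
    have := h e he t d h'
    omega

theorem mem_ends_cons {k : Cmd} {ks : List Cmd} {s s' : Store} :
    s' ∈ Ends (k :: ks, s) ↔ ∃ d ∈ LCfg.next (k :: ks, s), s' ∈ Ends d := by
  constructor
  · rintro ⟨_ | t, ht⟩
    · simp [Trace] at ht
    · obtain ⟨e, he, h'⟩ := trace_succ_iff.1 ht
      exact ⟨e, he, t, h'⟩
  · rintro ⟨d, hd, t, ht⟩
    exact ⟨t + 1, trace_succ_iff.2 ⟨d, hd, ht⟩⟩

/-- The big-step semantics is correct for the small-step semantics, in every continuation. -/
theorem Run.sound {c : Cmd} {s : Store} {T : ℕ} {R : Set Store} (h : Run c s T R) (ks : List Cmd) :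
    (∀ T', (∀ s' ∈ R, Bounded T' (ks, s')) → Bounded (T + T') (c :: ks, s)) ∧
      ∀ s'', s'' ∈ Ends (c :: ks, s) ↔ ∃ s' ∈ R, s'' ∈ Ends (ks, s') := by
  induction h generalizing ks with
  | skip s =>
    refine ⟨fun T' h => ?_, fun s'' => ?_⟩
    · rw [add_comm]; apply bounded_succ; simpa [LCfg.next] using h
    · rw [mem_ends_cons]; simp [LCfg.next]
  | push k γ s =>
    refine ⟨fun T' h => ?_, fun s'' => ?_⟩
    · rw [add_comm]; apply bounded_succ; simpa [LCfg.next] using h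
    · rw [mem_ends_cons]; simp [LCfg.next]
  | @pop k f s T R _ ih =>
    refine ⟨fun T' h => ?_, fun s'' => ?_⟩
    · rw [show T + 1 + T' = T + T' + 1 by omega]; apply bounded_succ
      simpa [LCfg.next] using (ih ks).1 T' h
    · rw [mem_ends_cons, ← (ih ks).2]; simp [LCfg.next]
  | @seq a b s T₁ T₂ R₁ R₂ _ _ iha ihb =>
    refine ⟨fun T' h => ?_, fun s'' => ?_⟩
    · rw [show T₁ + T₂ + 1 + T' = T₁ + (T₂ + T') + 1 by omega]; apply bounded_succ
      simp only [LCfg.next, List.mem_singleton, forall_eq]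
      refine (iha (b :: ks)).1 _ fun s' hs' => (ihb s' hs' ks).1 T' fun s₂ hs₂ => h s₂ ?_
      simp only [Set.mem_iUnion]; exact ⟨s', hs', hs₂⟩
    · rw [mem_ends_cons]
      simp only [LCfg.next, List.mem_singleton, exists_eq_left, (iha (b :: ks)).2, Set.mem_iUnion]
      constructor
      · rintro ⟨s', hs', h⟩
        obtain ⟨s₂, hs₂, h⟩ := ((ihb s' hs' ks).2 _).1 h
        exact ⟨s₂, ⟨s', hs', hs₂⟩, h⟩
      · rintro ⟨s₂, ⟨s', hs', hs₂⟩, h⟩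
        exact ⟨s', hs', ((ihb s' hs' ks).2 _).2 ⟨s₂, hs₂, h⟩⟩
  | @loop_nil k f s hs =>
    have hn : LCfg.next (.loop k f :: ks, s) = [(ks, s)] := by
      simp only [LCfg.next, hs, List.head?_nil, List.tail_nil]
      rw [← hs, Function.update_eq_self]
    refine ⟨fun T' h => ?_, fun s'' => ?_⟩
    · rw [add_comm]; apply bounded_succ; simpa [hn] using h
    · rw [mem_ends_cons]; simp [hn]
  | @loop_cons k f s γ l T₁ T₂ R₁ R₂ hs _ _ iha ihb =>
    have hn : LCfg.next (.loop k f :: ks, s) =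
        [(f γ :: .loop k f :: ks, Function.update s k l)] := by
      simp [LCfg.next, hs]
    refine ⟨fun T' h => ?_, fun s'' => ?_⟩
    · rw [show T₁ + T₂ + 1 + T' = T₁ + (T₂ + T') + 1 by omega]; apply bounded_succ
      simp only [hn, List.mem_singleton, forall_eq]
      refine (iha (_ :: ks)).1 _ fun s' hs' => (ihb s' hs' ks).1 T' fun s₂ hs₂ => h s₂ ?_
      simp only [Set.mem_iUnion]; exact ⟨s', hs', hs₂⟩
    · rw [mem_ends_cons]
      simp only [hn, List.mem_singleton, exists_eq_left, (iha (_ :: ks)).2, Set.mem_iUnion]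
      constructor
      · rintro ⟨s', hs', h⟩
        obtain ⟨s₂, hs₂, h⟩ := ((ihb s' hs' ks).2 _).1 h
        exact ⟨s₂, ⟨s', hs', hs₂⟩, h⟩
      · rintro ⟨s₂, ⟨s', hs', hs₂⟩, h⟩
        exact ⟨s', hs', ((ihb s' hs' ks).2 _).2 ⟨s₂, hs₂, h⟩⟩
  | @choice a b s T Ra Rb _ _ iha ihb =>
    refine ⟨fun T' h => ?_, fun s'' => ?_⟩
    · rw [show T + 1 + T' = T + T' + 1 by omega]; apply bounded_succ
      simp only [LCfg.next, List.mem_cons, List.not_mem_nil, or_false]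
      rintro d (rfl | rfl)
      · exact (iha ks).1 T' fun s' hs' => h s' (Or.inl hs')
      · exact (ihb ks).1 T' fun s' hs' => h s' (Or.inr hs')
    · rw [mem_ends_cons]
      simp only [LCfg.next, List.mem_cons, List.not_mem_nil, or_false,
        exists_eq_left, (iha ks).2, (ihb ks).2, Set.mem_union, or_and_right, exists_or]
  | fail s =>
    refine ⟨fun T' h => ?_, fun s'' => ?_⟩
    · refine Bounded.mono (T := 0) ?_ (by omega)
      rintro (_ | t) d ht
      · omega
      · obtain ⟨e, he, -⟩ := trace_succ_iff.1 ht
        simp [LCfg.next] at he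
    · rw [mem_ends_cons]; simp [LCfg.next]
  | mono _ hT ih =>
    exact ⟨fun T' h => ((ih ks).1 T' h).mono (by omega), (ih ks).2⟩

/-- All stacks of the program have numbers below `B`. -/
def Cmd.StacksLT (B : ℕ) : Cmd → Prop
  | .skip => True
  | .push k _ => k < B
  | .pop k f => k < B ∧ ∀ o, (f o).StacksLT B
  | .seq a b => a.StacksLT B ∧ b.StacksLT B
  | .loop k f => k < B ∧ ∀ o, (f o).StacksLT B
  | .choice a b => a.StacksLT B ∧ b.StacksLT B
  | .fail => True

/-- The lists of pending commands that can occur while `c` is executed before `ks`. -/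
def Cmd.conts : Cmd → List Cmd → Set (List Cmd)
  | .skip, ks => {.skip :: ks}
  | .push k γ, ks => {.push k γ :: ks}
  | .pop k f, ks => {.pop k f :: ks} ∪ ⋃ o, (f o).conts ks
  | .seq a b, ks => {.seq a b :: ks} ∪ a.conts (b :: ks) ∪ b.conts ks
  | .loop k f, ks => {.loop k f :: ks} ∪ ⋃ o, (f o).conts (.loop k f :: ks)
  | .choice a b, ks => {.choice a b :: ks} ∪ a.conts ks ∪ b.conts ks
  | .fail, ks => {.fail :: ks}

theorem Cmd.conts_finite (c : Cmd) (ks : List Cmd) : (c.conts ks).Finite := by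
  induction c generalizing ks with
  | skip => exact Set.finite_singleton _
  | push k γ => exact Set.finite_singleton _
  | pop k f ih => exact (Set.finite_singleton _).union (Set.finite_iUnion fun o => ih o ks)
  | seq a b iha ihb => exact ((Set.finite_singleton _).union (iha _)).union (ihb _)
  | loop k f ih => exact (Set.finite_singleton _).union (Set.finite_iUnion fun o => ih o _)
  | choice a b iha ihb => exact ((Set.finite_singleton _).union (iha _)).union (ihb _)
  | fail => exact Set.finite_singleton _

theorem Cmd.cons_mem_conts (c : Cmd) (ks : List Cmd) : c :: ks ∈ c.conts ks := by
  cases c <;> simp [Cmd.conts]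

theorem Cmd.conts_closed (c : Cmd) {ks l : List Cmd} (hl : l ∈ c.conts ks) {s : Store} {d : LCfg}
    (hd : d ∈ LCfg.next (l, s)) : d.1 ∈ c.conts ks ∨ d.1 = ks := by
  induction c generalizing ks with
  | skip =>
    obtain rfl : l = _ := hl
    right; simp [LCfg.next] at hd; simp [hd]
  | push k γ =>
    obtain rfl : l = _ := hl
    right; simp [LCfg.next] at hd; simp [hd]
  | pop k f ih =>
    rcases hl with hl | hl
    · obtain rfl : l = _ := hl
      simp only [LCfg.next, List.mem_singleton] at hd
      subst hd
      exact Or.inl (Or.inr (Set.mem_iUnion.2 ⟨_, (f _).cons_mem_conts ks⟩))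
    · obtain ⟨o, ho⟩ := Set.mem_iUnion.1 hl
      rcases ih o ho with h | h
      · exact Or.inl (Or.inr (Set.mem_iUnion.2 ⟨_, h⟩))
      · exact Or.inr h
  | seq a b iha ihb =>
    rcases hl with (hl | hl) | hl
    · obtain rfl : l = _ := hl
      simp only [LCfg.next, List.mem_singleton] at hd
      subst hd
      exact Or.inl (Or.inl (Or.inr (a.cons_mem_conts _)))
    · rcases iha hl with h | h
      · exact Or.inl (Or.inl (Or.inr h))
      · rw [h]
        exact Or.inl (Or.inr (b.cons_mem_conts _))
    · rcases ihb hl with h | h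
      · exact Or.inl (Or.inr h)
      · exact Or.inr h
  | loop k f ih =>
    rcases hl with hl | hl
    · obtain rfl : l = _ := hl
      simp only [LCfg.next, List.mem_singleton] at hd
      subst hd
      cases (s k).head? with
      | none => exact Or.inr rfl
      | some γ => exact Or.inl (Or.inr (Set.mem_iUnion.2 ⟨_, (f _).cons_mem_conts _⟩))
    · obtain ⟨o, ho⟩ := Set.mem_iUnion.1 hl
      rcases ih o ho with h | h
      · exact Or.inl (Or.inr (Set.mem_iUnion.2 ⟨_, h⟩))
      · rw [h]; exact Or.inl (Or.inl rfl)
  | choice a b iha ihb =>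
    rcases hl with (hl | hl) | hl
    · obtain rfl : l = _ := hl
      simp only [LCfg.next, List.mem_cons, List.not_mem_nil, or_false] at hd
      rcases hd with rfl | rfl
      · exact Or.inl (Or.inl (Or.inr (a.cons_mem_conts _)))
      · exact Or.inl (Or.inr (b.cons_mem_conts _))
    · rcases iha hl with h | h
      · exact Or.inl (Or.inl (Or.inr h))
      · exact Or.inr h
    · rcases ihb hl with h | h
      · exact Or.inl (Or.inr h)
      · exact Or.inr h
  | fail =>
    obtain rfl : l = _ := hl
    simp [LCfg.next] at hd

theorem Cmd.stacksLT_next {B : ℕ} {l : List Cmd} (hl : ∀ c ∈ l, c.StacksLT B) {s : Store} {d : LCfg}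
    (hd : d ∈ LCfg.next (l, s)) : ∀ c ∈ d.1, c.StacksLT B := by
  rcases l with _ | ⟨c, ks⟩
  · simp [LCfg.next] at hd
  · simp only [List.mem_cons, forall_eq_or_imp] at hl
    obtain ⟨hc, hks⟩ := hl
    cases c with
    | loop k f =>
      simp only [LCfg.next, List.mem_singleton] at hd
      subst hd
      cases (s k).head? with
      | none => exact hks
      | some γ =>
        simp only [List.mem_cons, forall_eq_or_imp]
        exact ⟨hc.2 _, hc, hks⟩
    | choice a b =>
      simp only [LCfg.next, List.mem_cons, List.not_mem_nil, or_false] at hd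
      simp only [Cmd.StacksLT] at hc
      rcases hd with rfl | rfl <;> simp [hc] <;> assumption
    | fail => simp [LCfg.next] at hd
    | _ =>
      simp only [LCfg.next, List.mem_singleton] at hd
      subst hd
      simp only [Cmd.StacksLT] at hc
      simp_all

/-- The labels of the machine of a program: the possible lists of pending commands. -/
abbrev Cmd.Labels (c : Cmd) : Type := {l : List Cmd // l ∈ c.conts [] ∪ {[]}}

instance (c : Cmd) : Finite c.Labels :=
  ((c.conts_finite []).union (Set.finite_singleton _)).to_subtype

open Classical in
/-- A list of pending commands as a label, with a default value if it is none. -/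
noncomputable def Cmd.label (c : Cmd) (l : List Cmd) : c.Labels :=
  if h : l ∈ c.conts [] ∪ {[]} then ⟨l, h⟩ else ⟨[], Or.inr rfl⟩

theorem Cmd.label_val {c : Cmd} {l : List Cmd} (h : l ∈ c.conts [] ∪ {[]}) :
    (c.label l).1 = l := by
  rw [Cmd.label, dif_pos h]

/-- The machine statements for a list of pending commands. -/
noncomputable def Cmd.stmts (c : Cmd) (B : ℕ) [NeZero B] :
    List Cmd → List (Turing.TM2.Stmt (fun _ : Fin B => Sym) c.Labels (Option Sym))
  | [] => [.halt]
  | .skip :: ks => [.goto fun _ => c.label ks]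
  | .push k γ :: ks => [.push (Fin.ofNat B k) (fun _ => γ) (.goto fun _ => c.label ks)]
  | .pop k f :: ks => [.pop (Fin.ofNat B k) (fun _ o => o) (.goto fun v => c.label (f v :: ks))]
  | .seq a b :: ks => [.goto fun _ => c.label (a :: b :: ks)]
  | .loop k f :: ks => [.pop (Fin.ofNat B k) (fun _ o => o) (.goto fun v => c.label
      (match v with
        | none => ks
        | some γ => f γ :: .loop k f :: ks))]
  | .choice a b :: ks => [.goto fun _ => c.label (a :: ks), .goto fun _ => c.label (b :: ks)]
  | .fail :: _ => []

/-- The machine of a program that uses the stacks `0, …, B - 1`. The input is on the stack `0`, the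
output on the stack `1`. -/
noncomputable def Cmd.machine (c : Cmd) (B : ℕ) [NeZero B] : NTM Sym where
  K := Fin B
  kIn := 0
  kOut := Fin.ofNat B 1
  Γ := Sym
  sym := Function.Embedding.refl _
  Λ := c.Labels
  main := c.label [c]
  σ := Option Sym
  initVar := none
  prog l := c.stmts B l.1

/-- The stacks below `B`. -/
def Store.restrict (B : ℕ) (s : Store) : Fin B → List Sym := fun i => s i

theorem Store.restrict_update {B : ℕ} [NeZero B] (s : Store) {k : ℕ} (hk : k < B) (l : List Sym) :
    Store.restrict B (Function.update s k l) =
      Function.update (Store.restrict B s) (Fin.ofNat B k) l := by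
  funext i
  have : (i = Fin.ofNat B k) ↔ (i : ℕ) = k := by
    rw [Fin.ext_iff, Fin.val_ofNat, Nat.mod_eq_of_lt hk]
  show Function.update s k l (i : ℕ) = _
  simp only [Function.update_apply, this]
  rfl

theorem Store.restrict_ofNat {B : ℕ} [NeZero B] (s : Store) {k : ℕ} (hk : k < B) :
    Store.restrict B s (Fin.ofNat B k) = s k := by
  simp [Store.restrict, Nat.mod_eq_of_lt hk]

/-- The machine steps from a label with pending commands are the small steps of the program. -/
theorem Cmd.machine_step {c : Cmd} {B : ℕ} [NeZero B] {k : Cmd} {ks : List Cmd} {s : Store}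
    (hk : k.StacksLT B) (hm : k :: ks ∈ c.conts [] ∪ {[]}) (v : Option Sym)
    (d : (c.machine B).Cfg) :
    ((c.machine B).Step ⟨some (c.label (k :: ks)), v, s.restrict B⟩ d →
      ∃ e ∈ LCfg.next (k :: ks, s), ∃ v', d = ⟨some (c.label e.1), v', Store.restrict B e.2⟩) ∧
    ∀ e ∈ LCfg.next (k :: ks, s), ∃ v', (c.machine B).Step
      ⟨some (c.label (k :: ks)), v, s.restrict B⟩
        ⟨some (c.label e.1), v', Store.restrict B e.2⟩ := by
  have key : ∀ d, (c.machine B).Step ⟨some (c.label (k :: ks)), v, s.restrict B⟩ d ↔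
      ∃ q ∈ c.stmts B (k :: ks), d = Turing.TM2.stepAux q v (s.restrict B) := by
    intro d
    constructor
    · rintro ⟨l, hl, q, hq, h⟩
      obtain rfl := Option.some.inj hl
      have hq : q ∈ c.stmts B (c.label (k :: ks)).1 := hq
      rw [Cmd.label_val hm] at hq
      exact ⟨q, hq, h⟩
    · rintro ⟨q, hq, h⟩
      refine ⟨_, rfl, q, ?_, h⟩
      show q ∈ c.stmts B (c.label (k :: ks)).1
      rwa [Cmd.label_val hm]
  simp only [key]
  cases k with
  | push k γ =>
    simp only [Cmd.StacksLT] at hk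
    simp only [Cmd.stmts, LCfg.next, List.mem_singleton, exists_eq_left, Turing.TM2.stepAux,
      forall_eq, Store.restrict_update _ hk, Store.restrict_ofNat _ hk]
    exact ⟨fun h => ⟨_, h⟩, ⟨_, rfl⟩⟩
  | pop k f =>
    simp only [Cmd.StacksLT] at hk
    simp only [Cmd.stmts, LCfg.next, List.mem_singleton, exists_eq_left, Turing.TM2.stepAux,
      forall_eq, Store.restrict_update _ hk.1, Store.restrict_ofNat _ hk.1]
    exact ⟨fun h => ⟨_, h⟩, ⟨_, rfl⟩⟩
  | loop k f =>
    simp only [Cmd.StacksLT] at hk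
    simp only [Cmd.stmts, LCfg.next, List.mem_singleton, exists_eq_left, Turing.TM2.stepAux,
      forall_eq, Store.restrict_update _ hk.1, Store.restrict_ofNat _ hk.1]
    exact ⟨fun h => ⟨_, h⟩, ⟨_, rfl⟩⟩
  | choice a b =>
    simp only [Cmd.stmts, LCfg.next, List.mem_cons, List.not_mem_nil, or_false, exists_eq_or_imp,
      exists_eq_left, Turing.TM2.stepAux]
    refine ⟨?_, ?_⟩
    · rintro (h | h)
      exacts [Or.inl ⟨_, h⟩, Or.inr ⟨_, h⟩]
    · rintro e (rfl | rfl)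
      exacts [⟨_, Or.inl rfl⟩, ⟨_, Or.inr rfl⟩]
  | _ =>
    simp only [Cmd.stmts, LCfg.next, List.mem_singleton, exists_eq_left, Turing.TM2.stepAux,
      forall_eq, List.not_mem_nil, false_and, exists_false, true_and,
      IsEmpty.forall_iff, implies_true]
    first
    | done
    | exact ⟨fun h => ⟨_, h⟩, ⟨_, rfl⟩⟩

theorem Cmd.machine_step_nil {c : Cmd} {B : ℕ} [NeZero B] {v : Option Sym} {s : Fin B → List Sym}
    (d : (c.machine B).Cfg) :
    (c.machine B).Step ⟨some (c.label []), v, s⟩ d ↔ d = ⟨none, v, s⟩ := by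
  have hm : [] ∈ c.conts [] ∪ {[]} := Or.inr rfl
  constructor
  · rintro ⟨l, hl, q, hq, h⟩
    obtain rfl := Option.some.inj hl
    have hq : q ∈ c.stmts B (c.label []).1 := hq
    rw [Cmd.label_val hm] at hq
    obtain rfl : q = .halt := List.eq_of_mem_singleton hq
    exact h
  · rintro rfl
    refine ⟨_, rfl, .halt, ?_, rfl⟩
    show _ ∈ c.stmts B (c.label []).1
    rw [Cmd.label_val hm]
    exact List.mem_singleton_self _

/-- The computations of the machine of a program are those of the program, with a last step that
halts. -/
theorem Cmd.machine_reaches {c : Cmd} {B : ℕ} [NeZero B] (hc : c.StacksLT B) {s : Store}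
    (t : ℕ) :
    (∀ d, (c.machine B).ReachesIn t ⟨some (c.label [c]), none, s.restrict B⟩ d →
      (∃ e v, Trace t ([c], s) e ∧ e.1 ∈ c.conts [] ∪ {[]} ∧ (∀ c' ∈ e.1, c'.StacksLT B) ∧
        d = ⟨some (c.label e.1), v, Store.restrict B e.2⟩) ∨
      ∃ t' s' v, t = t' + 1 ∧ Trace t' ([c], s) ([], s') ∧ d = ⟨none, v, s'.restrict B⟩) ∧
    ∀ e, Trace t ([c], s) e → e.1 ∈ c.conts [] ∪ {[]} ∧ (∀ c' ∈ e.1, c'.StacksLT B) ∧ ∃ v,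
      (c.machine B).ReachesIn t ⟨some (c.label [c]), none, s.restrict B⟩
        ⟨some (c.label e.1), v, Store.restrict B e.2⟩ := by
  have hcl : ∀ {l : List Cmd}, l ∈ c.conts [] ∪ {[]} → ∀ {s : Store} {d : LCfg},
      d ∈ LCfg.next (l, s) → d.1 ∈ c.conts [] ∪ {[]} := by
    rintro l (hl | rfl) s d hd
    · exact c.conts_closed hl hd
    · simp [LCfg.next] at hd
  induction t with
  | zero =>
    constructor
    · rintro d rfl
      exact Or.inl ⟨([c], s), none, rfl, Or.inl (c.cons_mem_conts _), by simpa using hc, rfl⟩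
    · rintro e rfl
      exact ⟨Or.inl (c.cons_mem_conts _), by simpa using hc, none, rfl⟩
  | succ t ih =>
    constructor
    · rintro d ⟨d', h', hd⟩
      rcases ih.1 d' h' with ⟨⟨l, s'⟩, v, htr, hl, hB, rfl⟩ | ⟨t', s', v, rfl, -, rfl⟩
      · rcases l with _ | ⟨k, ks⟩
        · replace hd := (Cmd.machine_step_nil _).1 hd
          exact Or.inr ⟨t, s', v, rfl, htr, hd⟩
        · obtain ⟨e, he, v', rfl⟩ := (Cmd.machine_step (hB k (by simp)) hl v d).1 hd
          exact Or.inl ⟨e, v', ⟨_, htr, he⟩, hcl hl he, Cmd.stacksLT_next hB he, rfl⟩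
      · obtain ⟨l, hl, -⟩ := hd
        simp at hl
    · rintro e ⟨⟨l, s'⟩, htr, he⟩
      obtain ⟨hl, hB, v, hr⟩ := ih.2 _ htr
      rcases l with _ | ⟨k, ks⟩
      · simp [LCfg.next] at he
      · obtain ⟨v', hv'⟩ := (Cmd.machine_step (d := ⟨none, none, fun _ => []⟩)
          (hB k (by simp)) hl v).2 e he
        exact ⟨hcl hl he, Cmd.stacksLT_next hB he, v', _, hr, hv'⟩

/-- Running time and outputs of the machine of a program. -/
theorem Cmd.machine_correct {c : Cmd} {B : ℕ} [NeZero B] (hc : c.StacksLT B) (hB : 1 < B)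
    {inp : List Sym} {T : ℕ} {R : Set Store}
    (h : Run c (Function.update (fun _ => []) 0 inp) T R) :
    (c.machine B).RunsInTime inp (T + 1) ∧
      (c.machine B).outputs inp = {o : List Sym | ∃ s ∈ R, s 1 = o} := by
  have hinit : (c.machine B).initCfg inp =
      ⟨some (c.label [c]), none, Store.restrict B (Function.update (fun _ => []) 0 inp)⟩ := by
    have hs : Function.update (fun _ : Fin B => ([] : List Sym)) (0 : Fin B) (inp.map id) =
        Store.restrict B (Function.update (fun _ => []) 0 inp) := by
      rw [List.map_id, Store.restrict_update _ (by omega)]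
      rfl
    exact congrArg (fun S : Fin B → List Sym =>
      (⟨some (c.label [c]), none, S⟩ : (c.machine B).Cfg)) hs
  have hbd : Bounded T ([c], Function.update (fun _ => []) 0 inp) := by
    refine (h.sound []).1 0 fun s' _ t d ht => ?_
    rcases t with _ | t
    · exact le_rfl
    · obtain ⟨e, he, -⟩ := trace_succ_iff.1 ht
      simp [LCfg.next] at he
  have hends : ∀ s' : Store, s' ∈ Ends ([c], Function.update (fun _ => []) 0 inp) ↔ s' ∈ R := by
    intro s'
    rw [(h.sound []).2]
    constructor
    · rintro ⟨s₁, hs₁, t, ht⟩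
      rcases t with _ | t
      · cases ht; exact hs₁
      · obtain ⟨e, he, -⟩ := trace_succ_iff.1 ht
        simp [LCfg.next] at he
    · exact fun hs => ⟨s', hs, 0, rfl⟩
  have hout : ∀ s : Store, s.restrict B (Fin.ofNat B 1) = s 1 := fun s => s.restrict_ofNat hB
  constructor
  · intro t d hd
    rw [hinit] at hd
    rcases (Cmd.machine_reaches hc t).1 d hd with ⟨e, v, htr, -⟩ | ⟨t', s', v, rfl, htr, -⟩
    · exact (hbd _ _ htr).trans (Nat.le_succ T)
    · exact Nat.succ_le_succ (hbd _ _ htr)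
  · ext o
    constructor
    · rintro ⟨t, d, hd, hn, ho⟩
      rw [hinit] at hd
      rcases (Cmd.machine_reaches hc t).1 d hd with
        ⟨e, v, htr, -, -, rfl⟩ | ⟨t', s', v, rfl, htr, rfl⟩
      · simp at hn
      · exact ⟨s', (hends s').1 ⟨_, htr⟩, (hout s').symm.trans ho⟩
    · rintro ⟨s', hs', rfl⟩
      obtain ⟨t, ht⟩ := (hends s').2 hs'
      obtain ⟨-, -, v, hr⟩ := (Cmd.machine_reaches hc t).2 _ ht
      refine ⟨t + 1, ⟨none, v, s'.restrict B⟩, ?_, rfl, hout s'⟩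
      rw [hinit]
      exact ⟨_, hr, (Cmd.machine_step_nil _).2 rfl⟩

/-! ### Arithmetic expressions over tapes and their evaluation by stack programs -/

theorem eval_mono_nat (p : Polynomial ℕ) {a b : ℕ} (h : a ≤ b) : p.eval a ≤ p.eval b := by
  rw [Polynomial.eval_eq_sum, Polynomial.eval_eq_sum]
  exact Finset.sum_le_sum fun i _ => Nat.mul_le_mul_left _ (Nat.pow_le_pow_left h i)

theorem Run.seq_det {a b : Cmd} {s s₁ s₂ : Store} {T₁ T₂ T : ℕ} (ha : Run a s T₁ {s₁})
    (hb : Run b s₁ T₂ {s₂}) (hT : T₁ + T₂ + 1 ≤ T) : Run (.seq a b) s T {s₂} := by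
  have := Run.seq (R₂ := fun _ => {s₂}) ha (by rintro s' rfl; exact hb)
  simp only [Set.mem_singleton_iff, Set.iUnion_iUnion_eq_left] at this
  exact this.mono hT

/-- A loop whose body is deterministic; `σ l` is the store when `l` is left on the stack `k`. -/
theorem Run.loop_det {k : ℕ} {f : Sym → Cmd} {T : ℕ} (σ : List Sym → Store) (l : List Sym)
    (hk : ∀ l, σ l k = l)
    (h : ∀ γ l', γ :: l' <:+ l → Run (f γ) (Function.update (σ (γ :: l')) k l') T {σ l'}) :
    Run (.loop k f) (σ l) (l.length * (T + 1) + 1) {σ []} := by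
  induction l with
  | nil => exact (Run.loop_nil (hk [])).mono (by simp)
  | cons γ l ih =>
    have h2 := ih fun γ' l' h' => h γ' l' (h'.trans (List.suffix_cons γ l))
    have h3 := Run.loop_cons (R₂ := fun _ => {σ []}) (hk (γ :: l)) (h γ l (List.suffix_refl _))
      (by rintro s' rfl; exact h2)
    simp only [Set.mem_singleton_iff, Set.iUnion_iUnion_eq_left] at h3
    exact h3.mono (by simp only [List.length_cons]; ring_nf; omega)

theorem Run.loop_det' {k : ℕ} {f : Sym → Cmd} {T T' : ℕ} {s s' : Store} (σ : List Sym → Store)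
    (l : List Sym) (hs : s = σ l) (hs' : s' = σ []) (hk : ∀ l, σ l k = l)
    (h : ∀ γ l', γ :: l' <:+ l → Run (f γ) (Function.update (σ (γ :: l')) k l') T {σ l'})
    (hT : l.length * (T + 1) + 1 ≤ T') :
    Run (.loop k f) s T' {s'} := by
  subst hs hs'
  exact (Run.loop_det σ l hk h).mono hT

/-- The list `1 ⋯ 1` of length `n`. -/
abbrev unary (n : ℕ) : List Sym := List.replicate n Sym.one

theorem unary_add (a b : ℕ) : unary (a + b) = unary a ++ unary b :=
  List.replicate_add ..

/-- Move the stack `k` to the stack `d`. -/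
def Cmd.move (k d : ℕ) : Cmd := .loop k fun γ => .push d γ

theorem Cmd.run_move {k d : ℕ} (h : k ≠ d) (s : Store) :
    Run (Cmd.move k d) s ((s k).length * 2 + 1)
      {Function.update (Function.update s k []) d ((s k).reverse ++ s d)} := by
  refine Run.loop_det' (T := 1) (fun l => Function.update (Function.update s k l) d
      (((s k).take ((s k).length - l.length)).reverse ++ s d)) (s k) ?_ ?_ ?_ ?_ le_rfl
  · simp
  · simp
  · intro l; simp [h]
  · intro γ l' hl'
    have : (s k).take ((s k).length - l'.length) =
        (s k).take ((s k).length - (γ :: l').length) ++ [γ] := by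
      obtain ⟨p, hp⟩ := hl'
      rw [← hp]
      simp only [List.length_append, List.length_cons]
      rw [Nat.add_sub_cancel, show p.length + (l'.length + 1) - l'.length = p.length + 1 by omega,
        List.take_length_add_append, List.take_left]
      simp
    convert Run.push d γ _ using 2
    rw [this]
    funext j
    simp only [Function.update_apply]
    split_ifs <;> simp_all

/-- Add the length of the stack `k` in unary to the stack `d`; the stack `f` is auxiliary. -/
def Cmd.measure (k d f : ℕ) : Cmd :=
  .seq (.move k f) (.loop f fun γ => .seq (.push k γ) (.push d Sym.one))

theorem Cmd.run_measure {k d f : ℕ} (hkd : k ≠ d) (hkf : k ≠ f) (hdf : d ≠ f) (s : Store)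
    (hf : s f = []) {T : ℕ} (hT : (s k).length * 6 + 3 ≤ T) :
    Run (Cmd.measure k d f) s T {Function.update s d (unary (s k).length ++ s d)} := by
  refine Run.seq_det (Cmd.run_move hkf s) (Run.loop_det' (T := 3) (T' := (s k).length * 4 + 1)
    (fun l => Function.update (Function.update (Function.update s f l) k
      ((s k).drop l.length)) d (unary ((s k).length - l.length) ++ s d)) (s k).reverse
      ?_ ?_ ?_ ?_ ?_) (by omega)
  · funext j
    simp only [Function.update_apply]
    split_ifs <;> simp_all
  · funext j
    simp only [Function.update_apply]
    split_ifs <;> simp_all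
  · intro l; simp [hdf.symm, hkf.symm]
  · intro γ l' hl'
    have h1 : γ :: (s k).drop (γ :: l').length = (s k).drop l'.length := by
      obtain ⟨p, hp⟩ := hl'
      have hp : s k = l'.reverse ++ γ :: p.reverse := by
        rw [← List.reverse_reverse (s k), ← hp]; simp
      have h₁ : (l'.reverse ++ γ :: p.reverse).drop l'.length = γ :: p.reverse :=
        List.drop_left' (by simp)
      have h₂ : (l'.reverse ++ γ :: p.reverse).drop (γ :: l').length = p.reverse := by
        rw [show l'.reverse ++ γ :: p.reverse = (l'.reverse ++ [γ]) ++ p.reverse by simp]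
        exact List.drop_left' (by simp)
      rw [hp, h₁, h₂]
    have h2 : (s k).length - l'.length = (s k).length - (γ :: l').length + 1 := by
      have := hl'.length_le
      simp only [List.length_cons, List.length_reverse] at this ⊢
      omega
    refine Run.seq_det (Run.push k γ _) (?_ : Run _ _ 1 _) le_rfl
    convert Run.push d Sym.one _ using 2
    rw [h2, ← h1]
    funext j
    simp only [Function.update_apply]
    split_ifs <;> simp_all [List.replicate_succ]
  · simp

/-- `scons a ρ` is the sequence `a, ρ 0, ρ 1, …`. -/
def scons (a : ℕ) (ρ : ℕ → ℕ) : ℕ → ℕ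
  | 0 => a
  | i + 1 => ρ i

/-- Expressions for natural numbers. The variables are de Bruijn indices; `sum b e` is the sum of
the values of `e` for the values of the variable `0` below the value of `b`; `rd t s e` is `1` or
`0`, according to whether the tape `t` has the symbol `s` at position `e`; `len t` is the length of
the tape `t`. -/
inductive Ex
  | var (i : ℕ)
  | one
  | add (a b : Ex)
  | sub (a b : Ex)
  | sum (b e : Ex)
  | rd (t : ℕ) (s : Sym) (e : Ex)
  | len (t : ℕ)

open Classical in
/-- The value of an expression on tapes `τ` with the values `ρ` of the variables. -/
noncomputable def Ex.eval (τ : Store) : Ex → (ℕ → ℕ) → ℕ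
  | .var i, ρ => ρ i
  | .one, _ => 1
  | .add a b, ρ => a.eval τ ρ + b.eval τ ρ
  | .sub a b, ρ => a.eval τ ρ - b.eval τ ρ
  | .sum b e, ρ => ∑ i ∈ Finset.range (b.eval τ ρ), e.eval τ (scons i ρ)
  | .rd t s e, ρ => if (τ t)[e.eval τ ρ]? = some s then 1 else 0
  | .len t, _ => (τ t).length

/-- The tapes of the expression have numbers below `m`. -/
def Ex.TapesLT (m : ℕ) : Ex → Prop
  | .var _ => True
  | .one => True
  | .add a b => a.TapesLT m ∧ b.TapesLT m
  | .sub a b => a.TapesLT m ∧ b.TapesLT m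
  | .sum b e => b.TapesLT m ∧ e.TapesLT m
  | .rd t _ e => t < m ∧ e.TapesLT m
  | .len t => t < m

open Classical in
/-- The program that adds the value of the expression in unary to the stack `d`. The variable `i`
is on the stack `env i`, and the stacks from `f` on are auxiliary. -/
noncomputable def Ex.comp : Ex → (ℕ → ℕ) → ℕ → ℕ → Cmd
  | .var i, env, d, f => .measure (env i) d f
  | .one, _, d, _ => .push d Sym.one
  | .add a b, env, d, f => .seq (a.comp env d f) (b.comp env d f)
  | .sub a b, env, d, f =>
      .seq (a.comp env f (f + 1)) (.seq (b.comp env (f + 1) (f + 2))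
        (.seq (.loop (f + 1) fun _ => .pop f fun _ => .skip) (.move f d)))
  | .sum b e, env, d, f =>
      .seq (b.comp env f (f + 1)) (.seq
        (.loop f fun _ => .seq (e.comp (scons (f + 1) env) d (f + 2)) (.push (f + 1) Sym.one))
        (.loop (f + 1) fun _ => .skip))
  | .rd t s e, env, d, f =>
      .seq (e.comp env f (f + 1)) (.seq
        (.loop f fun _ => .pop t fun o => o.elim .skip fun γ => .push (f + 1) γ) (.seq
          (.pop t fun o => o.elim .skip fun γ =>
            .seq (.push t γ) (if γ = s then .push d Sym.one else .skip))
          (.move (f + 1) t)))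
  | .len t, _, d, f => .measure t d f

/-- The store `s` represents the tapes `τ` below `m` and the values `ρ` of the variables, with the
stacks from `f` on empty and the stack `d` available for the result. -/
structure Store.Represents (m : ℕ) (τ : Store) (ρ env : ℕ → ℕ) (d f : ℕ) (s : Store) : Prop where
  tape : ∀ t < m, s t = τ t
  var : ∀ i, s (env i) = unary (ρ i)
  le_env : ∀ i, m ≤ env i
  env_lt : ∀ i, env i < f
  env_ne : ∀ i, d ≠ env i
  le_d : m ≤ d
  d_lt : d < f
  empty : ∀ k, f ≤ k → s k = []

namespace Store.Represents

variable {m : ℕ} {τ : Store} {ρ env : ℕ → ℕ} {d f : ℕ} {s : Store}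

theorem update (h : Store.Represents m τ ρ env d f s) (X : List Sym) :
    Store.Represents m τ ρ env d f (Function.update s d X) where
  tape t ht := by rw [Function.update_of_ne (by have := h.le_d; omega), h.tape t ht]
  var i := by rw [Function.update_of_ne (h.env_ne i).symm, h.var i]
  le_env := h.le_env
  env_lt := h.env_lt
  env_ne := h.env_ne
  le_d := h.le_d
  d_lt := h.d_lt
  empty k hk := by rw [Function.update_of_ne (by have := h.d_lt; omega), h.empty k hk]

/-- The first auxiliary stack becomes the stack for results. -/
theorem fresh (h : Store.Represents m τ ρ env d f s) : Store.Represents m τ ρ env f (f + 1) s where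
  tape := h.tape
  var := h.var
  le_env := h.le_env
  env_lt i := (h.env_lt i).trans (Nat.lt_succ_self f)
  env_ne i := (h.env_lt i).ne'
  le_d := h.le_d.trans h.d_lt.le
  d_lt := Nat.lt_succ_self f
  empty k hk := h.empty k (by omega)

/-- The second auxiliary stack becomes the stack of a new variable; the first one is a counter. -/
theorem bind (h : Store.Represents m τ ρ env d f s) (l X : List Sym) (i : ℕ) :
    Store.Represents m τ (scons i ρ) (scons (f + 1) env) d (f + 2)
      (Function.update (Function.update (Function.update s f l) (f + 1) (unary i)) d X) where
  tape t ht := by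
    have := h.le_d
    have := h.d_lt
    rw [Function.update_of_ne (by omega), Function.update_of_ne (by omega),
      Function.update_of_ne (by omega), h.tape t ht]
  var j := by
    have := h.d_lt
    cases j with
    | zero =>
      show (Function.update (Function.update (Function.update s f l) (f + 1) (unary i)) d X : Store)
        (f + 1) = unary i
      rw [Function.update_of_ne (by omega), Function.update_self]
    | succ j =>
      have := h.env_lt j
      have := h.env_ne j
      show (Function.update (Function.update (Function.update s f l) (f + 1) (unary i)) d X : Store)
        (env j) = unary (ρ j)
      rw [Function.update_of_ne (by omega), Function.update_of_ne (by omega),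
        Function.update_of_ne (by omega), h.var j]
  le_env j := by
    cases j with
    | zero => have := h.le_d; have := h.d_lt; show m ≤ f + 1; omega
    | succ j => exact h.le_env j
  env_lt j := by
    cases j with
    | zero => show f + 1 < f + 2; omega
    | succ j => exact (h.env_lt j).trans (by omega)
  env_ne j := by
    cases j with
    | zero => have := h.d_lt; show d ≠ f + 1; omega
    | succ j => exact h.env_ne j
  le_d := h.le_d
  d_lt := h.d_lt.trans (by omega)
  empty k hk := by
    have := h.d_lt
    rw [Function.update_of_ne (by omega), Function.update_of_ne (by omega),
      Function.update_of_ne (by omega), h.empty k (by omega)]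

end Store.Represents

theorem Cmd.run_clear (k : ℕ) (s : Store) :
    Run (.loop k fun _ => .skip) s ((s k).length * 2 + 1) {Function.update s k []} := by
  refine Run.loop_det' (T := 1) (fun l => Function.update s k l) (s k) ?_ ?_ ?_ ?_ le_rfl
  · simp
  · simp
  · intro l; simp
  · intro γ l' hl'
    convert Run.skip _ using 2
    simp

/-- The loop of the program of a difference. -/
theorem Cmd.run_truncated_sub {f a b : ℕ} {s : Store} (ha : s f = unary a)
    (hb : s (f + 1) = unary b) :
    Run (.loop (f + 1) fun _ => .pop f fun _ => .skip) s (b * 3 + 1)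
      {Function.update (Function.update s (f + 1) []) f (unary (a - b))} := by
  refine Run.loop_det' (T := 2) (fun l => Function.update (Function.update s (f + 1) l) f
    (unary (a - (b - l.length)))) (unary b) ?_ ?_ ?_ ?_ (by simp)
  · funext j
    simp only [Function.update_apply]
    split_ifs <;> simp_all
  · simp
  · intro l; simp
  · intro γ l' hl'
    have h1 := hl'.length_le
    simp only [List.length_cons, List.length_replicate] at h1
    refine Run.pop (T := 1) ?_
    have e1 : Function.update (Function.update (Function.update s (f + 1) (γ :: l')) f
        (unary (a - (b - (γ :: l').length)))) (f + 1) l' f =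
        unary (a - (b - (γ :: l').length)) := by
      rw [Function.update_of_ne (by omega), Function.update_self]
    have e2 : a - (b - l'.length) = a - (b - (γ :: l').length) - 1 := by
      simp only [List.length_cons]; omega
    convert Run.skip _ using 2
    rw [e1, List.tail_replicate, e2]
    funext j
    simp only [Function.update_apply]
    split_ifs <;> rfl

/-- Moving the head of a tape: the first `n` symbols are moved to an auxiliary stack. -/
theorem Cmd.run_seek {t f n : ℕ} {s : Store} (htf : t < f) (hn : s f = unary n)
    (h1 : s (f + 1) = []) :
    Run (.loop f fun _ => .pop t fun o => o.elim .skip fun γ => .push (f + 1) γ) s (n * 3 + 1)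
      {Function.update (Function.update (Function.update s f []) t ((s t).drop n)) (f + 1)
        ((s t).take n).reverse} := by
  refine Run.loop_det' (T := 2) (fun l => Function.update (Function.update (Function.update s f l)
    t ((s t).drop (n - l.length))) (f + 1) ((s t).take (n - l.length)).reverse) (unary n)
    ?_ ?_ ?_ ?_ (by simp)
  · funext j
    simp only [Function.update_apply]
    split_ifs <;> simp_all
  · simp
  · intro l
    rw [Function.update_of_ne (by omega), Function.update_of_ne (by omega), Function.update_self]
  · intro γ l' hl'
    have h2 := hl'.length_le
    simp only [List.length_cons, List.length_replicate] at h2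
    have h3 : n - l'.length = n - (l'.length + 1) + 1 := by omega
    refine Run.pop (T := 1) ?_
    simp only [List.length_cons]
    generalize hq : n - (l'.length + 1) = q at *
    have e1 : Function.update (Function.update (Function.update (Function.update s f (γ :: l'))
        t ((s t).drop q)) (f + 1) ((s t).take q).reverse) f l' t = (s t).drop q := by
      rw [Function.update_of_ne (by omega), Function.update_of_ne (by omega), Function.update_self]
    rw [e1, h3]
    cases hx : (s t).drop q with
    | nil =>
      have hlen : (s t).length ≤ q := List.drop_eq_nil_iff.1 hx
      show Run .skip _ _ _
      convert Run.skip _ using 2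
      rw [List.drop_eq_nil_of_le (by omega), List.take_of_length_le (by omega),
        List.take_of_length_le hlen]
      funext j
      simp only [Function.update_apply, List.tail_nil]
      split_ifs <;> first | rfl | omega
    | cons x r =>
      have h4 : (s t).drop (q + 1) = r := by rw [← List.tail_drop, hx]; rfl
      have h5 : (s t).take (q + 1) = (s t).take q ++ [x] := by
        have h6 : (s t)[q]? = some x := by rw [← List.head?_drop, hx]; rfl
        rw [List.take_add_one, h6]; rfl
      show Run (.push (f + 1) x) _ _ _
      convert Run.push (f + 1) x _ using 2
      rw [h4, h5]
      funext j
      simp only [Function.update_apply, List.tail_cons, List.reverse_append, List.reverse_singleton,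
        List.singleton_append]
      split_ifs <;> first | rfl | omega

open Classical in
/-- The program of an expression computes its value, and both the value and the running time are
bounded by a polynomial in the lengths of the tapes and the values of the variables. -/
theorem Ex.run_comp {m : ℕ} (e : Ex) (he : e.TapesLT m) : ∃ p : Polynomial ℕ,
    ∀ (τ : Store) (ρ env : ℕ → ℕ) (d f : ℕ) (s : Store) (M : ℕ),
      Store.Represents m τ ρ env d f s → (∀ t < m, (τ t).length ≤ M) → (∀ i, ρ i ≤ M) →
      e.eval τ ρ ≤ p.eval M ∧
        Run (e.comp env d f) s (p.eval M)
          {Function.update s d (unary (e.eval τ ρ) ++ s d)} := by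
  induction e with
  | var i =>
    refine ⟨Polynomial.X * 6 + 3, fun τ ρ env d f s M h hτ hρ => ?_⟩
    simp only [Polynomial.eval_add, Polynomial.eval_mul, Polynomial.eval_X, Polynomial.eval_ofNat,
      Ex.eval, Ex.comp]
    have hi := hρ i
    refine ⟨by omega, ?_⟩
    have h1 := h.env_lt i
    have h2 := Cmd.run_measure (T := M * 6 + 3) (h.env_ne i).symm (by omega) h.d_lt.ne s
      (h.empty f le_rfl) (by rw [h.var i, List.length_replicate]; omega)
    rwa [h.var i, List.length_replicate] at h2
  | one =>
    refine ⟨1, fun τ ρ env d f s M h hτ hρ => ?_⟩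
    simp only [Polynomial.eval_one, Ex.eval, Ex.comp]
    exact ⟨le_rfl, Run.push _ _ _⟩
  | add a b iha ihb =>
    obtain ⟨p, hp⟩ := iha he.1
    obtain ⟨q, hq⟩ := ihb he.2
    refine ⟨p + q + 1, fun τ ρ env d f s M h hτ hρ => ?_⟩
    simp only [Polynomial.eval_add, Polynomial.eval_one, Ex.eval, Ex.comp]
    obtain ⟨h1, h2⟩ := hp τ ρ env d f s M h hτ hρ
    obtain ⟨h3, h4⟩ := hq τ ρ env d f _ M (h.update _) hτ hρ
    refine ⟨by omega, Run.seq_det h2 ?_ le_rfl⟩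
    convert h4 using 2
    rw [Function.update_idem, Function.update_self, ← List.append_assoc,
      List.replicate_append_replicate, add_comm (a.eval τ ρ)]
  | sub a b iha ihb =>
    obtain ⟨p, hp⟩ := iha he.1
    obtain ⟨q, hq⟩ := ihb he.2
    refine ⟨p * 3 + q * 4 + 5, fun τ ρ env d f s M h hτ hρ => ?_⟩
    simp only [Polynomial.eval_add, Polynomial.eval_mul, Polynomial.eval_ofNat, Ex.eval, Ex.comp]
    obtain ⟨h1, h2⟩ := hp τ ρ env f (f + 1) s M h.fresh hτ hρ
    obtain ⟨h3, h4⟩ := hq τ ρ env (f + 1) (f + 2)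
      (Function.update s f (unary (a.eval τ ρ) ++ s f)) M
      (h.fresh.update _).fresh hτ hρ
    have hdf := h.d_lt
    have e0 := h.empty f le_rfl
    have e1 := h.empty (f + 1) (by omega)
    generalize a.eval τ ρ = va at *
    generalize b.eval τ ρ = vb at *
    rw [e0, List.append_nil] at h2 h4
    rw [Function.update_of_ne (by omega), e1, List.append_nil] at h4
    refine ⟨by omega, Run.seq_det (T₂ := p.eval M * 2 + q.eval M * 4 + 4) h2
      (Run.seq_det (T₂ := p.eval M * 2 + q.eval M * 3 + 3) h4
      (Run.seq_det (T₁ := q.eval M * 3 + 1) (T₂ := p.eval M * 2 + 1)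
        ((Cmd.run_truncated_sub (a := va)
        (b := vb) ?_ ?_).mono (by omega)) ?_ (by omega)) (by omega)) (by omega)⟩
    · rw [Function.update_of_ne (by omega), Function.update_self]
    · rw [Function.update_self]
    · have h5 := Cmd.run_move (k := f) (d := d) hdf.ne'
        (Function.update (Function.update (Function.update (Function.update s f (unary va)) (f + 1)
          (unary vb)) (f + 1) []) f (unary (va - vb)))
      refine (?_ : Run _ _ _ _).mono (T := (va - vb) * 2 + 1) (by omega)
      convert h5 using 2
      · rw [Function.update_self, List.length_replicate]
      · rw [Function.update_self]
        funext j
        simp only [Function.update_apply, List.reverse_replicate]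
        split_ifs <;> first | rfl | omega | simp_all
  | sum b e ihb ihe =>
    obtain ⟨p, hp⟩ := ihb he.1
    obtain ⟨q, hq⟩ := ihe he.2
    refine ⟨p + p * (q.comp (Polynomial.X + p) + 3) + 1 + p * 2 + 3 + p * q.comp (Polynomial.X + p),
      fun τ ρ env d f s M h hτ hρ => ?_⟩
    simp only [Polynomial.eval_add, Polynomial.eval_mul, Polynomial.eval_ofNat, Ex.eval, Ex.comp,
      Polynomial.eval_comp, Polynomial.eval_X, Polynomial.eval_one]
    obtain ⟨h1, h2⟩ := hp τ ρ env f (f + 1) s M h.fresh hτ hρ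
    generalize b.eval τ ρ = vb at *
    have hdf := h.d_lt
    have e0 := h.empty f le_rfl
    have e1 := h.empty (f + 1) (by omega)
    rw [e0, List.append_nil] at h2
    set P := p.eval M
    set Q := q.eval (M + P)
    -- the store when the counter is `l`: the values of the variable so far are `0, …, vb - l - 1`
    let σ : List Sym → Store := fun l =>
      Function.update (Function.update (Function.update s f l) (f + 1) (unary (vb - l.length))) d
        (unary (∑ i ∈ Finset.range (vb - l.length), e.eval τ (scons i ρ)) ++ s d)
    have hbody : ∀ i < vb, ∀ l X,
        e.eval τ (scons i ρ) ≤ Q ∧ Run (e.comp (scons (f + 1) env) d (f + 2))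
          (Function.update (Function.update (Function.update s f l) (f + 1) (unary i)) d X) Q
          {Function.update (Function.update (Function.update s f l) (f + 1) (unary i)) d
            (unary (e.eval τ (scons i ρ)) ++ X)} := by
      intro i hi l X
      have h3 := hq τ (scons i ρ) (scons (f + 1) env) d (f + 2) _ (M + P) (h.bind l X i)
        (fun t ht => (hτ t ht).trans (by omega)) (by
          rintro (_ | j)
          · show i ≤ _; omega
          · show ρ j ≤ _; have := hρ j; omega)
      rw [Function.update_self, Function.update_idem] at h3
      exact h3
    have hval : ∑ i ∈ Finset.range vb, e.eval τ (scons i ρ) ≤ P * Q :=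
      calc _ ≤ ∑ i ∈ Finset.range vb, Q :=
            Finset.sum_le_sum fun i hi => (hbody i (Finset.mem_range.1 hi) [] []).1
        _ = vb * Q := by simp
        _ ≤ _ := Nat.mul_le_mul_right _ h1
    refine ⟨by omega, (?_ : Run _ _ (P + P * (Q + 3) + 1 + P * 2 + 3) _).mono (by omega)⟩
    refine Run.seq_det (T₂ := P * (Q + 3) + 1 + P * 2 + 2) h2
      (Run.seq_det (T₁ := P * (Q + 3) + 1) (T₂ := P * 2 + 1) (s₁ := σ [])
        (Run.loop_det' (T := Q + 2) σ (unary vb) ?_ rfl ?_ ?_ ?_) ?_ (by omega)) (by omega)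
    · funext j
      simp only [σ, Function.update_apply, List.length_replicate, Nat.sub_self, Finset.range_zero,
        Finset.sum_empty, List.replicate_zero, List.nil_append]
      split_ifs <;> first | omega | simp_all
    · intro l
      simp only [σ]
      rw [Function.update_of_ne (by omega), Function.update_of_ne (by omega), Function.update_self]
    · intro γ l hl
      have h4 := hl.length_le
      simp only [List.length_cons, List.length_replicate] at h4
      obtain ⟨-, h5⟩ := hbody (vb - (l.length + 1)) (by omega) l
        (unary (∑ i ∈ Finset.range (vb - (l.length + 1)), e.eval τ (scons i ρ)) ++ s d)
      have h6 : vb - l.length = vb - (l.length + 1) + 1 := by omega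
      have h7 : Run (e.comp (scons (f + 1) env) d (f + 2)) (Function.update (σ (γ :: l)) f l) Q
          {Function.update (Function.update (Function.update s f l) (f + 1)
            (unary (vb - (l.length + 1)))) d
              (unary (∑ i ∈ Finset.range (vb - l.length), e.eval τ (scons i ρ)) ++ s d)} := by
        have h8 : Function.update (σ (γ :: l)) f l = Function.update (Function.update
            (Function.update s f l) (f + 1) (unary (vb - (l.length + 1)))) d
            (unary (∑ i ∈ Finset.range (vb - (l.length + 1)), e.eval τ (scons i ρ)) ++ s d) := by
          funext j
          simp only [σ, Function.update_apply, List.length_cons]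
          split_ifs <;> first | rfl | omega
        rw [h8, h6, Finset.sum_range_succ, add_comm (Finset.sum _ _), unary_add, List.append_assoc]
        exact h5
      refine Run.seq_det h7 (?_ : Run _ _ 1 _) le_rfl
      convert Run.push (f + 1) Sym.one _ using 2
      funext j
      simp only [σ, Function.update_apply, h6]
      split_ifs <;> first | rfl | omega
    · rw [List.length_replicate]
      exact Nat.add_le_add_right (Nat.mul_le_mul_right _ h1) 1
    · have h7 := Cmd.run_clear (f + 1) (σ [])
      have h8 : σ [] (f + 1) = unary vb := by
        simp only [σ, List.length_nil, Nat.sub_zero]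
        rw [Function.update_of_ne (by omega), Function.update_self]
      rw [h8, List.length_replicate] at h7
      refine (?_ : Run _ _ _ _).mono (T := vb * 2 + 1) (by omega)
      convert h7 using 2
      funext j
      simp only [σ, Function.update_apply, List.length_nil, Nat.sub_zero]
      split_ifs <;> first | rfl | omega | simp_all
  | rd t a e ih =>
    obtain ⟨p, hp⟩ := ih he.2
    refine ⟨p * 6 + Polynomial.X * 2 + 20, fun τ ρ env d f s M h hτ hρ => ?_⟩
    simp only [Polynomial.eval_add, Polynomial.eval_mul, Polynomial.eval_ofNat, Ex.eval, Ex.comp,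
      Polynomial.eval_X]
    obtain ⟨h1, h2⟩ := hp τ ρ env f (f + 1) s M h.fresh hτ hρ
    generalize e.eval τ ρ = v at *
    have hdf := h.d_lt
    have htd : t < d := he.1.trans_le h.le_d
    have e0 := h.empty f le_rfl
    have e1 := h.empty (f + 1) (by omega)
    have et := h.tape t he.1
    have hM := hτ t he.1
    rw [e0, List.append_nil] at h2
    refine ⟨by split_ifs <;> omega, ?_⟩
    have h3 := Cmd.run_seek (t := t) (f := f) (n := v) (s := Function.update s f (unary v))
      (by omega) (by rw [Function.update_self]) (by rw [Function.update_of_ne (by omega), e1])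
    rw [Function.update_idem, Function.update_of_ne (show t ≠ f by omega), et] at h3
    set s1 : Store := Function.update (Function.update (Function.update s f []) t ((τ t).drop v))
      (f + 1) ((τ t).take v).reverse with hs1
    have h4 : Run (.pop t fun o => o.elim .skip fun γ =>
        .seq (.push t γ) (if γ = a then .push d Sym.one else .skip)) s1 4
        {Function.update s1 d (unary (if (τ t)[v]? = some a then 1 else 0) ++ s d)} := by
      have e2 : s1 t = (τ t).drop v := by
        rw [hs1, Function.update_of_ne (by omega), Function.update_self]
      have e3 : s1 d = s d := by
        rw [hs1, Function.update_of_ne (by omega), Function.update_of_ne (by omega),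
          Function.update_of_ne (by omega)]
      refine Run.pop (T := 3) ?_
      rw [e2, List.head?_drop]
      cases hx : (τ t)[v]? with
      | none =>
        show Run .skip _ _ _
        refine Run.mono (T := 1) ?_ (by omega)
        convert Run.skip _ using 2
        have h5 : (τ t).drop v = [] := by
          rw [List.drop_eq_nil_iff]; exact List.getElem?_eq_none_iff.1 hx
        rw [h5, List.tail_nil, ← h5, ← e2, Function.update_eq_self]
        simp [← e3]
      | some x =>
        have h6 : (τ t).drop v = x :: ((τ t).drop v).tail := by
          cases hy : (τ t).drop v with
          | nil => rw [← List.head?_drop, hy] at hx; simp at hx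
          | cons y r => rw [← List.head?_drop, hy] at hx; simp at hx; simp [hx]
        show Run (.seq (.push t x) (if x = a then .push d Sym.one else .skip)) _ _ _
        refine Run.seq_det (T₁ := 1) (T₂ := 1) (s₁ := s1) ?_ ?_ le_rfl
        · convert Run.push t x _ using 2
          rw [Function.update_self, Function.update_idem, ← h6, ← e2, Function.update_eq_self]
        · by_cases hxa : x = a
          · subst hxa
            simp only [if_true]
            convert Run.push d _ _ using 2
            rw [e3]; rfl
          · have : ¬ some x = some a := fun h => hxa (Option.some.inj h)
            simp only [hxa, if_false, Option.some.injEq]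
            convert Run.skip _ using 2
            simp [← e3]
    have h5 := Cmd.run_move (k := f + 1) (d := t) (by omega)
      (Function.update s1 d (unary (if (τ t)[v]? = some a then 1 else 0) ++ s d))
    have e4 : Function.update s1 d (unary (if (τ t)[v]? = some a then 1 else 0) ++ s d) (f + 1) =
        ((τ t).take v).reverse := by
      rw [Function.update_of_ne (by omega), hs1, Function.update_self]
    have e5 : Function.update s1 d (unary (if (τ t)[v]? = some a then 1 else 0) ++ s d) t =
        (τ t).drop v := by
      rw [Function.update_of_ne (by omega), hs1, Function.update_of_ne (by omega),
        Function.update_self]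
    rw [e4, e5, List.reverse_reverse, List.take_append_drop, List.length_reverse] at h5
    have h6 : ((τ t).take v).length ≤ M := by rw [List.length_take]; omega
    refine Run.seq_det (T₂ := v * 3 + 1 + (4 + (M * 2 + 1) + 1) + 1) h2
      (Run.seq_det (T₂ := 4 + (M * 2 + 1) + 1) h3 (Run.seq_det h4 ((?_ : Run _ _ _ _).mono
      (T := ((τ t).take v).length * 2 + 1) (T' := M * 2 + 1) (by omega)) le_rfl) le_rfl) (by omega)
    convert h5 using 2
    rw [hs1, ← et]
    funext j
    simp only [Function.update_apply]
    split_ifs <;> first | rfl | omega | simp_all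
  | len t =>
    refine ⟨Polynomial.X * 6 + 3, fun τ ρ env d f s M h hτ hρ => ?_⟩
    simp only [Polynomial.eval_add, Polynomial.eval_mul, Polynomial.eval_X, Polynomial.eval_ofNat,
      Ex.eval, Ex.comp]
    have ht : t < m := he
    have hi := hτ t ht
    refine ⟨by omega, ?_⟩
    have h1 := h.d_lt
    have h3 := h.le_d
    have h2 := Cmd.run_measure (k := t) (d := d) (f := f) (T := M * 6 + 3) (by omega) (by omega)
      h.d_lt.ne s (h.empty f le_rfl) (by rw [h.tape t ht]; omega)
    rwa [h.tape t ht] at h2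

/-! ### Guess-and-check programs -/

theorem Cmd.exists_stacksLT (c : Cmd) : ∃ B, ∀ B', B ≤ B' → c.StacksLT B' := by
  induction c with
  | skip => exact ⟨0, fun _ _ => trivial⟩
  | push k γ => exact ⟨k + 1, fun _ h => h⟩
  | pop k f ih =>
    choose g hg using ih
    obtain ⟨b, hb⟩ := (Set.finite_range g).bddAbove
    exact ⟨max (k + 1) b, fun B' h => ⟨(le_max_left _ _).trans h, fun o =>
      hg o B' ((hb ⟨o, rfl⟩).trans ((le_max_right _ _).trans h))⟩⟩
  | seq a b iha ihb =>
    obtain ⟨A, hA⟩ := iha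
    obtain ⟨B, hB⟩ := ihb
    exact ⟨max A B, fun B' h => ⟨hA _ ((le_max_left _ _).trans h),
      hB _ ((le_max_right _ _).trans h)⟩⟩
  | loop k f ih =>
    choose g hg using ih
    obtain ⟨b, hb⟩ := (Set.finite_range g).bddAbove
    exact ⟨max (k + 1) b, fun B' h => ⟨(le_max_left _ _).trans h, fun o =>
      hg o B' ((hb ⟨o, rfl⟩).trans ((le_max_right _ _).trans h))⟩⟩
  | choice a b iha ihb =>
    obtain ⟨A, hA⟩ := iha
    obtain ⟨B, hB⟩ := ihb
    exact ⟨max A B, fun B' h => ⟨hA _ ((le_max_left _ _).trans h),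
      hB _ ((le_max_right _ _).trans h)⟩⟩
  | fail => exact ⟨0, fun _ _ => trivial⟩

theorem Run.congr {c : Cmd} {s : Store} {T : ℕ} {R R' : Set Store} (h : Run c s T R)
    (hR : ∀ s', s' ∈ R' ↔ s' ∈ R) : Run c s T R' :=
  Set.ext hR ▸ h

/-- A word over the symbols `0`, `1` and the separator, of length at most `b`. -/
def Guessable (b : ℕ) (g : List Sym) : Prop :=
  g.length ≤ b ∧ ∀ x ∈ g, x = Sym.zero ∨ x = Sym.one ∨ x = Sym.sep

/-- Guess at most one symbol and push it to the stack `t`. -/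
def Cmd.guessSymbol (t : ℕ) : Cmd :=
  .choice .skip (.choice (.push t Sym.zero) (.choice (.push t Sym.one) (.push t Sym.sep)))

theorem Cmd.run_guessSymbol (t : ℕ) (s : Store) :
    Run (Cmd.guessSymbol t) s 4
      {s' | ∃ g, Guessable 1 g ∧ s' = Function.update s t (g ++ s t)} := by
  have h := Run.choice ((Run.skip s).mono (T' := 3) (by omega)) (Run.choice
    ((Run.push t Sym.zero s).mono (T' := 2) (by omega))
    (Run.choice (Run.push t Sym.one s) (Run.push t Sym.sep s)))
  refine Run.congr h fun s' => ?_
  simp only [Set.mem_ofPred_eq, Set.mem_union, Set.mem_singleton_iff]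
  constructor
  · rintro ⟨g, ⟨h1, h2⟩, rfl⟩
    match g, h1, h2 with
    | [], _, _ => left; simp
    | [x], _, h2 =>
      rcases h2 x (by simp) with rfl | rfl | rfl <;> simp
  · rintro (rfl | rfl | rfl | rfl)
    · exact ⟨[], ⟨by simp, by simp⟩, by simp⟩
    · exact ⟨[.zero], ⟨by simp, by simp⟩, rfl⟩
    · exact ⟨[.one], ⟨by simp, by simp⟩, rfl⟩
    · exact ⟨[.sep], ⟨by simp, by simp⟩, rfl⟩

theorem Cmd.run_guessLoop {k t : ℕ} (hkt : k ≠ t) (l : List Sym) (s : Store) (hl : s k = l) :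
    Run (.loop k fun _ => Cmd.guessSymbol t) s (l.length * 5 + 1)
      {s' | ∃ g, Guessable l.length g ∧
        s' = Function.update (Function.update s k []) t (g ++ s t)} := by
  induction l generalizing s with
  | nil =>
    refine Run.congr (Run.loop_nil hl) fun s' => ?_
    simp only [Set.mem_ofPred_eq, Set.mem_singleton_iff, Guessable, List.length_nil]
    have hs : Function.update s k [] = s := by rw [← hl, Function.update_eq_self]
    constructor
    · rintro ⟨g, ⟨h1, -⟩, rfl⟩
      obtain rfl := List.eq_nil_of_length_eq_zero (Nat.le_zero.1 h1)
      rw [hs, List.nil_append, Function.update_eq_self]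
    · intro h
      refine ⟨[], by simp, ?_⟩
      rw [h, hs, List.nil_append, Function.update_eq_self]
  | cons γ l ih =>
    have h := Run.loop_cons (T₂ := l.length * 5 + 1)
      (R₁ := {s' | ∃ g, Guessable 1 g ∧ s' = Function.update (Function.update s k l) t
        (g ++ Function.update s k l t)})
      (R₂ := fun s' => {s'' | ∃ g, Guessable l.length g ∧
        s'' = Function.update (Function.update s' k []) t (g ++ s' t)}) hl (Cmd.run_guessSymbol t _)
      (by
        rintro s' ⟨g, -, rfl⟩
        apply ih
        rw [Function.update_of_ne hkt, Function.update_self])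
    refine Run.mono (T := 4 + (l.length * 5 + 1) + 1) ?_ (by simp only [List.length_cons]; omega)
    refine Run.congr h fun s' => ?_
    simp only [Set.mem_ofPred_eq, Set.mem_iUnion, List.length_cons, Guessable]
    constructor
    · rintro ⟨g, ⟨h1, h2⟩, rfl⟩
      rcases List.eq_nil_or_concat g with rfl | ⟨g', x, rfl⟩
      · refine ⟨_, ⟨[], by simp, rfl⟩, [], by simp, ?_⟩
        funext j
        simp only [Function.update_apply]
        split_ifs <;> simp_all
      · rw [List.concat_eq_append] at h1 h2 ⊢
        simp only [List.length_append, List.length_singleton] at h1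
        refine ⟨_, ⟨[x], ⟨by simp, fun y hy => h2 y (by simp_all)⟩, rfl⟩, g',
          ⟨by omega, fun y hy => h2 y (by simp_all)⟩, ?_⟩
        funext j
        simp only [Function.update_apply]
        split_ifs <;> simp_all
    · rintro ⟨_, ⟨g, ⟨h1, h2⟩, rfl⟩, g', ⟨h3, h4⟩, rfl⟩
      refine ⟨g' ++ g, ⟨by simp only [List.length_append]; omega, ?_⟩, ?_⟩
      · intro x hx
        rcases List.mem_append.1 hx with hx | hx
        exacts [h4 x hx, h2 x hx]
      · funext j
        simp only [Function.update_apply]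
        split_ifs <;> simp_all

/-- Guess the tapes `1, …, j`, of lengths at most the value of `b`. The stack `j + 1` stays empty.
-/
noncomputable def Cmd.guessTapes (b : Ex) (j : ℕ) : ℕ → Cmd
  | 0 => .skip
  | i + 1 => .seq (Cmd.guessTapes b j i) (.seq
      (b.comp (fun _ => j + 1) (j + 2) (j + 3)) (.loop (j + 2) fun _ => Cmd.guessSymbol (i + 1)))

/-- The tapes `1, …, i` have guessed contents, the tape `0` is `inp`, the other tapes are empty. -/
def GuessedTapes (inp : List Sym) (B i : ℕ) : Set Store :=
  {τ | τ 0 = inp ∧ (∀ t, 1 ≤ t → t ≤ i → Guessable B (τ t)) ∧ ∀ t, i < t → τ t = []}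

theorem GuessedTapes.represents {inp : List Sym} {B i j : ℕ} {τ : Store} (hij : i ≤ j)
    (h : τ ∈ GuessedTapes inp B i) :
    Store.Represents (j + 1) τ (fun _ => 0) (fun _ => j + 1) (j + 2) (j + 3) τ where
  tape _ _ := rfl
  var _ := h.2.2 _ (by omega)
  le_env _ := le_rfl
  env_lt _ := by omega
  env_ne _ := by omega
  le_d := by omega
  d_lt := by omega
  empty k hk := h.2.2 _ (by omega)

theorem GuessedTapes.length_le {inp : List Sym} {B i M : ℕ} {τ : Store} (hM : inp.length ≤ M)
    (hB : B ≤ M) (h : τ ∈ GuessedTapes inp B i) (t : ℕ) : (τ t).length ≤ M := by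
  rcases Nat.eq_zero_or_pos t with rfl | ht
  · rwa [h.1]
  · by_cases hti : t ≤ i
    · exact (h.2.1 t ht hti).1.trans hB
    · simp [h.2.2 t (by omega)]

theorem Cmd.run_guessTapes {b : Ex} {j : ℕ} (hb : b.TapesLT (j + 1)) {bd : ℕ → ℕ}
    (hbd : ∀ τ : Store, b.eval τ (fun _ => 0) = bd (τ 0).length) (i : ℕ) (hi : i ≤ j) :
    ∃ p : Polynomial ℕ, ∀ inp : List Sym, bd inp.length ≤ p.eval inp.length ∧
      Run (Cmd.guessTapes b j i) (Function.update (fun _ => []) 0 inp) (p.eval inp.length)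
        (GuessedTapes inp (bd inp.length) i) := by
  obtain ⟨q, hq⟩ := b.run_comp hb
  have hbq : ∀ inp : List Sym, bd inp.length ≤ q.eval inp.length := by
    intro inp
    have h0 : Function.update (fun _ => []) 0 inp ∈ GuessedTapes inp 0 0 := by
      refine ⟨by simp, by omega, fun t ht => ?_⟩
      rw [Function.update_of_ne (by omega)]
    have := (hq _ _ _ _ _ _ inp.length (GuessedTapes.represents (j := j) (by omega) h0)
      (fun t _ => GuessedTapes.length_le le_rfl (by omega) h0 t) (by simp)).1
    rwa [hbd, h0.1] at this
  induction i with
  | zero =>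
    refine ⟨1 + q, fun inp => ⟨?_, (?_ : Run _ _ 1 _).mono (by simp)⟩⟩
    · have := hbq inp
      simp only [Polynomial.eval_add]; omega
    · refine Run.congr (Run.skip _) fun τ => ?_
      simp only [GuessedTapes, Set.mem_ofPred_eq, Set.mem_singleton_iff]
      constructor
      · rintro ⟨rfl, -, h⟩
        funext t
        rcases Nat.eq_zero_or_pos t with rfl | ht
        · simp
        · rw [h t ht, Function.update_of_ne (by omega)]
      · rintro rfl
        refine ⟨by simp, by omega, fun t ht => ?_⟩
        rw [Function.update_of_ne (by omega)]
  | succ i ih =>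
    obtain ⟨p, hp⟩ := ih (by omega)
    refine ⟨p + (q.comp (Polynomial.X + q) + q * 5 + 2) + 1, fun inp => ?_⟩
    obtain ⟨h1, h2⟩ := hp inp
    simp only [Polynomial.eval_add, Polynomial.eval_mul, Polynomial.eval_comp, Polynomial.eval_X,
      Polynomial.eval_one, Polynomial.eval_ofNat]
    refine ⟨by omega, ?_⟩
    have h3 := Run.seq (T₂ := q.eval (inp.length + q.eval inp.length) + q.eval inp.length * 5 + 2)
      (R₂ := fun τ => {τ' | ∃ g, Guessable (bd inp.length) g ∧ τ' = Function.update τ (i + 1) g}) h2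
      (b := .seq (b.comp (fun _ => j + 1) (j + 2) (j + 3))
        (.loop (j + 2) fun _ => Cmd.guessSymbol (i + 1))) (by
      intro τ hτ
      have h4 := (hq _ _ _ _ _ _ (inp.length + q.eval inp.length)
        (GuessedTapes.represents (j := j) (by omega) hτ)
        (fun t _ => GuessedTapes.length_le (by omega) ((hbq inp).trans (by omega)) hτ t)
        (by simp)).2
      rw [hbd, hτ.1, hτ.2.2 (j + 2) (by omega), List.append_nil] at h4
      have h5 := Cmd.run_guessLoop (k := j + 2) (t := i + 1) (by omega) (unary (bd inp.length))
        (Function.update τ (j + 2) (unary (bd inp.length))) (by simp)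
      rw [List.length_replicate] at h5
      have h6 := Run.seq h4 (R₂ := fun _ => {τ' | ∃ g, Guessable (bd inp.length) g ∧
        τ' = Function.update τ (i + 1) g}) (T₂ := bd inp.length * 5 + 1)
        (b := .loop (j + 2) fun _ => Cmd.guessSymbol (i + 1)) (by
          rintro _ rfl
          refine Run.congr (h5) fun τ' => ?_
          have h7 : Function.update (Function.update τ (j + 2) (unary (bd inp.length))) (j + 2) [] =
              τ := by
            rw [Function.update_idem, ← hτ.2.2 (j + 2) (by omega), Function.update_eq_self]
          simp only [Set.mem_ofPred_eq, h7]
          rw [Function.update_of_ne (by omega), hτ.2.2 (i + 1) (by omega)]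
          simp only [List.append_nil])
      simp only [Set.mem_singleton_iff, Set.iUnion_iUnion_eq_left] at h6
      refine h6.mono ?_
      have := hbq inp
      omega)
    refine Run.congr h3 fun τ => ?_
    simp only [Set.mem_iUnion, Set.mem_ofPred_eq, GuessedTapes]
    constructor
    · rintro ⟨h4, h5, h6⟩
      refine ⟨Function.update τ (i + 1) [], ⟨?_, fun t ht hti => ?_, fun t ht => ?_⟩, τ (i + 1),
        h5 _ (by omega) le_rfl, ?_⟩
      · rwa [Function.update_of_ne (by omega)]
      · rw [Function.update_of_ne (by omega)]; exact h5 t ht (by omega)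
      · rw [Function.update_apply]
        split_ifs
        · rfl
        · exact h6 t (by omega)
      · rw [Function.update_idem, Function.update_eq_self]
    · rintro ⟨τ, ⟨h4, h5, h6⟩, g, hg, rfl⟩
      refine ⟨?_, fun t ht hti => ?_, fun t ht => ?_⟩
      · rwa [Function.update_of_ne (by omega)]
      · rw [Function.update_apply]
        split_ifs
        · exact hg
        · exact h5 t ht (by omega)
      · rw [Function.update_of_ne (by omega)]; exact h6 t (by omega)

/-- Existential guessing followed by the evaluation of an expression can be done by a
nondeterministic machine in polynomial time. The tape `0` is the input, the tapes `1, …, j` are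
guessed, and the output is the tape `1`. -/
theorem exists_machine {b e : Ex} {j : ℕ} (hj : 1 ≤ j) (hb : b.TapesLT (j + 1))
    (he : e.TapesLT (j + 1)) {bd : ℕ → ℕ}
    (hbd : ∀ τ : Store, b.eval τ (fun _ => 0) = bd (τ 0).length) :
    ∃ (c : Cmd) (B : ℕ) (_ : NeZero B) (p : Polynomial ℕ), ∀ inp : List Sym,
      bd inp.length ≤ p.eval inp.length ∧
      (c.machine B).RunsInTime inp (p.eval inp.length) ∧
      (c.machine B).outputs inp =
        {o : List Sym | ∃ τ ∈ GuessedTapes inp (bd inp.length) j,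
          e.eval τ (fun _ => 0) ≠ 0 ∧ τ 1 = o} := by
  obtain ⟨p, hp⟩ := Cmd.run_guessTapes hb hbd j le_rfl
  obtain ⟨q, hq⟩ := e.run_comp he
  set c : Cmd := .seq (Cmd.guessTapes b j j) (.seq (e.comp (fun _ => j + 1) (j + 2) (j + 3))
    (.pop (j + 2) fun o => o.elim .fail fun _ => .skip)) with hc
  obtain ⟨B, hB⟩ := c.exists_stacksLT
  refine ⟨c, B + 2, ⟨by omega⟩, p + q.comp (Polynomial.X + p) + 5, fun inp => ?_⟩
  obtain ⟨h1, h2⟩ := hp inp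
  simp only [Polynomial.eval_add, Polynomial.eval_comp, Polynomial.eval_X, Polynomial.eval_ofNat]
  refine ⟨by omega, ?_⟩
  have h3 := Run.seq (T₂ := q.eval (inp.length + p.eval inp.length) + 3)
    (R₂ := fun τ => {τ' | e.eval τ (fun _ => 0) ≠ 0 ∧
      τ' = Function.update τ (j + 2) (unary (e.eval τ (fun _ => 0) - 1))}) h2
    (b := .seq (e.comp (fun _ => j + 1) (j + 2) (j + 3))
      (.pop (j + 2) fun o => o.elim .fail fun _ => .skip)) (by
      intro τ hτ
      have h4 := (hq _ _ _ _ _ _ (inp.length + p.eval inp.length)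
        (GuessedTapes.represents (j := j) (by omega) hτ)
        (fun t _ => GuessedTapes.length_le (by omega) (h1.trans (by omega)) hτ t) (by simp)).2
      rw [hτ.2.2 (j + 2) (by omega), List.append_nil] at h4
      have h6 := Run.seq h4 (R₂ := fun _ => {τ' | e.eval τ (fun _ => 0) ≠ 0 ∧
        τ' = Function.update τ (j + 2) (unary (e.eval τ (fun _ => 0) - 1))}) (T₂ := 2)
        (b := .pop (j + 2) fun o => o.elim .fail fun _ => .skip) (by
          rintro _ rfl
          refine Run.pop (T := 1) ?_
          rw [Function.update_self, Function.update_idem]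
          cases hv : e.eval τ (fun _ => 0) with
          | zero =>
            refine (?_ : Run .fail _ 0 _).mono (by omega)
            exact Run.congr (Run.fail _) (by simp)
          | succ v =>
            show Run .skip _ _ _
            refine Run.congr (Run.skip _) fun τ' => ?_
            simp)
      simp only [Set.mem_singleton_iff, Set.iUnion_iUnion_eq_left] at h6
      exact h6.mono (by omega))
  obtain ⟨h4, h5⟩ := Cmd.machine_correct (B := B + 2) (hB _ (by omega)) (by omega) h3
  refine ⟨fun t d hd => (h4 t d hd).trans (by omega), ?_⟩
  rw [h5]
  ext o
  simp only [Set.mem_ofPred_eq, Set.mem_iUnion]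
  constructor
  · rintro ⟨_, ⟨τ, hτ, h6, rfl⟩, rfl⟩
    exact ⟨τ, hτ, h6, by rw [Function.update_of_ne (by omega)]⟩
  · rintro ⟨τ, hτ, h6, rfl⟩
    exact ⟨_, ⟨τ, hτ, h6, rfl⟩, by rw [Function.update_of_ne (by omega)]⟩

/-! ### Definable functions and predicates on tapes -/

/-- Renaming of the variables of an expression. -/
def Ex.rename : Ex → (ℕ → ℕ) → Ex
  | .var i, g => .var (g i)
  | .one, _ => .one
  | .add a b, g => .add (a.rename g) (b.rename g)
  | .sub a b, g => .sub (a.rename g) (b.rename g)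
  | .sum b e, g => .sum (b.rename g) (e.rename (scons 0 fun i => g i + 1))
  | .rd t s e, g => .rd t s (e.rename g)
  | .len t, _ => .len t

theorem Ex.tapesLT_rename {m : ℕ} (e : Ex) (g : ℕ → ℕ) (h : e.TapesLT m) :
    (e.rename g).TapesLT m := by
  induction e generalizing g with
  | var i => trivial
  | one => trivial
  | add a b iha ihb => exact ⟨iha g h.1, ihb g h.2⟩
  | sub a b iha ihb => exact ⟨iha g h.1, ihb g h.2⟩
  | sum b e ihb ihe => exact ⟨ihb g h.1, ihe _ h.2⟩
  | rd t s e ih => exact ⟨h.1, ih g h.2⟩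
  | len t => exact h

theorem Ex.eval_rename (e : Ex) (g : ℕ → ℕ) (τ : Store) (ρ : ℕ → ℕ) :
    (e.rename g).eval τ ρ = e.eval τ fun i => ρ (g i) := by
  induction e generalizing g ρ with
  | var i => rfl
  | one => rfl
  | add a b iha ihb => simp only [Ex.rename, Ex.eval, iha, ihb]
  | sub a b iha ihb => simp only [Ex.rename, Ex.eval, iha, ihb]
  | sum b e ihb ihe =>
    simp only [Ex.rename, Ex.eval, ihb, ihe]
    refine Finset.sum_congr rfl fun i _ => ?_
    congr 1
    funext j
    cases j <;> rfl
  | rd t s e ih => unfold Ex.rename Ex.eval; rw [ih]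
  | len t => rfl

/-- The function `f` of the tapes and of the variables is the value of an expression over the tapes
below `m`. -/
def Dn (m : ℕ) (f : Store → (ℕ → ℕ) → ℕ) : Prop :=
  ∃ e : Ex, e.TapesLT m ∧ ∀ τ ρ, e.eval τ ρ = f τ ρ

/-- The predicate `P` of the tapes and of the variables is expressible over the tapes below `m`:
it holds if and only if the value of some expression is not zero. -/
def DP (m : ℕ) (P : Store → (ℕ → ℕ) → Prop) : Prop :=
  ∃ e : Ex, e.TapesLT m ∧ ∀ τ ρ, e.eval τ ρ ≠ 0 ↔ P τ ρ

section

variable {m : ℕ} {a b : Store → (ℕ → ℕ) → ℕ} {P Q : Store → (ℕ → ℕ) → Prop}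

theorem Dn.var (i : ℕ) : Dn m fun _ ρ => ρ i := ⟨.var i, trivial, fun _ _ => rfl⟩

theorem Dn.len {t : ℕ} (ht : t < m) : Dn m fun τ _ => (τ t).length :=
  ⟨.len t, ht, fun _ _ => rfl⟩

theorem Dn.add (ha : Dn m a) (hb : Dn m b) : Dn m fun τ ρ => a τ ρ + b τ ρ := by
  obtain ⟨e, he, h⟩ := ha
  obtain ⟨e', he', h'⟩ := hb
  exact ⟨.add e e', ⟨he, he'⟩, fun τ ρ => by simp only [Ex.eval, h, h']⟩

theorem Dn.sub (ha : Dn m a) (hb : Dn m b) : Dn m fun τ ρ => a τ ρ - b τ ρ := by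
  obtain ⟨e, he, h⟩ := ha
  obtain ⟨e', he', h'⟩ := hb
  exact ⟨.sub e e', ⟨he, he'⟩, fun τ ρ => by simp only [Ex.eval, h, h']⟩

theorem Dn.const (c : ℕ) : Dn m fun _ _ => c := by
  induction c with
  | zero => exact ⟨.sub .one .one, ⟨trivial, trivial⟩, fun _ _ => rfl⟩
  | succ c ih => exact ih.add ⟨.one, trivial, fun _ _ => rfl⟩

theorem Dn.rename (ha : Dn m a) (g : ℕ → ℕ) : Dn m fun τ ρ => a τ fun i => ρ (g i) := by
  obtain ⟨e, he, h⟩ := ha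
  exact ⟨e.rename g, e.tapesLT_rename g he, fun τ ρ => by rw [Ex.eval_rename, h]⟩

theorem Dn.sum {f : Store → (ℕ → ℕ) → ℕ → ℕ} (hb : Dn m b)
    (hf : Dn m fun τ ρ => f τ (fun i => ρ (i + 1)) (ρ 0)) :
    Dn m fun τ ρ => ∑ i ∈ Finset.range (b τ ρ), f τ ρ i := by
  obtain ⟨e, he, h⟩ := hb
  obtain ⟨e', he', h'⟩ := hf
  refine ⟨.sum e e', ⟨he, he'⟩, fun τ ρ => ?_⟩
  simp only [Ex.eval, h, h']
  rfl

theorem Dn.mul (ha : Dn m a) (hb : Dn m b) : Dn m fun τ ρ => a τ ρ * b τ ρ := by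
  obtain ⟨e, he, h⟩ := Dn.sum (f := fun τ ρ _ => b τ ρ) ha (hb.rename fun i => i + 1)
  refine ⟨e, he, fun τ ρ => ?_⟩
  rw [h]; simp

theorem Dn.pow (ha : Dn m a) (k : ℕ) : Dn m fun τ ρ => a τ ρ ^ k := by
  induction k with
  | zero => exact Dn.const 1
  | succ k ih => simp only [pow_succ]; exact ih.mul ha

theorem DP.lt (ha : Dn m a) (hb : Dn m b) : DP m fun τ ρ => a τ ρ < b τ ρ := by
  obtain ⟨e, he, h⟩ := hb.sub ha
  refine ⟨e, he, fun τ ρ => ?_⟩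
  rw [h]; beta_reduce; omega

theorem DP.not (hP : DP m P) : DP m fun τ ρ => ¬ P τ ρ := by
  obtain ⟨e, he, h⟩ := hP
  refine ⟨.sub .one e, ⟨trivial, he⟩, fun τ ρ => ?_⟩
  show _ ↔ ¬ P τ ρ
  rw [← h]
  simp only [Ex.eval]; omega

theorem DP.or (hP : DP m P) (hQ : DP m Q) : DP m fun τ ρ => P τ ρ ∨ Q τ ρ := by
  obtain ⟨e, he, h⟩ := hP
  obtain ⟨e', he', h'⟩ := hQ
  refine ⟨.add e e', ⟨he, he'⟩, fun τ ρ => ?_⟩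
  show _ ↔ P τ ρ ∨ Q τ ρ
  rw [← h, ← h']
  simp only [Ex.eval]; omega

theorem DP.congr (hP : DP m P) (h : ∀ τ ρ, P τ ρ ↔ Q τ ρ) : DP m Q := by
  obtain ⟨e, he, h'⟩ := hP
  exact ⟨e, he, fun τ ρ => (h' τ ρ).trans (h τ ρ)⟩

theorem DP.and (hP : DP m P) (hQ : DP m Q) : DP m fun τ ρ => P τ ρ ∧ Q τ ρ :=
  (hP.not.or hQ.not).not.congr fun τ ρ => by tauto

theorem DP.imp (hP : DP m P) (hQ : DP m Q) : DP m fun τ ρ => P τ ρ → Q τ ρ :=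
  (hP.not.or hQ).congr fun τ ρ => by tauto

theorem DP.iff (hP : DP m P) (hQ : DP m Q) : DP m fun τ ρ => P τ ρ ↔ Q τ ρ :=
  ((hP.imp hQ).and (hQ.imp hP)).congr fun τ ρ => by tauto

theorem DP.le (ha : Dn m a) (hb : Dn m b) : DP m fun τ ρ => a τ ρ ≤ b τ ρ :=
  (DP.lt hb ha).not.congr fun τ ρ => by omega

theorem DP.eq (ha : Dn m a) (hb : Dn m b) : DP m fun τ ρ => a τ ρ = b τ ρ :=
  ((DP.le ha hb).and (DP.le hb ha)).congr fun τ ρ => by omega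

theorem DP.rd {t : ℕ} (ht : t < m) (s : Sym) (ha : Dn m a) :
    DP m fun τ ρ => (τ t)[a τ ρ]? = some s := by
  obtain ⟨e, he, h⟩ := ha
  refine ⟨.rd t s e, ⟨ht, he⟩, fun τ ρ => ?_⟩
  unfold Ex.eval
  rw [h]
  split_ifs with h' <;> simp [h']

theorem DP.bex {R : Store → (ℕ → ℕ) → ℕ → Prop} (hb : Dn m b)
    (hR : DP m fun τ ρ => R τ (fun i => ρ (i + 1)) (ρ 0)) :
    DP m fun τ ρ => ∃ i, i < b τ ρ ∧ R τ ρ i := by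
  obtain ⟨e, he, h⟩ := hb
  obtain ⟨e', he', h'⟩ := hR
  refine ⟨.sum e e', ⟨he, he'⟩, fun τ ρ => ?_⟩
  simp only [Ex.eval, h, ne_eq, Finset.sum_eq_zero_iff, Finset.mem_range, not_forall]
  have : ∀ i, ¬ e'.eval τ (scons i ρ) = 0 ↔ R τ ρ i := fun i => h' τ (scons i ρ)
  simp only [this, exists_prop]

theorem DP.ball {R : Store → (ℕ → ℕ) → ℕ → Prop} (hb : Dn m b)
    (hR : DP m fun τ ρ => R τ (fun i => ρ (i + 1)) (ρ 0)) :
    DP m fun τ ρ => ∀ i, i < b τ ρ → R τ ρ i :=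
  (DP.bex (R := fun τ ρ i => ¬ R τ ρ i) hb hR.not).not.congr fun τ ρ => by
    simp only [not_exists, not_and, not_not]

open Classical in
theorem Dn.ind (hP : DP m P) : Dn m fun τ ρ => if P τ ρ then 1 else 0 := by
  obtain ⟨e, he, h⟩ := hP
  refine ⟨.sub .one (.sub .one e), ⟨trivial, trivial, he⟩, fun τ ρ => ?_⟩
  have := h τ ρ
  simp only [Ex.eval]
  split_ifs with h' <;> simp only [h', iff_true, iff_false] at this <;> omega

end

/-! ### Types of positions, and how often they change -/

/-- The assignment of `j` to the variable `u` and of `i` to the other variable. -/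
def asg (u : Var) (i j : ℕ) : Var → ℕ := fun v => if v = u then j else i

/-- The variable other than `u`. -/
def Var.other : Var → Var
  | .x => .y
  | .y => .x

theorem update_eq_asg (v : Var → ℕ) (u : Var) (j : ℕ) :
    Function.update v u j = asg u (v u.other) j := by
  funext z
  cases u <;> cases z <;> simp [asg, Var.other]

namespace Formula

variable {n : ℕ}

/-- The existential subformulas `∃ u, χ`, as pairs `(u, χ)`. -/
def exs : Formula n → List (Var × Formula n)
  | pred _ _ => []
  | lt _ _ => []
  | eq _ _ => []
  | neg φ => φ.exs
  | and φ ψ => φ.exs ++ ψ.exs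
  | or φ ψ => φ.exs ++ ψ.exs
  | ex u φ => (u, φ) :: φ.exs

/-- The maximal existential subformulas: the formula is a Boolean combination of these and of atomic
formulas. -/
def topExs : Formula n → List (Formula n)
  | pred _ _ => []
  | lt _ _ => []
  | eq _ _ => []
  | neg φ => φ.topExs
  | and φ ψ => φ.topExs ++ ψ.topExs
  | or φ ψ => φ.topExs ++ ψ.topExs
  | ex u φ => [ex u φ]

theorem sum_size_topExs (φ : Formula n) : (φ.topExs.map size).sum ≤ φ.size := by
  induction φ with
  | ex u φ => simp [topExs]
  | neg φ ih => simp only [topExs, size]; omega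
  | and φ ψ ih ih' => simp only [topExs, size, List.map_append, List.sum_append]; omega
  | or φ ψ ih ih' => simp only [topExs, size, List.map_append, List.sum_append]; omega
  | _ => simp [topExs]

theorem length_exs (φ : Formula n) : φ.exs.length ≤ φ.size := by
  induction φ with
  | ex u φ ih => simp only [exs, size, List.length_cons]; omega
  | neg φ ih => simp only [exs, size]; omega
  | and φ ψ ih ih' => simp only [exs, size, List.length_append]; omega
  | or φ ψ ih ih' => simp only [exs, size, List.length_append]; omega
  | _ => simp [exs]

theorem size_lt_of_mem_exs {φ χ : Formula n} {u : Var} (h : (u, χ) ∈ φ.exs) :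
    χ.size < φ.size := by
  induction φ with
  | ex u φ ih =>
    simp only [exs, List.mem_cons, Prod.mk.injEq] at h
    rcases h with ⟨-, rfl⟩ | h
    · exact Nat.lt_succ_self _
    · exact (ih h).trans (Nat.lt_succ_self _)
  | neg φ ih => exact (ih h).trans (Nat.lt_succ_self _)
  | and φ ψ ih ih' =>
    simp only [size]
    rcases List.mem_append.1 h with h | h
    · have := ih h; omega
    · have := ih' h; omega
  | or φ ψ ih ih' =>
    simp only [size]
    rcases List.mem_append.1 h with h | h
    · have := ih h; omega
    · have := ih' h; omega
  | _ => simp [exs] at h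

/-- The truth of a formula when both variables have the value `i`. -/
def SatAt (w : ℕ → Fin n) (φ : Formula n) (i : ℕ) : Prop := Sat w (fun _ => i) φ

/-- Some position after `i` is a witness for `∃ u, χ` when the other variable has the value `i`. -/
def FutureWitness (w : ℕ → Fin n) (u : Var) (χ : Formula n) (i : ℕ) : Prop :=
  ∃ j, i < j ∧ Sat w (asg u i j) χ

/-- Some position before `i` is a witness for `∃ u, χ` when the other variable has the value `i`. -/
def PastWitness (w : ℕ → Fin n) (u : Var) (χ : Formula n) (i : ℕ) : Prop :=
  ∃ j, j < i ∧ Sat w (asg u i j) χ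

theorem sat_ex_iff (w : ℕ → Fin n) (v : Var → ℕ) (u : Var) (χ : Formula n) :
    Sat w v (ex u χ) ↔ FutureWitness w u χ (v u.other) ∨ PastWitness w u χ (v u.other) ∨
      SatAt w χ (v u.other) := by
  simp only [Sat, update_eq_asg, FutureWitness, PastWitness, SatAt]
  have h0 : ∀ i, asg u i i = fun _ => i := fun i => by funext z; simp [asg]
  constructor
  · rintro ⟨j, hj⟩
    rcases lt_trichotomy (v u.other) j with h | h | h
    · exact Or.inl ⟨j, h, hj⟩
    · subst h; rw [h0] at hj; exact Or.inr (Or.inr hj)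
    · exact Or.inr (Or.inl ⟨j, h, hj⟩)
  · rintro (⟨j, -, hj⟩ | ⟨j, -, hj⟩ | hj)
    · exact ⟨j, hj⟩
    · exact ⟨j, hj⟩
    · exact ⟨_, by rw [h0]; exact hj⟩

theorem satAt_ex_iff (w : ℕ → Fin n) (i : ℕ) (u : Var) (χ : Formula n) :
    SatAt w (ex u χ) i ↔ FutureWitness w u χ i ∨ PastWitness w u χ i ∨ SatAt w χ i :=
  sat_ex_iff w (fun _ => i) u χ

/-- The truth of a formula depends only on the letters at the two positions, on their order, and on
the maximal existential subformulas that hold there. -/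
theorem sat_congr {w : ℕ → Fin n} {v v' : Var → ℕ} {χ : Formula n}
    (hw : ∀ z, w (v z) = w (v' z)) (hlt : ∀ s t, v s < v t ↔ v' s < v' t)
    (hq : ∀ ψ ∈ χ.topExs, ∀ z, SatAt w ψ (v z) ↔ SatAt w ψ (v' z)) :
    Sat w v χ ↔ Sat w v' χ := by
  induction χ with
  | pred a u => simp only [Sat, hw]
  | lt s t => simp only [Sat, hlt]
  | eq s t =>
    simp only [Sat]
    have h1 := hlt s t
    have h2 := hlt t s
    omega
  | neg φ ih => simp only [Sat, ih hq]
  | and φ ψ ih ih' =>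
    simp only [Sat, ih fun χ h => hq χ (List.mem_append_left _ h),
      ih' fun χ h => hq χ (List.mem_append_right _ h)]
  | or φ ψ ih ih' =>
    simp only [Sat, ih fun χ h => hq χ (List.mem_append_left _ h),
      ih' fun χ h => hq χ (List.mem_append_right _ h)]
  | ex u φ ih =>
    have := hq (ex u φ) (by simp [topExs]) u.other
    rw [satAt_ex_iff, satAt_ex_iff] at this
    rw [sat_ex_iff, sat_ex_iff, this]

end Formula

/-- A relation between positions has at most `C` cuts on the set `P` if there are at most `C` cut
points such that it holds for all `i < j` in `P` without a cut point `b`, `i < b ≤ j`. -/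
def HasCuts (P : ℕ → Prop) (E : ℕ → ℕ → Prop) (C : ℕ) : Prop :=
  ∃ B : Finset ℕ, B.card ≤ C ∧ ∀ i j, i < j → P i → P j → (∀ b ∈ B, i < b → j < b) → E i j

section

variable {P : ℕ → Prop} {E E' : ℕ → ℕ → Prop} {C C' : ℕ}

theorem HasCuts.mono (h : HasCuts P E C) (hC : C ≤ C')
    (hE : ∀ i j, i < j → P i → P j → E i j → E' i j) : HasCuts P E' C' := by
  obtain ⟨B, hB, h⟩ := h
  exact ⟨B, hB.trans hC, fun i j hij hi hj hb => hE i j hij hi hj (h i j hij hi hj hb)⟩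

theorem HasCuts.and (h : HasCuts P E C) (h' : HasCuts P E' C') :
    HasCuts P (fun i j => E i j ∧ E' i j) (C + C') := by
  obtain ⟨B, hB, h⟩ := h
  obtain ⟨B', hB', h'⟩ := h'
  exact ⟨B ∪ B', (Finset.card_union_le _ _).trans (Nat.add_le_add hB hB'), fun i j hij hi hj hb =>
    ⟨h i j hij hi hj fun b hb' => hb b (Finset.mem_union_left _ hb'),
      h' i j hij hi hj fun b hb' => hb b (Finset.mem_union_right _ hb')⟩⟩

theorem HasCuts.list {ι : Type*} {R : ι → ℕ → ℕ → Prop} {c : ι → ℕ} (l : List ι)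
    (h : ∀ x ∈ l, HasCuts P (R x) (c x)) :
    HasCuts P (fun i j => ∀ x ∈ l, R x i j) (l.map c).sum := by
  induction l with
  | nil => exact ⟨∅, by simp, by simp⟩
  | cons x l ih =>
    refine ((h x (by simp)).and (ih fun y hy => h y (by simp [hy]))).mono (by simp) ?_
    rintro i j - - - ⟨h1, h2⟩ y hy
    rcases List.mem_cons.1 hy with rfl | hy
    exacts [h1, h2 y hy]

/-- A property which, among the positions with the same key, is preserved when the position grows,
needs one cut for each key. -/
theorem HasCuts.of_monotone {κ : Type*} (key : ℕ → κ) (K : Finset κ) (hK : ∀ i, P i → key i ∈ K)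
    {G : ℕ → Prop} (hG : ∀ i j, i < j → P i → P j → key i = key j → G i → G j) :
    HasCuts P (fun i j => key i = key j → (G i ↔ G j)) K.card := by
  classical
  let t : κ → ℕ := fun k => sInf {i | P i ∧ key i = k ∧ G i}
  refine ⟨K.image t, Finset.card_image_le, fun i j hij hi hj hb hk => ⟨hG i j hij hi hj hk, ?_⟩⟩
  intro hGj
  have hmem : j ∈ {i | P i ∧ key i = key j ∧ G i} := ⟨hj, rfl, hGj⟩
  have hle : t (key j) ≤ j := Nat.sInf_le hmem
  obtain ⟨h1, h2, h3⟩ : t (key j) ∈ {i | P i ∧ key i = key j ∧ G i} := Nat.sInf_mem ⟨j, hmem⟩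
  have hti : ¬ i < t (key j) := fun h =>
    absurd (hb _ (Finset.mem_image_of_mem t (hK j hj)) h) (by omega)
  rcases (not_lt.1 hti).lt_or_eq with h | h
  · exact hG _ _ h h1 hi (h2.trans hk.symm) h3
  · rwa [← h]

/-- The number of cuts for a property that decreases and a property that increases among the
positions at which the same properties `T x` hold, `x = h` or `x ∈ r`. The cuts of `T h` count once,
since the values of the other properties leave only two possibilities for all of them together. -/
theorem HasCuts.heavy {ι : Type*} {T : ι → ℕ → Prop} {c : ι → ℕ} (h : ι) (r : List ι)
    (hc : ∀ x ∈ h :: r, HasCuts P (fun i j => T x i ↔ T x j) (c x)) {F G : ℕ → Prop}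
    (hF : ∀ i j, i < j → P i → P j → (∀ x ∈ h :: r, T x i ↔ T x j) → F j → F i)
    (hG : ∀ i j, i < j → P i → P j → (∀ x ∈ h :: r, T x i ↔ T x j) → G i → G j) :
    HasCuts P (fun i j => (∀ x ∈ h :: r, T x i ↔ T x j) ∧ (F i ↔ F j) ∧ (G i ↔ G j))
      (c h + 5 * (r.map c).sum + 4) := by
  classical
  obtain ⟨B, hB, hBr⟩ := HasCuts.list r fun x hx => hc x (List.mem_cons_of_mem _ hx)
  let key : ℕ → ℕ × Prop := fun i => ((B.filter (· ≤ i)).card, T h i)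
  have hmono : ∀ i j, i ≤ j → B.filter (· ≤ i) ⊆ B.filter (· ≤ j) := fun i j hij b hb => by
    rw [Finset.mem_filter] at hb ⊢
    exact ⟨hb.1, hb.2.trans hij⟩
  have hkey : ∀ i j, i < j → P i → P j → key i = key j → ∀ x ∈ h :: r, T x i ↔ T x j := by
    intro i j hij hi hj hk x hx
    simp only [key, Prod.mk.injEq] at hk
    rcases List.mem_cons.1 hx with rfl | hx
    · exact iff_of_eq hk.2
    · refine hBr i j hij hi hj (fun b hb hib => ?_) x hx
      by_contra hjb
      have hlt : (B.filter (· ≤ i)).card < (B.filter (· ≤ j)).card := by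
        refine Finset.card_lt_card ⟨hmono i j hij.le, fun hsub => ?_⟩
        have := hsub (Finset.mem_filter.2 ⟨hb, not_lt.1 hjb⟩)
        rw [Finset.mem_filter] at this
        omega
      omega
  let K : Finset (ℕ × Prop) := Finset.range (B.card + 1) ×ˢ Finset.univ
  have hK : ∀ i, P i → key i ∈ K := fun i _ => Finset.mem_product.2
    ⟨Finset.mem_range.2 (Nat.lt_succ_of_le (Finset.card_filter_le _ _)), Finset.mem_univ _⟩
  have hcard : K.card = (B.card + 1) * 2 := by
    rw [Finset.card_product, Finset.card_range, Finset.card_univ, Fintype.card_prop]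
  have h1 := HasCuts.of_monotone key K hK (G := G) fun i j hij hi hj hk =>
    hG i j hij hi hj (hkey i j hij hi hj hk)
  have h2 := HasCuts.of_monotone key K hK (G := fun i => ¬ F i) fun i j hij hi hj hk hFi hFj =>
    hFi (hF i j hij hi hj (hkey i j hij hi hj hk) hFj)
  have h3 : HasCuts P (fun i j => (B.filter (· ≤ i)).card = (B.filter (· ≤ j)).card) B.card := by
    refine ⟨B, le_rfl, fun i j hij _ _ hb => congrArg _ ((hmono i j hij.le).antisymm ?_)⟩
    intro b hb'
    rw [Finset.mem_filter] at hb' ⊢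
    refine ⟨hb'.1, not_lt.1 fun hib => ?_⟩
    have := hb b hb'.1 hib
    omega
  refine (((hc h (by simp)).and h3).and (h1.and h2)).mono ?_ ?_
  · rw [hcard]; omega
  · rintro i j hij hi hj ⟨⟨e1, e2⟩, e3, e4⟩
    have hk : key i = key j := Prod.ext e2 (propext e1)
    exact ⟨hkey i j hij hi hj hk, not_iff_not.1 (e4 hk), e3 hk⟩

end

theorem List.exists_perm_max {ι : Type*} (f : ι → ℕ) (l : List ι) (hl : l ≠ []) :
    ∃ h r, l.Perm (h :: r) ∧ ∀ x ∈ r, f x ≤ f h := by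
  induction l with
  | nil => exact absurd rfl hl
  | cons a l ih =>
    by_cases hl' : l = []
    · exact ⟨a, [], by rw [hl'], by simp⟩
    · obtain ⟨h, r, hp, hr⟩ := ih hl'
      rcases le_total (f a) (f h) with hle | hle
      · refine ⟨h, a :: r, (hp.cons a).trans (List.Perm.swap _ _ _), ?_⟩
        simpa [hle] using hr
      · refine ⟨a, h :: r, hp.cons a, ?_⟩
        simp only [List.mem_cons, forall_eq_or_imp]
        exact ⟨hle, fun x hx => (hr x hx).trans hle⟩

/-- The arithmetic of the cubic bound: if the cuts of the largest of several subformulas of total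
size `S` count once and those of the others five times, then the bound `4 * s ^ 3` is inherited. It
uses that each of the others has size at most `X` and at most the sum of their sizes, so that its
cube is absorbed by a mixed term of `(X + r.sum + 1) ^ 3`. -/
theorem heavy_arith {X S : ℕ} (r : List ℕ) (hr : ∀ s ∈ r, s ≤ X) (hS : X + r.sum ≤ S) :
    4 * X ^ 3 + 5 * (r.map fun s => 4 * s ^ 3).sum + 4 ≤ 4 * (S + 1) ^ 3 := by
  have key : ∀ Z, (∀ s ∈ r, s ≤ Z) →
      (r.map fun s => 4 * s ^ 3).sum ≤ 4 * (X * Z) * r.sum := by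
    intro Z hZ
    clear hS
    induction r with
    | nil => simp
    | cons s r ih =>
      have h1 := ih (fun s hs => hr s (by simp [hs])) (fun s hs => hZ s (by simp [hs]))
      have h2 : s * s ≤ X * Z := Nat.mul_le_mul (hr s (by simp)) (hZ s (by simp))
      simp only [List.map_cons, List.sum_cons]
      have h3 : 4 * s ^ 3 ≤ 4 * (X * Z) * s := by
        calc 4 * s ^ 3 = 4 * (s * s) * s := by ring
          _ ≤ _ := Nat.mul_le_mul_right _ (Nat.mul_le_mul_left _ h2)
      linarith [mul_add (4 * (X * Z)) s r.sum]
  have h1 := key X hr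
  have h2 := key r.sum fun s hs => List.single_le_sum (by simp) s hs
  generalize r.sum = Y at *
  generalize (r.map fun s => 4 * s ^ 3).sum = Z at *
  have h3 : 4 * (X + Y + 1) ^ 3 ≤ 4 * (S + 1) ^ 3 :=
    Nat.mul_le_mul_left _ (Nat.pow_le_pow_left (by omega) 3)
  refine le_trans ?_ h3
  nlinarith [Nat.zero_le (X ^ 2), Nat.zero_le (Y ^ 2), Nat.zero_le (X * Y), Nat.zero_le (Y ^ 3)]

namespace Formula

variable {n : ℕ}

/-- The witnesses in the future are the fewer the later the position is. -/
theorem FutureWitness.anti {w : ℕ → Fin n} {u : Var} {χ : Formula n} {i j : ℕ} (hij : i < j)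
    (hw : w i = w j) (hq : ∀ ψ ∈ χ.topExs, SatAt w ψ i ↔ SatAt w ψ j)
    (h : FutureWitness w u χ j) : FutureWitness w u χ i := by
  obtain ⟨k, hk, h⟩ := h
  refine ⟨k, hij.trans hk, (sat_congr ?_ ?_ ?_).1 h⟩
  · intro z; simp only [asg]; split_ifs <;> simp [hw]
  · intro s t; simp only [asg]; split_ifs <;> omega
  · intro ψ hψ z
    simp only [asg]; split_ifs
    · exact Iff.rfl
    · exact (hq ψ hψ).symm

theorem PastWitness.mono {w : ℕ → Fin n} {u : Var} {χ : Formula n} {i j : ℕ} (hij : i < j)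
    (hw : w i = w j) (hq : ∀ ψ ∈ χ.topExs, SatAt w ψ i ↔ SatAt w ψ j)
    (h : PastWitness w u χ i) : PastWitness w u χ j := by
  obtain ⟨k, hk, h⟩ := h
  refine ⟨k, hk.trans hij, (sat_congr ?_ ?_ ?_).1 h⟩
  · intro z; simp only [asg]; split_ifs <;> simp [hw]
  · intro s t; simp only [asg]; split_ifs <;> omega
  · intro ψ hψ z
    simp only [asg]; split_ifs
    · exact Iff.rfl
    · exact hq ψ hψ

/-- The truth values of the outermost existential subformulas of `χ`, and the existence of witnesses
for `∃ u, χ`, change rarely: between the changes of the former, the latter are monotone. -/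
theorem hasCuts_witness (w : ℕ → Fin n) (a : Fin n) (u : Var) (χ : Formula n)
    (h : ∀ ψ ∈ χ.topExs, HasCuts (fun i => w i = a) (fun i j => SatAt w ψ i ↔ SatAt w ψ j)
      (4 * ψ.size ^ 3)) :
    HasCuts (fun i => w i = a) (fun i j => (∀ ψ ∈ χ.topExs, SatAt w ψ i ↔ SatAt w ψ j) ∧
      (FutureWitness w u χ i ↔ FutureWitness w u χ j) ∧
      (PastWitness w u χ i ↔ PastWitness w u χ j)) (4 * (χ.size + 1) ^ 3) := by
  have hsum := χ.sum_size_topExs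
  by_cases hl : χ.topExs = []
  · -- without subformulas there is one key, and one cut for each of the two properties
    have h1 := HasCuts.of_monotone (P := fun i => w i = a) (fun _ => ()) {()} (by simp)
      (G := PastWitness w u χ)
      fun i j hij hi hj _ => PastWitness.mono hij (hi.trans hj.symm) (by simp [hl])
    have h2 := HasCuts.of_monotone (P := fun i => w i = a) (fun _ => ()) {()} (by simp)
      (G := fun i => ¬ FutureWitness w u χ i) fun i j hij hi hj _ hi' hj' =>
        hi' (FutureWitness.anti hij (hi.trans hj.symm) (by simp [hl]) hj')
    refine (h1.and h2).mono ?_ ?_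
    · simp only [Finset.card_singleton]
      have : 1 ≤ (χ.size + 1) ^ 3 := Nat.one_le_pow _ _ (by omega)
      omega
    · rintro i j - - - ⟨e1, e2⟩
      exact ⟨by simp [hl], not_iff_not.1 (e2 rfl), e1 rfl⟩
  · obtain ⟨ψ, r, hp, hr⟩ := List.exists_perm_max size χ.topExs hl
    have hm : ∀ x, x ∈ ψ :: r ↔ x ∈ χ.topExs := fun x => hp.mem_iff.symm
    have h1 := HasCuts.heavy (P := fun i => w i = a) (T := fun ψ i => SatAt w ψ i)
      (c := fun ψ => 4 * ψ.size ^ 3) ψ r (fun x hx => h x ((hm x).1 hx))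
      (F := FutureWitness w u χ) (G := PastWitness w u χ)
      (fun i j hij hi hj hx => FutureWitness.anti hij (hi.trans hj.symm) fun x h' =>
        hx x ((hm x).2 h'))
      (fun i j hij hi hj hx => PastWitness.mono hij (hi.trans hj.symm) fun x h' =>
        hx x ((hm x).2 h'))
    refine h1.mono ?_ ?_
    · have hs : ψ.size + (r.map size).sum ≤ χ.size := by
        rw [(hp.map size).sum_eq] at hsum
        simpa using hsum
      have := heavy_arith (r.map size) (by simpa using hr) hs
      simpa [List.map_map, Function.comp_def] using this
    · rintro i j - - - ⟨e1, e2⟩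
      exact ⟨fun x hx => e1 x ((hm x).2 hx), e2⟩

theorem hasCuts_topExs (w : ℕ → Fin n) (a : Fin n) (χ : Formula n) :
    ∀ ψ ∈ χ.topExs, HasCuts (fun i => w i = a) (fun i j => SatAt w ψ i ↔ SatAt w ψ j)
      (4 * ψ.size ^ 3) := by
  induction χ with
  | ex u χ ih =>
    intro ψ hψ
    obtain rfl : ψ = ex u χ := by simpa [topExs] using hψ
    refine (hasCuts_witness w a u χ ih).mono le_rfl ?_
    rintro i j hij hi hj ⟨e1, e2, e3⟩
    rw [satAt_ex_iff, satAt_ex_iff, e2, e3]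
    have : SatAt w χ i ↔ SatAt w χ j :=
      sat_congr (fun _ => hi.trans hj.symm) (fun _ _ => by simp) fun ψ hψ _ => e1 ψ hψ
    rw [this]
  | neg φ ih => exact ih
  | and φ ψ ih ih' =>
    intro χ hχ
    rcases List.mem_append.1 hχ with h | h
    exacts [ih χ h, ih' χ h]
  | or φ ψ ih ih' =>
    intro χ hχ
    rcases List.mem_append.1 hχ with h | h
    exacts [ih χ h, ih' χ h]
  | _ => simp [topExs]

/-- Two positions have the same type for `φ`: the same existential subformulas have witnesses in the
future, and the same ones have witnesses in the past. -/
def SameType (w : ℕ → Fin n) (φ : Formula n) (i j : ℕ) : Prop :=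
  ∀ c ∈ φ.exs, (FutureWitness w c.1 c.2 i ↔ FutureWitness w c.1 c.2 j) ∧
    (PastWitness w c.1 c.2 i ↔ PastWitness w c.1 c.2 j)

/-- Along the positions of one letter, the type changes at most polynomially often. -/
theorem hasCuts_sameType (w : ℕ → Fin n) (a : Fin n) (φ : Formula n) :
    HasCuts (fun i => w i = a) (SameType w φ) (4 * φ.size ^ 4) := by
  have h := HasCuts.list (P := fun i => w i = a) (c := fun c => 4 * (c.2.size + 1) ^ 3) φ.exs
    fun c _ => hasCuts_witness w a c.1 c.2 (hasCuts_topExs w a c.2)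
  refine h.mono ?_ fun i j _ _ _ h c hc => (h c hc).2
  have h1 : ((φ.exs).map fun c => 4 * (c.2.size + 1) ^ 3).sum ≤
      φ.exs.length • (4 * φ.size ^ 3) := by
    rw [← List.length_map (as := φ.exs) (fun c => 4 * (c.2.size + 1) ^ 3)]
    refine List.sum_le_card_nsmul _ _ fun s hs => ?_
    obtain ⟨⟨u, χ⟩, hc, rfl⟩ := List.mem_map.1 hs
    exact Nat.mul_le_mul_left _ (Nat.pow_le_pow_left (size_lt_of_mem_exs hc) 3)
  refine h1.trans ?_
  rw [smul_eq_mul]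
  calc _ ≤ φ.size * (4 * φ.size ^ 3) := Nat.mul_le_mul_right _ φ.length_exs
    _ = _ := by ring

end Formula

/-! ### Certificates -/

/-- A certificate describes the shape of a word: its positions are cut into `R` runs, where a run
consists of positions of one letter between which the type does not change. The first and the last
positions of the runs are the `k` markers, numbered in their order. Run `r < R` has the letter `ℓ
r`, extends from the marker `st r` to the marker `en r`, and is infinite if `en r = k`. -/
structure Cert where
  R : ℕ
  k : ℕ
  ℓ : ℕ → ℕ
  st : ℕ → ℕ
  en : ℕ → ℕ

/-- The value that belongs to a variable, out of the pair of the values of `x` and `y`. -/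
def Var.pick (u : Var) (r s : ℕ) : ℕ :=
  match u with
  | .x => r
  | .y => s

/-- The order of two positions as a number: `0` for equal, `1` for ascending, `2` for descending. -/
def ord (i j : ℕ) : ℕ := if i = j then 0 else if i < j then 1 else 2

/-- The number for the reversed order. -/
def swapOrd (o : ℕ) : ℕ := if o = 1 then 2 else if o = 2 then 1 else o

/-- A relation between the values of `x` and `y` and their order, read for the values `s` of `u` and
`r` of the other variable. -/
def orient (u : Var) (B : ℕ → ℕ → ℕ → Prop) (r s o : ℕ) : Prop :=
  match u with
  | .y => B r s o
  | .x => B s r (swapOrd o)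

theorem Formula.mem_exs_trans {n : ℕ} {φ : Formula n} {e e' : Var × Formula n} (h : e ∈ φ.exs)
    (h' : e' ∈ e.2.exs) : e' ∈ φ.exs := by
  induction φ with
  | ex u φ ih =>
    rcases List.mem_cons.1 h with rfl | h
    · exact List.mem_cons_of_mem _ h'
    · exact List.mem_cons_of_mem _ (ih h)
  | neg φ ih => exact ih h
  | and φ ψ ih ih' =>
    rcases List.mem_append.1 h with h | h
    · exact List.mem_append_left _ (ih h)
    · exact List.mem_append_right _ (ih' h)
  | or φ ψ ih ih' =>
    rcases List.mem_append.1 h with h | h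
    · exact List.mem_append_left _ (ih h)
    · exact List.mem_append_right _ (ih' h)
  | _ => simp [exs] at h

namespace Cert

variable (c : Cert)

/-- The letter `a` may be read between the markers `i - 1` and `i`. -/
def Opn (i a : ℕ) : Prop := ∃ r < c.R, c.ℓ r = a ∧ c.st r < i ∧ i ≤ c.en r

/-- The letter `a` may be read at the marker `i`. -/
def Mark (i a : ℕ) : Prop := ∃ r < c.R, c.ℓ r = a ∧ (c.st r = i ∨ c.en r = i)

/-- The combinatorial conditions on a certificate over an alphabet with `n` letters. -/
structure Wf (n : ℕ) : Prop where
  run : ∀ r < c.R, c.ℓ r < n ∧ c.st r ≤ c.en r ∧ c.st r < c.k ∧ c.en r ≤ c.k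
  disj : ∀ r < c.R, ∀ r' < c.R, r ≠ r' → c.ℓ r = c.ℓ r' → c.en r < c.st r' ∨ c.en r' < c.st r
  used : ∀ i < c.k, ∃ r < c.R, c.st r = i ∨ c.en r = i
  letter : ∀ r < c.R, ∀ r' < c.R, ∀ i < c.k, (c.st r = i ∨ c.en r = i) →
    (c.st r' = i ∨ c.en r' = i) → c.ℓ r = c.ℓ r'

/-- Some run has a position after the first position of the run `r` and satisfies `B`. -/
def fut (u : Var) (B : ℕ → ℕ → ℕ → Prop) (r : ℕ) : Prop :=
  ∃ s < c.R, c.st r < c.en s ∧ orient u B r s 1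

/-- Some run has a position before the last position of the run `r` and satisfies `B`. -/
def past (u : Var) (B : ℕ → ℕ → ℕ → Prop) (r : ℕ) : Prop :=
  ∃ s < c.R, c.st s < c.en r ∧ orient u B r s 2

/-- Some run has a position after all positions of the run `r`, or after each single one of them,
and satisfies `B`. -/
def futLast (u : Var) (B : ℕ → ℕ → ℕ → Prop) (r : ℕ) : Prop :=
  ∃ s < c.R, (c.en r < c.en s ∨ c.en s = c.k) ∧ orient u B r s 1

/-- Some run has a position before all positions of the run `r` and satisfies `B`. -/
def pastFirst (u : Var) (B : ℕ → ℕ → ℕ → Prop) (r : ℕ) : Prop :=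
  ∃ s < c.R, c.st s < c.st r ∧ orient u B r s 2

/-- The truth of a formula computed from the certificate, for a position `x` in the run `r` and a
position `y` in the run `s` in the order `o`. -/
def Abs {n : ℕ} : Formula n → ℕ → ℕ → ℕ → Prop
  | .pred a u, r, s, _ => c.ℓ (u.pick r s) = a
  | .lt u v, _, _, o => (u = .x ∧ v = .y ∧ o = 1) ∨ (u = .y ∧ v = .x ∧ o = 2)
  | .eq u v, _, _, o => u = v ∨ o = 0
  | .neg φ, r, s, o => ¬ Abs φ r s o
  | .and φ ψ, r, s, o => Abs φ r s o ∧ Abs ψ r s o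
  | .or φ ψ, r, s, o => Abs φ r s o ∨ Abs ψ r s o
  | .ex u φ, r, s, _ => c.fut u (Abs φ) (u.other.pick r s) ∨ c.past u (Abs φ) (u.other.pick r s) ∨
      Abs φ (u.other.pick r s) (u.other.pick r s) 0

/-- The certificate is consistent with the formula: within a run the same existential subformulas
have witnesses in the future and in the past (`const`), between consecutive runs of a letter this
changes (`maximal`), and the formula is true at the initial position (`root`). -/
structure Valid {n : ℕ} (φ : Formula n) : Prop where
  wf : c.Wf n
  const : ∀ e ∈ φ.exs, ∀ r < c.R, (c.fut e.1 (c.Abs e.2) r → c.futLast e.1 (c.Abs e.2) r) ∧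
    (c.past e.1 (c.Abs e.2) r → c.pastFirst e.1 (c.Abs e.2) r)
  maximal : ∀ r < c.R, ∀ r' < c.R, c.ℓ r = c.ℓ r' → c.en r < c.st r' →
    (∀ s < c.R, c.ℓ s = c.ℓ r → c.en r < c.st s → ¬ c.en s < c.st r') →
    ∃ e ∈ φ.exs, ¬ ((c.fut e.1 (c.Abs e.2) r ↔ c.fut e.1 (c.Abs e.2) r') ∧
      (c.past e.1 (c.Abs e.2) r ↔ c.past e.1 (c.Abs e.2) r'))
  root : ∃ r < c.R, c.st r = 0 ∧ c.Abs φ r r 0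

variable {c} {n : ℕ} {w : ℕ → Fin n} {cnt : ℕ → ℕ}

/-- The word `w` has the shape described by the certificate; `cnt p` is the number of markers before
the position `p`. -/
structure Match (c : Cert) (w : ℕ → Fin n) (cnt : ℕ → ℕ) : Prop where
  zero : cnt 0 = 0
  step : ∀ p, (cnt (p + 1) = cnt p + 1 ∧ cnt p < c.k ∧ c.Mark (cnt p) (w p)) ∨
    (cnt (p + 1) = cnt p ∧ c.Opn (cnt p) (w p))
  last : ∃ p, cnt p = c.k
  often : ∀ b : Fin n, c.Opn c.k b → ∃ᶠ p in atTop, w p = b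

/-- The position `p` belongs to the run `r`. -/
structure On (c : Cert) (w : ℕ → Fin n) (cnt : ℕ → ℕ) (p r : ℕ) : Prop where
  lt : r < c.R
  letter : c.ℓ r = w p
  st_le : c.st r ≤ cnt p
  le_en : cnt p ≤ c.en r

theorem Match.mono (m : Match c w cnt) : Monotone cnt :=
  monotone_nat_of_le_succ fun p => by rcases m.step p with h | h <;> omega

theorem Match.le (m : Match c w cnt) (p : ℕ) : cnt p ≤ c.k := by
  induction p with
  | zero => rw [m.zero]; exact Nat.zero_le _
  | succ p ih => rcases m.step p with h | h <;> omega

/-- The position of the marker `i`. -/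
theorem Match.exists_marker (m : Match c w cnt) {i : ℕ} (hi : i < c.k) :
    ∃ p, cnt p = i ∧ cnt (p + 1) = i + 1 := by
  obtain ⟨q, hq⟩ := m.last
  have : ∃ p, i < cnt p := ⟨q, by omega⟩
  classical
  obtain ⟨p, hp⟩ : ∃ p, Nat.find this = p + 1 :=
    Nat.exists_eq_succ_of_ne_zero fun h => by
      have := Nat.find_spec this
      rw [h, m.zero] at this
      omega
  have h1 := Nat.find_spec this
  have h2 := Nat.find_min this (m := p) (by omega)
  rw [hp] at h1
  exact ⟨p, by rcases m.step p with h | h <;> omega, by rcases m.step p with h | h <;> omega⟩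

theorem Match.lt_of_marker (m : Match c w cnt) {p q : ℕ} (h : cnt (p + 1) = cnt p + 1)
    (hpq : p < q) : cnt p < cnt q := by
  have := m.mono (Nat.succ_le_of_lt hpq)
  simp only [Nat.succ_eq_add_one] at this
  omega

theorem Match.lt_of_lt (m : Match c w cnt) {p q : ℕ} (h : cnt p < cnt q) : p < q :=
  not_le.1 fun h' => absurd (m.mono h') (by omega)

variable (hc : c.Wf n)

include hc

theorem On.unique {p r s : ℕ} (h : On c w cnt p r) (h' : On c w cnt p s) : r = s := by
  by_contra hne
  have := hc.disj r h.lt s h'.lt hne (h.letter.trans h'.letter.symm)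
  have := h.st_le; have := h.le_en; have := h'.st_le; have := h'.le_en
  omega

theorem Match.exists_on (m : Match c w cnt) (p : ℕ) : ∃ r, On c w cnt p r := by
  rcases m.step p with ⟨-, -, r, hr, hl, h⟩ | ⟨-, r, hr, hl, h1, h2⟩
  · have := (hc.run r hr).2.1
    exact ⟨r, hr, hl, by omega, by omega⟩
  · exact ⟨r, hr, hl, h1.le, h2⟩

theorem Match.on_marker (m : Match c w cnt) {p r i : ℕ} (hr : r < c.R) (h1 : cnt p = i)
    (h2 : cnt (p + 1) = i + 1) (h : c.st r = i ∨ c.en r = i) : On c w cnt p r := by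
  rcases m.step p with ⟨-, hk, s, hs, hl, h'⟩ | h'
  · rw [h1] at h' hk
    have := (hc.run r hr).2.1
    exact ⟨hr, (hc.letter r hr s hs i hk h h').trans hl, by omega, by omega⟩
  · omega

/-- The first position of a run is a marker, and it is the only one of the run before which there
are that many markers. -/
theorem Match.step_of_eq_st (m : Match c w cnt) {p r : ℕ} (h : On c w cnt p r)
    (hp : cnt p = c.st r) : cnt (p + 1) = cnt p + 1 := by
  rcases m.step p with h' | ⟨-, s, hs, hl, h1, h2⟩
  · exact h'.1
  · have := On.unique hc h ⟨hs, hl, h1.le, h2⟩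
    subst this
    omega

theorem Match.exists_first (m : Match c w cnt) {r : ℕ} (hr : r < c.R) :
    ∃ p, On c w cnt p r ∧ cnt p = c.st r ∧ cnt (p + 1) = cnt p + 1 := by
  obtain ⟨p, h1, h2⟩ := m.exists_marker (hc.run r hr).2.2.1
  exact ⟨p, m.on_marker hc hr h1 h2 (Or.inl rfl), h1, by omega⟩

theorem Match.exists_last (m : Match c w cnt) {r : ℕ} (hr : r < c.R) (h : c.en r < c.k) :
    ∃ p, On c w cnt p r ∧ cnt p = c.en r ∧ cnt (p + 1) = cnt p + 1 := by
  obtain ⟨p, h1, h2⟩ := m.exists_marker h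
  exact ⟨p, m.on_marker hc hr h1 h2 (Or.inr rfl), h1, by omega⟩

theorem Match.frequently_on (m : Match c w cnt) {r : ℕ} (hr : r < c.R) (h : c.en r = c.k) (N : ℕ) :
    ∃ p, N < p ∧ On c w cnt p r ∧ cnt p = c.k := by
  obtain ⟨h1, h2, h3, h4⟩ := hc.run r hr
  obtain ⟨q, hq⟩ := m.last
  obtain ⟨p, hp, hw⟩ := frequently_atTop.1 (m.often ⟨c.ℓ r, h1⟩ ⟨r, hr, rfl, h3, h.ge⟩) (N + q + 1)
  have hk : cnt p = c.k := le_antisymm (m.le p) (hq ▸ m.mono (by omega))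
  exact ⟨p, by omega, ⟨hr, by rw [hw], by omega, by omega⟩, hk⟩

/-- A run has a position after the marker `i` if its last marker is later. -/
theorem Match.exists_gt (m : Match c w cnt) {p s : ℕ} (hs : s < c.R)
    (h : cnt p < c.en s ∨ c.en s = c.k) : ∃ q, p < q ∧ On c w cnt q s := by
  by_cases hk : c.en s = c.k
  · obtain ⟨q, h1, h2, -⟩ := m.frequently_on hc hs hk p
    exact ⟨q, h1, h2⟩
  · obtain ⟨q, h1, h2, -⟩ := m.exists_last hc hs (lt_of_le_of_ne (hc.run s hs).2.2.2 hk)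
    exact ⟨q, m.lt_of_lt (by omega), h1⟩

theorem Match.exists_lt (m : Match c w cnt) {p s : ℕ} (hs : s < c.R) (h : c.st s < cnt p) :
    ∃ q, q < p ∧ On c w cnt q s := by
  obtain ⟨q, h1, h2, -⟩ := m.exists_first hc hs
  exact ⟨q, m.lt_of_lt (by omega), h1⟩

theorem Match.st_lt_en (m : Match c w cnt) {p q r s : ℕ} (hp : On c w cnt p r)
    (hq : On c w cnt q s) (hpq : p < q) : c.st r < c.en s := by
  have h1 := m.mono hpq.le
  have := hp.st_le; have := hq.le_en
  by_contra hlt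
  have := m.lt_of_marker (m.step_of_eq_st hc hp (by omega)) hpq
  omega

omit hc

/-- The relation computed from the certificate and the satisfaction of the formula of `e` agree, for
positions in the runs `run i` and `run j`. -/
def Agree (c : Cert) (w : ℕ → Fin n) (run : ℕ → ℕ) (e : Var × Formula n) : Prop :=
  ∀ i j, Formula.Sat w (asg e.1 i j) e.2 ↔ orient e.1 (c.Abs e.2) (run i) (run j) (ord i j)

/-- The computed truth agrees with satisfaction, provided that the computed witnesses exist. -/
theorem abs_iff {φ : Formula n} {run : ℕ → ℕ} (m : Match c w cnt) (hc : c.Wf n)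
    (hrun : ∀ p, On c w cnt p (run p))
    (H : ∀ e ∈ φ.exs, Agree c w run e →
      ∀ i, (c.fut e.1 (c.Abs e.2) (run i) → Formula.FutureWitness w e.1 e.2 i) ∧
        (c.past e.1 (c.Abs e.2) (run i) → Formula.PastWitness w e.1 e.2 i))
    (v : Var → ℕ) :
    Formula.Sat w v φ ↔ c.Abs φ (run (v .x)) (run (v .y)) (ord (v .x) (v .y)) := by
  induction φ generalizing v with
  | pred a u =>
    have h : u.pick (run (v .x)) (run (v .y)) = run (v u) := by cases u <;> rfl
    simp only [Formula.Sat, Abs, h, (hrun (v u)).letter, Fin.ext_iff]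
  | lt s t =>
    cases s <;> cases t <;> simp [Formula.Sat, Abs, ord] <;> split_ifs <;> simp <;> omega
  | eq s t =>
    cases s <;> cases t <;> simp [Formula.Sat, Abs, ord] <;> split_ifs <;> simp <;> omega
  | neg φ ih => simp only [Formula.Sat, Abs, ih H]
  | and φ ψ ih ih' =>
    simp only [Formula.Sat, Abs, ih fun e he => H e (List.mem_append_left _ he),
      ih' fun e he => H e (List.mem_append_right _ he)]
  | or φ ψ ih ih' =>
    simp only [Formula.Sat, Abs, ih fun e he => H e (List.mem_append_left _ he),
      ih' fun e he => H e (List.mem_append_right _ he)]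
  | ex u χ ih =>
    have ih := ih fun e he => H e (List.mem_cons_of_mem _ he)
    have hB : ∀ i j, Formula.Sat w (asg u i j) χ ↔
        orient u (c.Abs χ) (run i) (run j) (ord i j) := by
      intro i j
      rw [ih]
      cases u
      · simp only [asg, orient, if_true, reduceCtorEq, if_false]
        have : ord j i = swapOrd (ord i j) := by
          simp only [ord, swapOrd]; split_ifs <;> omega
        rw [this]
      · simp [asg, orient]
    have hH := H (u, χ) (by simp [Formula.exs]) hB
    have hpick : u.other.pick (run (v .x)) (run (v .y)) = run (v u.other) := by cases u <;> rfl
    have h0 : Formula.SatAt w χ (v u.other) ↔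
        c.Abs χ (run (v u.other)) (run (v u.other)) 0 := by
      rw [Formula.SatAt, ih]; simp [ord]
    rw [Formula.sat_ex_iff]
    simp only [Abs, hpick]
    generalize v u.other = i at *
    refine or_congr ⟨?_, (hH i).1⟩ (or_congr ⟨?_, (hH i).2⟩ h0)
    · rintro ⟨j, hij, hj⟩
      rw [hB] at hj
      have : ord i j = 1 := by simp only [ord]; split_ifs <;> omega
      exact ⟨run j, (hrun j).lt, m.st_lt_en hc (hrun i) (hrun j) hij, this ▸ hj⟩
    · rintro ⟨j, hij, hj⟩
      rw [hB] at hj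
      have : ord i j = 2 := by simp only [ord]; split_ifs <;> omega
      exact ⟨run j, (hrun j).lt, m.st_lt_en hc (hrun j) (hrun i) hij, this ▸ hj⟩

theorem Agree.future {e : Var × Formula n} {run : ℕ → ℕ} (h : Agree c w run e) {i j : ℕ}
    (hij : i < j) (ho : orient e.1 (c.Abs e.2) (run i) (run j) 1) :
    Formula.FutureWitness w e.1 e.2 i := by
  refine ⟨j, hij, (h i j).2 ?_⟩
  have : ord i j = 1 := by simp only [ord]; split_ifs <;> omega
  rwa [this]

theorem Agree.past {e : Var × Formula n} {run : ℕ → ℕ} (h : Agree c w run e) {i j : ℕ}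
    (hij : j < i) (ho : orient e.1 (c.Abs e.2) (run i) (run j) 2) :
    Formula.PastWitness w e.1 e.2 i := by
  refine ⟨j, hij, (h i j).2 ?_⟩
  have : ord i j = 2 := by simp only [ord]; split_ifs <;> omega
  rwa [this]

/-- The computed truth agrees with satisfaction for the formula at the initial position and for the
witnesses of all its existential subformulas, provided that the computed witnesses exist. -/
theorem agree_of {φ : Formula n} {run : ℕ → ℕ} (m : Match c w cnt) (hc : c.Wf n)
    (hrun : ∀ p, On c w cnt p (run p))
    (H : ∀ e ∈ φ.exs, Agree c w run e →
      ∀ i, (c.fut e.1 (c.Abs e.2) (run i) → Formula.FutureWitness w e.1 e.2 i) ∧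
        (c.past e.1 (c.Abs e.2) (run i) → Formula.PastWitness w e.1 e.2 i)) :
    (Formula.SatAt w φ 0 ↔ c.Abs φ (run 0) (run 0) 0) ∧
    ∀ e ∈ φ.exs, Agree c w run e ∧
      ∀ i, (c.fut e.1 (c.Abs e.2) (run i) ↔ Formula.FutureWitness w e.1 e.2 i) ∧
        (c.past e.1 (c.Abs e.2) (run i) ↔ Formula.PastWitness w e.1 e.2 i) := by
  refine ⟨abs_iff m hc hrun H _, fun e he => ?_⟩
  have hA : Agree c w run e := by
    rintro i j
    obtain ⟨u, χ⟩ := e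
    rw [abs_iff m hc hrun fun e' he' => H e' (Formula.mem_exs_trans he he')]
    cases u
    · have : ord j i = swapOrd (ord i j) := by
        simp only [ord, swapOrd]; split_ifs <;> omega
      simp [asg, orient, this]
    · simp [asg, orient]
  refine ⟨hA, fun i => ⟨⟨(H e he hA i).1, ?_⟩, ⟨(H e he hA i).2, ?_⟩⟩⟩
  · rintro ⟨j, hij, hj⟩
    rw [hA i j] at hj
    have : ord i j = 1 := by simp only [ord]; split_ifs <;> omega
    exact ⟨run j, (hrun j).lt, m.st_lt_en hc (hrun i) (hrun j) hij, this ▸ hj⟩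
  · rintro ⟨j, hij, hj⟩
    rw [hA i j] at hj
    have : ord i j = 2 := by simp only [ord]; split_ifs <;> omega
    exact ⟨run j, (hrun j).lt, m.st_lt_en hc (hrun j) (hrun i) hij, this ▸ hj⟩

/-- If the certificate says that the witnesses do not change within a run, then the computed truth
agrees with satisfaction. -/
theorem agree_of_const {φ : Formula n} {run : ℕ → ℕ} (m : Match c w cnt) (hc : c.Wf n)
    (hrun : ∀ p, On c w cnt p (run p))
    (H : ∀ e ∈ φ.exs, ∀ r < c.R, (c.fut e.1 (c.Abs e.2) r → c.futLast e.1 (c.Abs e.2) r) ∧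
      (c.past e.1 (c.Abs e.2) r → c.pastFirst e.1 (c.Abs e.2) r)) :
    (Formula.SatAt w φ 0 ↔ c.Abs φ (run 0) (run 0) 0) ∧
    ∀ e ∈ φ.exs, Agree c w run e ∧
      ∀ i, (c.fut e.1 (c.Abs e.2) (run i) ↔ Formula.FutureWitness w e.1 e.2 i) ∧
        (c.past e.1 (c.Abs e.2) (run i) ↔ Formula.PastWitness w e.1 e.2 i) := by
  refine agree_of m hc hrun fun e he hA i => ⟨fun h => ?_, fun h => ?_⟩
  · obtain ⟨s, hs, h1, h2⟩ := (H e he _ (hrun i).lt).1 h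
    obtain ⟨j, hij, hj⟩ := m.exists_gt hc (p := i) hs (h1.imp_left (hrun i).le_en.trans_lt)
    exact hA.future hij (On.unique hc (hrun j) hj ▸ h2)
  · obtain ⟨s, hs, h1, h2⟩ := (H e he _ (hrun i).lt).2 h
    obtain ⟨j, hij, hj⟩ := m.exists_lt hc (p := i) hs (h1.trans_le (hrun i).st_le)
    exact hA.past hij (On.unique hc (hrun j) hj ▸ h2)

/-- If the type of the positions does not change within a run, then the computed truth agrees with
satisfaction, and the certificate says that the witnesses do not change. -/
theorem agree_of_sameType {φ : Formula n} {run : ℕ → ℕ} (m : Match c w cnt) (hc : c.Wf n)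
    (hrun : ∀ p, On c w cnt p (run p))
    (H : ∀ p q, run p = run q → Formula.SameType w φ p q) :
    (Formula.SatAt w φ 0 ↔ c.Abs φ (run 0) (run 0) 0) ∧
    ∀ e ∈ φ.exs, Agree c w run e ∧
      ∀ i, (c.fut e.1 (c.Abs e.2) (run i) ↔ Formula.FutureWitness w e.1 e.2 i) ∧
        (c.past e.1 (c.Abs e.2) (run i) ↔ Formula.PastWitness w e.1 e.2 i) := by
  refine agree_of m hc hrun fun e he hA i => ⟨?_, ?_⟩
  · rintro ⟨s, hs, h1, h2⟩
    obtain ⟨i', hi', hi1, -⟩ := m.exists_first hc (hrun i).lt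
    obtain ⟨j, hij, hj⟩ := m.exists_gt hc (p := i') hs (Or.inl (hi1 ▸ h1))
    have hri := On.unique hc (hrun i') hi'
    refine (H i' i hri e he).1.1 (hA.future hij ?_)
    rw [hri, On.unique hc (hrun j) hj]
    exact h2
  · rintro ⟨s, hs, h1, h2⟩
    obtain ⟨j, hj, hj1, -⟩ := m.exists_first hc hs
    obtain ⟨i', hij, hi'⟩ := m.exists_gt hc (p := j) (hrun i).lt (Or.inl (hj1 ▸ h1))
    have hri := On.unique hc (hrun i') hi'
    refine (H i' i hri e he).2.1 (hA.past hij ?_)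
    rw [hri, On.unique hc (hrun j) hj]
    exact h2

/-- If the positions of a run have the same type, then a witness in the future of the first position
gives one in the future of the last, and likewise for the past. -/
theorem const_of_sameType {φ : Formula n} {run : ℕ → ℕ} (m : Match c w cnt) (hc : c.Wf n)
    (hrun : ∀ p, On c w cnt p (run p))
    (H : ∀ p q, run p = run q → Formula.SameType w φ p q) {e : Var × Formula n} (he : e ∈ φ.exs)
    {r : ℕ} (hr : r < c.R) :
    (c.fut e.1 (c.Abs e.2) r → c.futLast e.1 (c.Abs e.2) r) ∧
      (c.past e.1 (c.Abs e.2) r → c.pastFirst e.1 (c.Abs e.2) r) := by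
  obtain ⟨i, hi, hi1, hi2⟩ := m.exists_first hc hr
  obtain rfl := On.unique hc hi (hrun i)
  obtain ⟨hA, hag⟩ := (agree_of_sameType m hc hrun H).2 e he
  refine ⟨fun h => ?_, fun h => ?_⟩
  · have h := (hag i).1.1 h
    -- the last position of the run if there is one, otherwise one behind all markers
    obtain ⟨i', hi', h'⟩ : ∃ i', On c w cnt i' (run i) ∧
        ((cnt i' = c.en (run i) ∧ cnt (i' + 1) = cnt i' + 1) ∨ cnt i' = c.k) := by
      by_cases hk : c.en (run i) = c.k
      · obtain ⟨p, -, h1, h2⟩ := m.frequently_on hc hr hk 0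
        exact ⟨p, h1, Or.inr h2⟩
      · obtain ⟨p, h1, h2⟩ := m.exists_last hc hr (lt_of_le_of_ne (hc.run _ hr).2.2.2 hk)
        exact ⟨p, h1, Or.inl h2⟩
    have hri := On.unique hc (hrun i') hi'
    obtain ⟨j, hij, hj⟩ := (H i' i hri e he).1.2 h
    rw [hA i' j, hri] at hj
    have ho : ord i' j = 1 := by simp only [ord]; split_ifs <;> omega
    rw [ho] at hj
    refine ⟨run j, (hrun j).lt, ?_, hj⟩
    have h3 := (hrun j).le_en
    rcases h' with ⟨h1, h2⟩ | h1
    · exact Or.inl (by have := m.lt_of_marker h2 hij; omega)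
    · have := m.mono hij.le
      have := (hc.run _ (hrun j).lt).2.2.2
      exact Or.inr (by omega)
  · obtain ⟨j, hij, hj⟩ := (hag i).2.1 h
    rw [hA i j] at hj
    have ho : ord i j = 2 := by simp only [ord]; split_ifs <;> omega
    rw [ho] at hj
    refine ⟨run j, (hrun j).lt, ?_, hj⟩
    have h3 := (hrun j).st_le
    have h4 := m.mono hij.le
    by_contra hlt
    have := m.lt_of_marker (m.step_of_eq_st hc (hrun j) (by omega)) hij
    omega

end Cert

/-! ### The markers are determined by the word -/

/-- The position `p` starts a run: its type differs from that at the previous position with the same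
letter, if there is one. -/
def IsStart {n : ℕ} (w : ℕ → Fin n) (φ : Formula n) (p : ℕ) : Prop :=
  ∀ q < p, w q = w p → (∀ z, q < z → z < p → w z ≠ w p) → ¬ Formula.SameType w φ q p

/-- The position `p` ends a run: its type differs from that at the next position with the same
letter, if there is one. -/
def IsEnd {n : ℕ} (w : ℕ → Fin n) (φ : Formula n) (p : ℕ) : Prop :=
  ∀ q, p < q → w q = w p → (∀ z, p < z → z < q → w z ≠ w p) → ¬ Formula.SameType w φ p q

theorem exists_prev {n : ℕ} {w : ℕ → Fin n} {p q : ℕ} (h : q < p) (hw : w q = w p) :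
    ∃ z, q ≤ z ∧ z < p ∧ w z = w p ∧ ∀ z', z < z' → z' < p → w z' ≠ w p := by
  have hb : ∀ z, z < p ∧ w z = w p → z ≤ p := fun z hz => hz.1.le
  classical
  have h1 := Nat.findGreatest_spec (P := fun z => z < p ∧ w z = w p) h.le ⟨h, hw⟩
  refine ⟨_, Nat.le_findGreatest h.le ⟨h, hw⟩, h1.1, h1.2, fun z' h2 h3 h4 => ?_⟩
  exact Nat.findGreatest_is_greatest h2 h3.le ⟨h3, h4⟩

theorem exists_next {n : ℕ} {w : ℕ → Fin n} {p q : ℕ} (h : p < q) (hw : w q = w p) :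
    ∃ z, z ≤ q ∧ p < z ∧ w z = w p ∧ ∀ z', p < z' → z' < z → w z' ≠ w p := by
  classical
  have hex : ∃ z, p < z ∧ w z = w p := ⟨q, h, hw⟩
  exact ⟨Nat.find hex, Nat.find_min' hex ⟨h, hw⟩, (Nat.find_spec hex).1, (Nat.find_spec hex).2,
    fun z' h1 h2 h3 => Nat.find_min hex h2 ⟨h1, h3⟩⟩

namespace Cert

variable {c c' : Cert} {n : ℕ} {w : ℕ → Fin n} {cnt cnt' : ℕ → ℕ} {φ : Formula n}

theorem Match.exists_run (m : Match c w cnt) (hc : c.Wf n) :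
    ∃ run : ℕ → ℕ, ∀ p, On c w cnt p (run p) :=
  ⟨fun p => (m.exists_on hc p).choose, fun p => (m.exists_on hc p).choose_spec⟩

/-- The constancy conditions of a valid certificate make the type constant on its runs. -/
theorem Valid.sameType (hv : c.Valid φ) (m : Match c w cnt) {p q r : ℕ} (hp : On c w cnt p r)
    (hq : On c w cnt q r) : Formula.SameType w φ p q := by
  obtain ⟨run, hrun⟩ := m.exists_run hv.wf
  have h := (agree_of_const m hv.wf hrun hv.const).2
  intro e he
  rw [← ((h e he).2 p).1, ← ((h e he).2 p).2, ← ((h e he).2 q).1, ← ((h e he).2 q).2,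
    On.unique hv.wf (hrun p) hp, On.unique hv.wf (hrun q) hq]
  exact ⟨Iff.rfl, Iff.rfl⟩

theorem Match.en_lt_st (m : Match c w cnt) (hc : c.Wf n) {p q r s : ℕ} (hp : On c w cnt p r)
    (hq : On c w cnt q s) (hpq : p ≤ q) (hw : w p = w q) (hne : r ≠ s) : c.en r < c.st s := by
  have h1 := hc.disj r hp.lt s hq.lt hne (by rw [hp.letter, hq.letter, hw])
  have := m.mono hpq
  have := hp.st_le; have := hp.le_en; have := hq.st_le; have := hq.le_en
  omega

/-- The type changes between successive positions of a letter in different runs of a valid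
certificate, because there is no other run of the letter in between. -/
theorem Valid.not_sameType (hv : c.Valid φ) (m : Match c w cnt) {p q r s : ℕ}
    (hp : On c w cnt p r) (hq : On c w cnt q s) (hpq : p < q) (hw : w p = w q)
    (hb : ∀ z, p < z → z < q → w z ≠ w p) (hne : r ≠ s) : ¬ Formula.SameType w φ p q := by
  intro hs
  obtain ⟨run, hrun⟩ := m.exists_run hv.wf
  have h := (agree_of_const m hv.wf hrun hv.const).2
  have hlt := m.en_lt_st hv.wf hp hq hpq.le hw hne
  obtain ⟨e, he, hd⟩ := hv.maximal r hp.lt s hq.lt (by rw [hp.letter, hq.letter, hw]) hlt (by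
    intro t ht hl h1 h2
    obtain ⟨z, hz, hz1, -⟩ := m.exists_first hv.wf ht
    have h3 := (hv.wf.run t ht).2.1
    have h4 := hp.le_en
    have h5 := hq.st_le
    refine hb z (m.lt_of_lt (by omega)) (m.lt_of_lt (by omega)) (Fin.ext ?_)
    rw [← hz.letter, hl, hp.letter])
  apply hd
  have h1 := (h e he).2 p
  have h2 := (h e he).2 q
  rw [On.unique hv.wf (hrun p) hp] at h1
  rw [On.unique hv.wf (hrun q) hq] at h2
  rw [h1.1, h1.2, h2.1, h2.2]
  exact hs e he

/-- The first position of a run of a valid certificate is recognised by the types alone. -/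
theorem Valid.isStart_iff (hv : c.Valid φ) (m : Match c w cnt) {p r : ℕ} (hp : On c w cnt p r) :
    IsStart w φ p ↔ cnt p = c.st r := by
  constructor
  · intro h
    by_contra hne
    have hlt : c.st r < cnt p := lt_of_le_of_ne hp.st_le (Ne.symm hne)
    obtain ⟨q0, h1, h2, -⟩ := m.exists_first hv.wf hp.lt
    have hw : w q0 = w p := Fin.ext (h1.letter.symm.trans hp.letter)
    obtain ⟨q, h3, h4, h5, h6⟩ := exists_prev (m.lt_of_lt (h2 ▸ hlt)) hw
    refine h q h4 h5 h6 (hv.sameType m ⟨hp.lt, by rw [h5, hp.letter], ?_, ?_⟩ hp)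
    · exact h2 ▸ m.mono h3
    · exact (m.mono h4.le).trans hp.le_en
  · intro h q hq hw hb
    obtain ⟨s, hs⟩ := m.exists_on hv.wf q
    refine hv.not_sameType m hs hp hq hw (by rwa [hw]) ?_
    rintro rfl
    have h1 := hs.st_le
    have h2 := m.mono hq.le
    have := m.lt_of_marker (m.step_of_eq_st hv.wf hs (by omega)) hq
    omega

/-- The last position of a finite run of a valid certificate is recognised by the types alone. A
position before which all markers lie has `cnt p = c.en r` in an infinite run, hence the first
condition. -/
theorem Valid.isEnd_iff (hv : c.Valid φ) (m : Match c w cnt) {p r : ℕ} (hp : On c w cnt p r) :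
    IsEnd w φ p ↔ cnt (p + 1) = cnt p + 1 ∧ cnt p = c.en r := by
  constructor
  · intro h
    by_contra hne
    obtain ⟨q0, h1, h2⟩ : ∃ q0, p < q0 ∧ On c w cnt q0 r := by
      by_cases hlt : cnt p < c.en r ∨ c.en r = c.k
      · exact m.exists_gt hv.wf hp.lt hlt
      · have hle := hp.le_en
        have := (hv.wf.run r hp.lt).2.2.2
        obtain ⟨q, h1, h2, h3⟩ := m.exists_last hv.wf hp.lt (by omega)
        refine ⟨q, lt_of_not_ge fun hqp => ?_, h1⟩
        rcases hqp.lt_or_eq with h | rfl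
        · have := m.lt_of_marker h3 h
          omega
        · omega
    have hw : w q0 = w p := Fin.ext (h2.letter.symm.trans hp.letter)
    obtain ⟨q, h3, h4, h5, h6⟩ := exists_next h1 hw
    refine h q h4 h5 h6 (hv.sameType m hp ⟨hp.lt, by rw [h5, hp.letter], ?_, ?_⟩)
    · exact hp.st_le.trans (m.mono h4.le)
    · exact (m.mono h3).trans h2.le_en
  · rintro ⟨h, h'⟩ q hq hw hb
    obtain ⟨s, hs⟩ := m.exists_on hv.wf q
    refine hv.not_sameType m hp hs hq hw.symm hb ?_
    rintro rfl
    have h1 := hs.le_en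
    have := m.lt_of_marker h hq
    omega

/-- The markers of a word can be recognised without the certificate. -/
theorem Valid.marker_iff (hv : c.Valid φ) (m : Match c w cnt) (p : ℕ) :
    cnt (p + 1) = cnt p + 1 ↔ IsStart w φ p ∨ IsEnd w φ p := by
  obtain ⟨r, hr⟩ := m.exists_on hv.wf p
  rw [hv.isStart_iff m hr, hv.isEnd_iff m hr]
  constructor
  · intro h
    rcases m.step p with ⟨-, hk, s, hs, hl, h'⟩ | ⟨h', -⟩
    · have h3 := (hv.wf.run s hs).2.1
      obtain rfl := On.unique hv.wf hr ⟨hs, hl, by omega, by omega⟩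
      omega
    · omega
  · rintro (h | h)
    · exact m.step_of_eq_st hv.wf hr h
    · exact h.1

/-- The markers of a word are the same for all valid certificates. -/
theorem Valid.cnt_unique (hv : c.Valid φ) (m : Match c w cnt) (hv' : c'.Valid φ)
    (m' : Match c' w cnt') : cnt = cnt' := by
  funext p
  induction p with
  | zero => rw [m.zero, m'.zero]
  | succ p ih =>
    have h1 := hv.marker_iff m p
    have h2 := hv'.marker_iff m' p
    have h3 := m.step p
    have h4 := m'.step p
    by_cases h : IsStart w φ p ∨ IsEnd w φ p
    · rw [h1.2 h, h2.2 h, ih]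
    · have h5 := mt h1.1 h
      have h6 := mt h2.1 h
      omega

theorem Match.k_unique (m : Match c w cnt) (m' : Match c' w cnt) : c.k = c'.k := by
  obtain ⟨p, hp⟩ := m.last
  obtain ⟨p', hp'⟩ := m'.last
  have := m.le p'
  have := m'.le p
  omega

theorem Match.mark_iff (m : Match c w cnt) (hc : c.Wf n) {i : ℕ} (hi : i < c.k) (a : Fin n) :
    c.Mark i a ↔ ∃ p, cnt p = i ∧ cnt (p + 1) = i + 1 ∧ w p = a := by
  constructor
  · rintro ⟨r, hr, hl, h⟩
    obtain ⟨p, h1, h2⟩ := m.exists_marker hi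
    have := (m.on_marker hc hr h1 h2 h).letter
    exact ⟨p, h1, h2, Fin.ext (by omega)⟩
  · rintro ⟨p, rfl, h2, rfl⟩
    rcases m.step p with h | h
    · exact h.2.2
    · omega

/-- The letters allowed between two markers are determined by the word, although the numbering of
the runs in the certificate is not. -/
theorem Valid.opn_iff (hv : c.Valid φ) (m : Match c w cnt) {i : ℕ} (hi : i ≤ c.k) (a : Fin n) :
    c.Opn i a ↔ ∃ p q, p ≤ q ∧ w p = a ∧ w q = a ∧ cnt p < i ∧ i ≤ cnt q ∧
      ∀ z, p < z → z ≤ q → w z = a → ¬ IsStart w φ z := by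
  constructor
  · rintro ⟨r, hr, hl, h1, h2⟩
    obtain ⟨p, hp, hp1, hp2⟩ := m.exists_first hv.wf hr
    obtain ⟨q, hq, hq1⟩ : ∃ q, On c w cnt q r ∧ i ≤ cnt q := by
      by_cases hk : c.en r = c.k
      · obtain ⟨q, -, h3, h4⟩ := m.frequently_on hv.wf hr hk 0
        exact ⟨q, h3, by omega⟩
      · obtain ⟨q, h3, h4, -⟩ := m.exists_last hv.wf hr
          (lt_of_le_of_ne (hv.wf.run r hr).2.2.2 hk)
        exact ⟨q, h3, by omega⟩
    refine ⟨p, q, (m.lt_of_lt (by omega)).le, Fin.ext (by rw [← hp.letter, hl]),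
      Fin.ext (by rw [← hq.letter, hl]), by omega, hq1, fun z hz1 hz2 hz hs => ?_⟩
    have h3 := m.lt_of_marker hp2 hz1
    have h4 := m.mono hz2
    have h5 := hq.le_en
    have := (hv.isStart_iff m ⟨hr, by rw [hl, hz], by omega, by omega⟩).1 hs
    omega
  · rintro ⟨p, q, hpq, rfl, hw, h1, h2, h3⟩
    obtain ⟨r, hr⟩ := m.exists_on hv.wf p
    obtain ⟨s, hs⟩ := m.exists_on hv.wf q
    by_cases hrs : r = s
    · subst hrs
      exact ⟨r, hr.lt, hr.letter, hr.st_le.trans_lt h1, h2.trans hs.le_en⟩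
    · exfalso
      have h4 := m.en_lt_st hv.wf hr hs hpq hw.symm hrs
      obtain ⟨z, hz, hz1, hz2⟩ := m.exists_first hv.wf hs.lt
      have h5 := hr.le_en
      have h6 := hs.st_le
      refine h3 z (m.lt_of_lt (by omega)) (not_lt.1 fun h => ?_) ?_ ((hv.isStart_iff m hz).2 hz1)
      · have := m.mono h.le
        have := m.lt_of_marker (m.step_of_eq_st hv.wf hs (by omega)) h
        omega
      · rw [← hw]; exact Fin.ext (by rw [← hz.letter, hs.letter])

end Cert

/-! ### The automaton of a certificate -/

namespace Cert

/-- The transitions: a state `s ≤ k` counts the markers that have been read; when all of them have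
been read, the state is `k + 1 + a` for the last letter `a`. -/
def Trans (c : Cert) (s a t : ℕ) : Prop :=
  (s < c.k ∧ t = s ∧ c.Opn s a) ∨ (s < c.k ∧ t = s + 1 ∧ c.Mark s a) ∨
    (c.k ≤ s ∧ t = c.k + 1 + a ∧ c.Opn c.k a)

/-- The accepting set for the letter `b` requires that `b` is read infinitely often if it has an
infinite run. -/
def Acc (c : Cert) (b s : ℕ) : Prop := c.k < s ∧ (s = c.k + 1 + b ∨ ¬ c.Opn c.k b)

open Classical in
/-- The automaton of the words that have the shape described by the certificate. -/
noncomputable def aut (c : Cert) (n : ℕ) : GBA n where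
  numStates := c.k + 1 + n
  numAcc := n
  init s := decide ((s : ℕ) = 0)
  trans s a t := decide (c.Trans s a t)
  acc b s := decide (c.Acc b s)

variable {c : Cert} {n : ℕ} {w : ℕ → Fin n} {cnt : ℕ → ℕ}

theorem init_aut {s : Fin (c.aut n).numStates} : (c.aut n).init s = true ↔ (s : ℕ) = 0 := by
  simp [aut]

theorem trans_aut {s t : Fin (c.aut n).numStates} {a : Fin n} :
    (c.aut n).trans s a t = true ↔ c.Trans s a t := by
  simp [aut]

theorem acc_aut {b : Fin n} {s : Fin (c.aut n).numStates} :
    (c.aut n).acc b s = true ↔ c.Acc b s := by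
  simp [aut]

/-- The number of markers read along a run is the state, capped at `k`. -/
theorem steps_of_run {s : Fin (c.aut n).numStates} {ρ : ℕ → Fin (c.aut n).numStates}
    (h : (c.aut n).IsAcceptingRunFrom s w ρ) :
    (∀ p, (min (ρ (p + 1) : ℕ) c.k = min (ρ p : ℕ) c.k + 1 ∧ min (ρ p : ℕ) c.k < c.k ∧
        c.Mark (min (ρ p : ℕ) c.k) (w p)) ∨
      (min (ρ (p + 1) : ℕ) c.k = min (ρ p : ℕ) c.k ∧ c.Opn (min (ρ p : ℕ) c.k) (w p))) ∧
    (∃ p, min (ρ p : ℕ) c.k = c.k) ∧ ∀ b : Fin n, c.Opn c.k b → ∃ᶠ p in atTop, w p = b := by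
  obtain ⟨-, h1, h2⟩ := h
  have h1 : ∀ p, c.Trans (ρ p) (w p) (ρ (p + 1)) := fun p => trans_aut.1 (h1 p)
  refine ⟨fun p => ?_, ?_, fun b hb => ?_⟩
  · rcases h1 p with ⟨h3, h4, h5⟩ | ⟨h3, h4, h5⟩ | ⟨h3, h4, h5⟩
    · rw [h4, min_eq_left h3.le]; exact Or.inr ⟨rfl, h5⟩
    · rw [h4, min_eq_left h3.le, min_eq_left (Nat.succ_le_of_lt h3)]
      exact Or.inl ⟨rfl, h3, h5⟩
    · rw [h4, min_eq_right h3, min_eq_right (by omega)]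
      exact Or.inr ⟨rfl, h5⟩
  · obtain ⟨q, hq, hf⟩ := h2 (w 0)
    obtain ⟨p, rfl⟩ := hf.exists
    have hq : c.Acc (w 0) (ρ p) := acc_aut.1 hq
    exact ⟨p, min_eq_right hq.1.le⟩
  · obtain ⟨q, hq, hf⟩ := h2 b
    have hq : c.Acc b q := acc_aut.1 hq
    refine frequently_atTop.2 fun N => ?_
    obtain ⟨p, hp, rfl⟩ := frequently_atTop.1 hf (N + 1)
    obtain ⟨p, rfl⟩ : ∃ p', p = p' + 1 := ⟨p - 1, by omega⟩
    refine ⟨p, by omega, ?_⟩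
    obtain ⟨h6, h7 | h7⟩ := hq
    · rcases h1 p with h | h | h
      · omega
      · omega
      · exact Fin.ext (by omega)
    · exact absurd hb h7

theorem match_of_run {ρ : ℕ → Fin (c.aut n).numStates} (h : (c.aut n).IsAcceptingRun w ρ) :
    Match c w fun p => min (ρ p : ℕ) c.k := by
  obtain ⟨s, hs, h⟩ := h
  have hs : (s : ℕ) = 0 := init_aut.1 hs
  obtain ⟨h1, h2, h3⟩ := steps_of_run h
  exact ⟨by simp [h.1, hs], h1, h2, h3⟩

theorem run_of_match (m : Match c w cnt) : ∃ ρ, (c.aut n).IsAcceptingRun w ρ := by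
  have hlt' : ∀ p, (if cnt p < c.k then cnt p else if p = 0 ∨ cnt (p - 1) < c.k then c.k else
      c.k + 1 + (w (p - 1) : ℕ)) < c.k + 1 + n := by
    intro p
    have := (w (p - 1)).2
    split_ifs <;> omega
  refine ⟨fun p => ⟨_, hlt' p⟩, ⟨⟨0, by show 0 < c.k + 1 + n; omega⟩, by simp [aut], ?_, ?_, ?_⟩⟩
  · apply Fin.ext
    simp only [m.zero]
    split_ifs with h
    · rfl
    · simp at *; omega
    · simp at *
  · intro p
    refine trans_aut.2 ?_
    simp only [Trans, Nat.add_sub_cancel, Nat.add_eq_zero_iff, one_ne_zero, and_false, false_or]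
    have hle := m.le p
    rcases m.step p with ⟨h1, h2, h3⟩ | ⟨h1, h2⟩
    · refine Or.inr (Or.inl ⟨?_, ?_, ?_⟩)
      · rw [if_pos h2]; exact h2
      · rw [if_pos h2, h1, if_pos h2]; split_ifs <;> omega
      · rw [if_pos h2]; exact h3
    · by_cases hk : cnt p < c.k
      · refine Or.inl ⟨?_, ?_, ?_⟩
        · rw [if_pos hk]; exact hk
        · rw [h1, if_pos hk, if_pos hk]
        · rw [if_pos hk]; exact h2
      · refine Or.inr (Or.inr ⟨?_, ?_, ?_⟩)
        · rw [if_neg hk]; split_ifs <;> omega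
        · rw [h1, if_neg hk, if_neg hk]
        · rwa [le_antisymm hle (not_lt.1 hk)] at h2
  · intro b
    obtain ⟨N, hN⟩ := m.last
    have hN : ∀ p, N ≤ p → cnt p = c.k := fun p hp => le_antisymm (m.le p) (hN ▸ m.mono hp)
    have hlt : ∀ a : Fin n, c.k + 1 + (a : ℕ) < c.k + 1 + n := fun a => by
      have := a.2
      omega
    have key : ∀ a : Fin n, (∃ᶠ p in atTop, w p = a) → ∃ᶠ p in atTop,
        (⟨_, hlt' p⟩ : Fin (c.aut n).numStates) = ⟨c.k + 1 + (a : ℕ), hlt a⟩ := by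
      intro a ha
      refine frequently_atTop.2 fun M => ?_
      obtain ⟨p, hp, hw⟩ := frequently_atTop.1 ha (M + N)
      refine ⟨p + 1, by omega, Fin.ext ?_⟩
      simp [hN p (by omega), hN (p + 1) (by omega), hw]
    by_cases hb : c.Opn c.k b
    · exact ⟨⟨_, hlt b⟩, acc_aut.2 ⟨by simp only; omega, Or.inl rfl⟩, key b (m.often b hb)⟩
    · have : Nonempty (Fin n) := ⟨w 0⟩
      obtain ⟨a, ha⟩ := Finite.exists_infinite_fiber w
      refine ⟨⟨_, hlt a⟩, acc_aut.2 ⟨?_, Or.inr hb⟩, key a ?_⟩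
      · simp only; omega
      · rw [Nat.frequently_atTop_iff_infinite]
        exact Set.infinite_coe_iff.1 ha

theorem mem_lang_aut : w ∈ (c.aut n).lang ↔ ∃ cnt, Match c w cnt :=
  ⟨fun ⟨_, h⟩ => ⟨_, match_of_run h⟩, fun ⟨_, m⟩ => run_of_match m⟩

theorem deterministic_of_le {s : Fin (c.aut n).numStates} (h : c.k ≤ s) :
    (c.aut n).IsDeterministicState s := by
  intro a t t' h1 h2
  have h1 : c.Trans s a t := trans_aut.1 h1
  have h2 : c.Trans s a t' := trans_aut.1 h2
  simp only [Trans] at h1 h2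
  exact Fin.ext (by omega)

theorem deterministicInLimit : (c.aut n).DeterministicInLimit := by
  rintro s t hs hst
  rcases hs with hn | ⟨j, hj⟩
  · intro a
    exact absurd a.2 (by have : n = 0 := hn; omega)
  · have hs : c.Acc j s := acc_aut.1 hj
    refine deterministic_of_le ?_
    have : c.k ≤ (s : ℕ) := hs.1.le
    induction hst with
    | refl => exact this
    | tail _ h ih =>
      obtain ⟨a, h⟩ := h
      have h : c.Trans _ a _ := trans_aut.1 h
      simp only [Trans] at h
      omega

/-- The number of markers read so far determines a run from a given state, since the states behind
the last marker hold the last letter. -/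
theorem run_ext {s : Fin (c.aut n).numStates} {ρ ρ' : ℕ → Fin (c.aut n).numStates}
    (h : (c.aut n).IsAcceptingRunFrom s w ρ) (h' : (c.aut n).IsAcceptingRunFrom s w ρ')
    (hmin : ∀ p, min (ρ p : ℕ) c.k = min (ρ' p : ℕ) c.k) : ρ = ρ' := by
  funext p
  induction p with
  | zero => rw [h.1, h'.1]
  | succ p ih =>
    have h1 : c.Trans (ρ p) (w p) (ρ (p + 1)) := trans_aut.1 (h.2.1 p)
    have h2 : c.Trans (ρ' p) (w p) (ρ' (p + 1)) := trans_aut.1 (h'.2.1 p)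
    have h3 := hmin (p + 1)
    rw [ih] at h1
    simp only [Trans] at h1 h2
    exact Fin.ext (by omega)

/-- A run from the state `s < k` becomes a run from the initial state when the word is preceded by
the letters of the first `s` markers. -/
theorem match_prefix {s : Fin (c.aut n).numStates} (hs : (s : ℕ) < c.k)
    {pre : ℕ → Fin n} (hpre : ∀ i < c.k, c.Mark i (pre i)) {ρ : ℕ → Fin (c.aut n).numStates}
    (h : (c.aut n).IsAcceptingRunFrom s w ρ) :
    Match c (fun p => if p < s then pre p else w (p - s))
      fun p => if p < s then p else min (ρ (p - s) : ℕ) c.k := by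
  obtain ⟨h1, h2, h3⟩ := steps_of_run h
  have h0 : ρ 0 = s := h.1
  refine ⟨?_, fun p => ?_, ?_, fun b hb => ?_⟩
  · split_ifs with hp
    · rfl
    · simp [h0]; omega
  · by_cases hp : p < s
    · refine Or.inl ?_
      simp only [if_pos hp]
      refine ⟨?_, hp.trans hs, hpre p (hp.trans hs)⟩
      split_ifs with hp'
      · rfl
      · rw [show p + 1 - s = 0 by omega, h0]; omega
    · simp only [if_neg hp, if_neg (show ¬ p + 1 < s by omega),
        show p + 1 - (s : ℕ) = p - s + 1 by omega]
      exact h1 _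
  · obtain ⟨p, hp⟩ := h2
    exact ⟨p + s, by simp [hp]⟩
  · refine frequently_atTop.2 fun N => ?_
    obtain ⟨p, hp, hw⟩ := frequently_atTop.1 (h3 b hb) N
    exact ⟨p + s, by omega, by simp [hw]⟩

variable {φ : Formula n}

/-- Behind the last marker the automaton is deterministic. Before it, a run from any state extends
to a run on a longer word from the initial state, where the markers are unique. -/
theorem Valid.unambiguous (hv : c.Valid φ) : (c.aut n).Unambiguous := by
  have h1 : ∀ s w ρ ρ', (c.aut n).IsAcceptingRunFrom s w ρ →
      (c.aut n).IsAcceptingRunFrom s w ρ' → ρ = ρ' := by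
    intro s w ρ ρ' h h'
    refine run_ext h h' fun p => ?_
    by_cases hs : (s : ℕ) < c.k
    · have hm : ∀ i, ∃ a : Fin n, i < c.k → c.Mark i a := fun i => by
        by_cases hi : i < c.k
        · obtain ⟨r, hr, h⟩ := hv.wf.used i hi
          exact ⟨⟨c.ℓ r, (hv.wf.run r hr).1⟩, fun _ => ⟨r, hr, rfl, h⟩⟩
        · exact ⟨w 0, fun h => absurd h hi⟩
      choose pre hpre using hm
      have := congrFun (hv.cnt_unique (match_prefix hs hpre h) hv
        (match_prefix hs hpre h')) (p + s)
      simpa using this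
    · have hge : ∀ ρ, (c.aut n).IsAcceptingRunFrom s w ρ → ∀ p, c.k ≤ (ρ p : ℕ) := by
        intro ρ h p
        induction p with
        | zero => rw [h.1]; omega
        | succ p ih =>
          have h1 : c.Trans (ρ p) (w p) (ρ (p + 1)) := trans_aut.1 (h.2.1 p)
          simp only [Trans] at h1
          omega
      rw [min_eq_right (hge ρ h p), min_eq_right (hge ρ' h' p)]
  refine ⟨h1, ?_⟩
  rintro w ρ ρ' ⟨s, hs, h⟩ ⟨s', hs', h'⟩
  have hs : (s : ℕ) = 0 := init_aut.1 hs
  have hs' : (s' : ℕ) = 0 := init_aut.1 hs'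
  obtain rfl : s = s' := Fin.ext (by omega)
  exact h1 s w ρ ρ' h h'

/-- Valid certificates of a word have the same automaton. -/
theorem Valid.aut_unique {c' : Cert} {cnt' : ℕ → ℕ} (hv : c.Valid φ) (m : Match c w cnt)
    (hv' : c'.Valid φ) (m' : Match c' w cnt') : c.aut n = c'.aut n := by
  obtain rfl := hv.cnt_unique m hv' m'
  have hk := m.k_unique m'
  have hopn : ∀ i ≤ c.k, ∀ a : Fin n, c.Opn i a ↔ c'.Opn i a := fun i hi a => by
    rw [hv.opn_iff m hi, hv'.opn_iff m' (hk ▸ hi)]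
  have hmark : ∀ i < c.k, ∀ a : Fin n, c.Mark i a ↔ c'.Mark i a := fun i hi a => by
    rw [m.mark_iff hv.wf hi, m'.mark_iff hv'.wf (hk ▸ hi)]
  have htrans : ∀ s (a : Fin n) t, c.Trans s a t ↔ c'.Trans s a t := fun s a t => by
    simp only [Trans, ← hk]
    refine or_congr ?_ (or_congr ?_ ?_)
    · exact and_congr_right fun h => and_congr_right fun _ => hopn s h.le a
    · exact and_congr_right fun h => and_congr_right fun _ => hmark s h a
    · exact and_congr_right fun h => and_congr_right fun _ => hopn _ le_rfl a
  have hacc : ∀ (b : Fin n) s, c.Acc b s ↔ c'.Acc b s := fun b s => by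
    simp only [Acc, ← hk, hopn _ le_rfl b]
  have : ∀ K K' (hK : K = K') (f : Fin (K + 1 + n) → Bool) (f' : Fin (K' + 1 + n) → Bool)
      (g : Fin (K + 1 + n) → Fin n → Fin (K + 1 + n) → Bool)
      (g' : Fin (K' + 1 + n) → Fin n → Fin (K' + 1 + n) → Bool)
      (h : Fin n → Fin (K + 1 + n) → Bool) (h' : Fin n → Fin (K' + 1 + n) → Bool),
      (∀ (s : Fin _) (s' : Fin _), (s : ℕ) = s' → f s = f' s') →
      (∀ (s : Fin _) (s' : Fin _) a (t : Fin _) (t' : Fin _), (s : ℕ) = s' →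
        (t : ℕ) = t' → g s a t = g' s' a t') →
      (∀ b (s : Fin _) (s' : Fin _), (s : ℕ) = s' → h b s = h' b s') →
      (⟨K + 1 + n, n, f, g, h⟩ : GBA n) = ⟨K' + 1 + n, n, f', g', h'⟩ := by
    rintro K K' rfl f f' g g' h h' h1 h2 h3
    congr
    · exact funext fun s => h1 s s rfl
    · exact funext fun s => funext fun a => funext fun t => h2 s s a t t rfl rfl
    · exact funext fun b => funext fun s => h3 b s s rfl
  refine this _ _ hk _ _ _ _ _ _ ?_ ?_ ?_
  · intro s s' h; exact decide_eq_decide.2 (by rw [h])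
  · intro s s' a t t' h1 h2; exact decide_eq_decide.2 (by rw [h1, h2, htrans])
  · intro b s s' h; exact decide_eq_decide.2 (by rw [h, hacc])

theorem Valid.lang_subset (hv : c.Valid φ) : (c.aut n).lang ⊆ φ.lang := by
  intro w hw
  obtain ⟨cnt, m⟩ := mem_lang_aut.1 hw
  obtain ⟨run, hrun⟩ := m.exists_run hv.wf
  refine (agree_of_const m hv.wf hrun hv.const).1.2 ?_
  obtain ⟨r, hr, h1, h2⟩ := hv.root
  have h3 : On c w cnt 0 r := by
    obtain ⟨p, hp, hp1, hp2⟩ := m.exists_first hv.wf hr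
    have : p = 0 := by
      by_contra hne
      have h0 := m.zero
      have h3 := m.mono (Nat.one_le_iff_ne_zero.2 hne)
      rw [hp1, h1] at h3
      have h4 := m.step 0
      rw [zero_add, h0] at h4
      rcases h4 with h | ⟨-, s, -, -, h, -⟩ <;> omega
    exact this ▸ hp
  rw [On.unique hv.wf (hrun 0) h3]
  exact h2

end Cert

/-! ### The certificate of a word -/

section

variable {n : ℕ} {w : ℕ → Fin n} {φ : Formula n} {p q : ℕ}

theorem Formula.SameType.symm (h : Formula.SameType w φ p q) : Formula.SameType w φ q p :=
  fun e he => ⟨(h e he).1.symm, (h e he).2.symm⟩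

theorem Formula.SameType.trans {r : ℕ} (h : Formula.SameType w φ p q)
    (h' : Formula.SameType w φ q r) : Formula.SameType w φ p r :=
  fun e he => ⟨(h e he).1.trans (h' e he).1, (h e he).2.trans (h' e he).2⟩

theorem isStart_of_prev (hpq : p < q) (hw : w p = w q) (hb : ∀ z, p < z → z < q → w z ≠ w q)
    (h : ¬ Formula.SameType w φ p q) : IsStart w φ q := by
  intro p' hp' hw' hb'
  rcases lt_trichotomy p p' with hlt | rfl | hlt
  · exact absurd hw' (hb p' hlt hp')
  · exact h
  · exact absurd hw (hb' p hlt hpq)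

theorem isEnd_of_next (hpq : p < q) (hw : w p = w q) (hb : ∀ z, p < z → z < q → w z ≠ w q)
    (h : ¬ Formula.SameType w φ p q) : IsEnd w φ p := by
  intro q' hq' hw' hb'
  rcases lt_trichotomy q q' with hlt | rfl | hlt
  · exact absurd hw.symm (hb' q hpq hlt)
  · exact h
  · exact absurd (hw'.trans hw) (hb q' hq' hlt)

theorem exists_isEnd (hpq : p < q) (hw : w p = w q) (h : IsStart w φ q) :
    ∃ e, p ≤ e ∧ e < q ∧ w e = w q ∧ IsEnd w φ e := by
  obtain ⟨e, h1, h2, h3, h4⟩ := exists_prev hpq hw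
  exact ⟨e, h1, h2, h3, isEnd_of_next h2 h3 h4 (h e h2 h3 h4)⟩

theorem exists_isStart (hpq : p < q) (hw : w p = w q) (h : IsEnd w φ p) :
    ∃ z, p < z ∧ z ≤ q ∧ w z = w p ∧ IsStart w φ z ∧ ¬ Formula.SameType w φ p z := by
  obtain ⟨z, h1, h2, h3, h4⟩ := exists_next hpq hw.symm
  exact ⟨z, h2, h1, h3, isStart_of_prev h2 h3.symm (by rwa [h3]) (h z h2 h3 h4), h z h2 h3 h4⟩

/-- The first position of the run to which `p` belongs. -/
theorem exists_first (w : ℕ → Fin n) (φ : Formula n) (p : ℕ) :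
    ∃ z ≤ p, w z = w p ∧ IsStart w φ z ∧ ∀ y, z < y → y ≤ p → w y = w p → ¬ IsStart w φ y := by
  induction p using Nat.strong_induction_on with
  | _ p ih =>
    by_cases h : IsStart w φ p
    · exact ⟨p, le_rfl, rfl, h, fun y h1 h2 => by omega⟩
    · obtain ⟨q, hq, hw, hb⟩ : ∃ q < p, w q = w p ∧ ∀ z, q < z → z < p → w z ≠ w p := by
        by_contra! hcon
        refine h fun q hq hw hb => ?_
        obtain ⟨z, h1, h2, h3⟩ := hcon q hq hw
        exact absurd h3 (hb z h1 h2)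
      obtain ⟨z, h1, h2, h3, h4⟩ := ih q hq
      refine ⟨z, by omega, h2.trans hw, h3, fun y hy1 hy2 hy3 => ?_⟩
      rcases lt_or_ge q y with hlt | hle
      · rcases hy2.lt_or_eq with h5 | rfl
        · exact absurd hy3 (hb y hlt h5)
        · exact h
      · exact h4 y hy1 hle (hy3.trans hw.symm)

theorem sameType_of_no_start (hpq : p ≤ q) (hw : w p = w q)
    (h : ∀ y, p < y → y ≤ q → w y = w q → ¬ IsStart w φ y) : Formula.SameType w φ p q := by
  induction q using Nat.strong_induction_on with
  | _ q ih =>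
    rcases hpq.lt_or_eq with hlt | rfl
    · obtain ⟨z, h1, h2, h3, h4⟩ := exists_prev hlt hw
      refine (ih z h2 h1 (hw.trans h3.symm) fun y hy1 hy2 hy3 =>
        h y hy1 (by omega) (hy3.trans h3)).trans ?_
      by_contra hs
      exact h q hlt le_rfl rfl (isStart_of_prev h2 h3 h4 hs)
    · exact fun e he => ⟨Iff.rfl, Iff.rfl⟩

/-- Positions of which any two with the same letter are separated by a cut are few. -/
theorem finite_of_separated {T : Set ℕ} {C : ℕ} (B : Fin n → Finset ℕ) (hB : ∀ a, (B a).card ≤ C)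
    (hT : ∀ p ∈ T, ∀ q ∈ T, p < q → w p = w q → ∃ b ∈ B (w q), p < b ∧ b ≤ q) :
    T.Finite ∧ T.ncard ≤ n * (C + 1) := by
  let f : ℕ → Fin n × ℕ := fun p => (w p, ((B (w p)).filter (· ≤ p)).card)
  let U : Finset (Fin n × ℕ) := Finset.univ ×ˢ Finset.range (C + 1)
  have hmaps : Set.MapsTo f T U := fun p _ => by
    simp only [U, f, Finset.coe_product, Finset.coe_univ, Finset.coe_range, Set.mem_prod,
      Set.mem_univ, true_and, Set.mem_Iio]
    exact Nat.lt_succ_of_le ((Finset.card_filter_le _ _).trans (hB _))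
  have hlt : ∀ p ∈ T, ∀ q ∈ T, p < q → f p ≠ f q := by
    intro p hp q hq hpq hf
    simp only [f, Prod.mk.injEq] at hf
    obtain ⟨hw, hc⟩ := hf
    obtain ⟨b, hb, h1, h2⟩ := hT p hp q hq hpq hw
    rw [hw] at hc
    refine hc.not_lt (Finset.card_lt_card ⟨fun x hx => ?_, fun hsub => ?_⟩)
    · rw [Finset.mem_filter] at hx ⊢
      exact ⟨hx.1, hx.2.trans hpq.le⟩
    · have := hsub (Finset.mem_filter.2 ⟨hb, h2⟩)
      rw [Finset.mem_filter] at this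
      omega
  have hinj : Set.InjOn f T := fun p hp q hq hf => by
    rcases lt_trichotomy p q with h | h | h
    · exact absurd hf (hlt p hp q hq h)
    · exact h
    · exact absurd hf.symm (hlt q hq p hp h)
  refine ⟨Set.Finite.of_injOn hmaps hinj U.finite_toSet, ?_⟩
  refine (Set.ncard_le_ncard_of_injOn f hmaps hinj U.finite_toSet).trans ?_
  rw [Set.ncard_coe_finset]
  simp [U]

/-- A letter starts at most one more run than the number of cuts of its type. -/
theorem finite_isStart (w : ℕ → Fin n) (φ : Formula n) :
    {p | IsStart w φ p}.Finite ∧ {p | IsStart w φ p}.ncard ≤ n * (4 * φ.size ^ 4 + 1) := by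
  choose B hB h using fun a => Formula.hasCuts_sameType w a φ
  refine finite_of_separated (w := w) B hB fun p _ q hq hpq hw => ?_
  obtain ⟨z, h1, h2, h3, h4⟩ := exists_prev hpq hw
  by_contra! hcon
  refine hq z h2 h3 h4 (h (w q) z q h2 h3 rfl fun b hb hz => hcon b hb (by omega))

/-- A letter ends at most one more run than the number of cuts of its type. -/
theorem finite_isEnd (w : ℕ → Fin n) (φ : Formula n) :
    {p | IsEnd w φ p}.Finite ∧ {p | IsEnd w φ p}.ncard ≤ n * (4 * φ.size ^ 4 + 1) := by
  choose B hB h using fun a => Formula.hasCuts_sameType w a φ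
  refine finite_of_separated (w := w) B hB fun p hp q _ hpq hw => ?_
  obtain ⟨z, h1, h2, h3, h4⟩ := exists_next hpq hw.symm
  by_contra! hcon
  refine hp z h2 h3 h4 (h (w q) p z h2 hw (h3.trans hw) fun b hb hz => ?_)
  by_contra hzb
  exact absurd (hcon b hb hz) (by omega)

/-- The positions that start or end a run. -/
def IsMarker (w : ℕ → Fin n) (φ : Formula n) (p : ℕ) : Prop := IsStart w φ p ∨ IsEnd w φ p

noncomputable instance (w : ℕ → Fin n) (φ : Formula n) : DecidablePred (IsMarker w φ) :=
  Classical.decPred _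

theorem finite_isMarker (w : ℕ → Fin n) (φ : Formula n) : {p | IsMarker w φ p}.Finite :=
  (finite_isStart w φ).1.union (finite_isEnd w φ).1

open Classical in
/-- The certificate of a word: the runs are numbered in the order of their first positions. The
values that belong to no run are set to `0`. -/
noncomputable def certOf (w : ℕ → Fin n) (φ : Formula n) : Cert where
  R := (finite_isStart w φ).1.toFinset.card
  k := (finite_isMarker w φ).toFinset.card
  ℓ r := if r < (finite_isStart w φ).1.toFinset.card then w (Nat.nth (IsStart w φ) r) else 0
  st r := if r < (finite_isStart w φ).1.toFinset.card then
    Nat.count (IsMarker w φ) (Nat.nth (IsStart w φ) r) else 0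
  en r := if r < (finite_isStart w φ).1.toFinset.card then
    if h : ∃ e, Nat.nth (IsStart w φ) r ≤ e ∧ w e = w (Nat.nth (IsStart w φ) r) ∧ IsEnd w φ e
    then Nat.count (IsMarker w φ) (Nat.find h) else (finite_isMarker w φ).toFinset.card else 0

namespace certOf

theorem R_le : (certOf w φ).R ≤ n * (4 * φ.size ^ 4 + 1) := by
  exact (Set.ncard_eq_toFinset_card _ _).symm.trans_le (finite_isStart w φ).2

theorem k_le : (certOf w φ).k ≤ 2 * (n * (4 * φ.size ^ 4 + 1)) := by
  refine (Set.ncard_eq_toFinset_card _ _).symm.trans_le ?_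
  rw [two_mul]
  exact (Set.ncard_union_le _ _).trans (Nat.add_le_add (finite_isStart w φ).2 (finite_isEnd w φ).2)

/-- The number of markers before a position. -/
noncomputable def cnt (w : ℕ → Fin n) (φ : Formula n) (p : ℕ) : ℕ := Nat.count (IsMarker w φ) p

theorem cnt_mono (h : p ≤ q) : cnt w φ p ≤ cnt w φ q := Nat.count_monotone _ h

theorem lt_of_cnt_lt (h : cnt w φ p < cnt w φ q) : p < q :=
  not_le.1 fun h' => absurd (cnt_mono (w := w) (φ := φ) h') (by omega)

theorem cnt_lt (hp : IsMarker w φ p) (h : p < q) : cnt w φ p < cnt w φ q :=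
  Nat.count_strict_mono hp h

theorem cnt_le : cnt w φ p ≤ (certOf w φ).k := Nat.count_le_card (finite_isMarker w φ) p

theorem cnt_lt_k (hp : IsMarker w φ p) : cnt w φ p < (certOf w φ).k :=
  Nat.count_lt_card (finite_isMarker w φ) hp

theorem cnt_inj (hp : IsMarker w φ p) (hq : IsMarker w φ q) (h : cnt w φ p = cnt w φ q) :
    p = q := by
  rcases lt_trichotomy p q with h' | h' | h'
  · have := cnt_lt hp h'; omega
  · exact h'
  · have := cnt_lt hq h'; omega

theorem exists_marker {i : ℕ} (hi : i < (certOf w φ).k) : ∃ p, IsMarker w φ p ∧ cnt w φ p = i := by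
  classical
  exact ⟨Nat.nth (IsMarker w φ) i, Nat.nth_mem_of_lt_card (finite_isMarker w φ) hi,
    Nat.count_nth_of_lt_card_finite (finite_isMarker w φ) hi⟩

/-- The first position of a run. -/
noncomputable def first (w : ℕ → Fin n) (φ : Formula n) (r : ℕ) : ℕ := Nat.nth (IsStart w φ) r

theorem isStart_first {r : ℕ} (hr : r < (certOf w φ).R) : IsStart w φ (first w φ r) :=
  Nat.nth_mem_of_lt_card (finite_isStart w φ).1 hr

theorem first_inj {r r' : ℕ} (hr : r < (certOf w φ).R) (hr' : r' < (certOf w φ).R)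
    (h : first w φ r = first w φ r') : r = r' :=
  Nat.nth_injOn (finite_isStart w φ).1 hr hr' h

theorem exists_run_of_isStart (h : IsStart w φ p) : ∃ r < (certOf w φ).R, first w φ r = p :=
  Nat.exists_lt_card_finite_nth_eq (finite_isStart w φ).1 h

theorem letter_eq {r : ℕ} (hr : r < (certOf w φ).R) : (certOf w φ).ℓ r = w (first w φ r) :=
  if_pos hr

theorem st_eq {r : ℕ} (hr : r < (certOf w φ).R) : (certOf w φ).st r = cnt w φ (first w φ r) :=
  if_pos hr

theorem eq_zero {r : ℕ} (hr : (certOf w φ).R ≤ r) :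
    (certOf w φ).ℓ r = 0 ∧ (certOf w φ).st r = 0 ∧ (certOf w φ).en r = 0 :=
  ⟨if_neg hr.not_gt, if_neg hr.not_gt, if_neg hr.not_gt⟩

/-- A run has a last position, or it is infinite. -/
theorem en_cases {r : ℕ} (hr : r < (certOf w φ).R) :
    (∃ e, (certOf w φ).en r = cnt w φ e ∧ first w φ r ≤ e ∧ w e = w (first w φ r) ∧ IsEnd w φ e ∧
      ∀ e', first w φ r ≤ e' → w e' = w (first w φ r) → IsEnd w φ e' → e ≤ e') ∨
    ((certOf w φ).en r = (certOf w φ).k ∧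
      ∀ e', first w φ r ≤ e' → w e' = w (first w φ r) → ¬ IsEnd w φ e') := by
  classical
  by_cases h : ∃ e, first w φ r ≤ e ∧ w e = w (first w φ r) ∧ IsEnd w φ e
  · refine Or.inl ⟨Nat.find h, ?_, (Nat.find_spec h).1, (Nat.find_spec h).2.1,
      (Nat.find_spec h).2.2, fun e' h1 h2 h3 => Nat.find_min' h ⟨h1, h2, h3⟩⟩
    exact (if_pos hr).trans ((dif_pos h).trans (by simp only [cnt, first]))
  · exact Or.inr ⟨(if_pos hr).trans (dif_neg h), fun e' h1 h2 h3 => h ⟨e', h1, h2, h3⟩⟩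

/-- The position `p` is in the run that starts at `first w φ r`. -/
def In (w : ℕ → Fin n) (φ : Formula n) (r p : ℕ) : Prop :=
  r < (certOf w φ).R ∧ first w φ r ≤ p ∧ w p = w (first w φ r) ∧
    ∀ y, first w φ r < y → y ≤ p → w y = w (first w φ r) → ¬ IsStart w φ y

theorem exists_in (w : ℕ → Fin n) (φ : Formula n) (p : ℕ) : ∃ r, In w φ r p := by
  obtain ⟨z, h1, h2, h3, h4⟩ := exists_first w φ p
  obtain ⟨r, hr, rfl⟩ := exists_run_of_isStart h3
  exact ⟨r, hr, h1, h2.symm, fun y a b c => h4 y a b (c.trans h2)⟩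

theorem le_en {r : ℕ} (h : In w φ r p) : cnt w φ p ≤ (certOf w φ).en r := by
  rcases en_cases h.1 with ⟨e, h1, h2, h3, h4, h5⟩ | ⟨h1, -⟩
  · rw [h1]
    by_contra hlt
    obtain ⟨z, hz1, hz2, hz3, hz4, -⟩ := exists_isStart (lt_of_cnt_lt (not_le.1 hlt))
      (h3.trans h.2.2.1.symm) h4
    exact h.2.2.2 z (by omega) hz2 (hz3.trans h3) hz4
  · rw [h1]; exact cnt_le

theorem in_of_cnt {r : ℕ} (hr : r < (certOf w φ).R) (hw : w p = w (first w φ r))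
    (h1 : (certOf w φ).st r ≤ cnt w φ p) (h2 : cnt w φ p ≤ (certOf w φ).en r) : In w φ r p := by
  refine ⟨hr, ?_, hw, fun y hy1 hy2 hy3 hy => ?_⟩
  · by_contra hlt
    obtain ⟨e, he1, he2, -, he4⟩ := exists_isEnd (not_le.1 hlt) hw (isStart_first hr)
    have := cnt_lt (Or.inr he4) he2
    have := cnt_mono (w := w) (φ := φ) he1
    rw [st_eq hr] at h1
    omega
  · obtain ⟨e', he1, he2, he3, he4⟩ := exists_isEnd hy1 hy3.symm hy
    rcases en_cases hr with ⟨e, h3, h4, h5, h6, h7⟩ | ⟨-, h3⟩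
    · have := h7 e' he1 (he3.trans hy3) he4
      have := cnt_lt (Or.inr h6) (this.trans_lt (he2.trans_le hy2))
      omega
    · exact h3 e' he1 (he3.trans hy3) he4

theorem first_in {r : ℕ} (hr : r < (certOf w φ).R) : In w φ r (first w φ r) :=
  ⟨hr, le_rfl, rfl, fun y h1 h2 => by omega⟩

/-- The last position of a run is its marker `en`. -/
theorem en_of_isEnd {r : ℕ} (h : In w φ r p) (hp : IsEnd w φ p) :
    (certOf w φ).en r = cnt w φ p := by
  rcases en_cases h.1 with ⟨e, h1, h2, h3, h4, h5⟩ | ⟨-, h1⟩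
  · rcases (h5 p h.2.1 h.2.2.1 hp).lt_or_eq with hlt | rfl
    · obtain ⟨z, hz1, hz2, hz3, hz4, -⟩ := exists_isStart hlt (h3.trans h.2.2.1.symm) h4
      exact absurd hz4 (h.2.2.2 z (by omega) hz2 (hz3.trans h3))
    · exact h1
  · exact absurd hp (h1 p h.2.1 h.2.2.1)

theorem mark (hp : IsMarker w φ p) : ∃ r < (certOf w φ).R, (certOf w φ).ℓ r = w p ∧
    ((certOf w φ).st r = cnt w φ p ∨ (certOf w φ).en r = cnt w φ p) := by
  rcases hp with hp | hp
  · obtain ⟨r, hr, rfl⟩ := exists_run_of_isStart hp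
    exact ⟨r, hr, letter_eq hr, Or.inl (st_eq hr)⟩
  · obtain ⟨r, h⟩ := exists_in w φ p
    exact ⟨r, h.1, by rw [letter_eq h.1, h.2.2.1], Or.inr (en_of_isEnd h hp)⟩

theorem disj_of_lt {r r' : ℕ} (hr : r < (certOf w φ).R) (hr' : r' < (certOf w φ).R)
    (hw : w (first w φ r) = w (first w φ r')) (hlt : first w φ r < first w φ r') :
    (certOf w φ).en r < (certOf w φ).st r' := by
  obtain ⟨e', he1, he2, he3, he4⟩ := exists_isEnd hlt hw (isStart_first hr')
  rcases en_cases hr with ⟨e, h3, h4, h5, h6, h7⟩ | ⟨-, h3⟩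
  · rw [h3, st_eq hr']
    exact cnt_lt (Or.inr h6) ((h7 e' he1 (he3.trans hw.symm) he4).trans_lt he2)
  · exact absurd he4 (h3 e' he1 (he3.trans hw.symm))

theorem wf : (certOf w φ).Wf n where
  run r hr := by
    rw [letter_eq hr, st_eq hr]
    refine ⟨(w _).2, le_en (first_in hr), cnt_lt_k (Or.inl (isStart_first hr)), ?_⟩
    rcases en_cases hr with ⟨e, h1, -⟩ | ⟨h1, -⟩
    · rw [h1]; exact cnt_le
    · exact h1.le
  disj r hr r' hr' hne hl := by
    rw [letter_eq hr, letter_eq hr'] at hl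
    have hw : w (first w φ r) = w (first w φ r') := Fin.ext hl
    rcases lt_trichotomy (first w φ r) (first w φ r') with h | h | h
    · exact Or.inl (disj_of_lt hr hr' hw h)
    · exact absurd (first_inj hr hr' h) hne
    · exact Or.inr (disj_of_lt hr' hr hw.symm h)
  used i hi := by
    obtain ⟨p, hp, rfl⟩ := exists_marker hi
    obtain ⟨r, hr, -, h⟩ := mark hp
    exact ⟨r, hr, h⟩
  letter r hr r' hr' i hi h h' := by
    have key : ∀ r < (certOf w φ).R, ((certOf w φ).st r = i ∨ (certOf w φ).en r = i) →
        ∃ p, IsMarker w φ p ∧ cnt w φ p = i ∧ w p = w (first w φ r) := by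
      rintro r hr (h | h)
      · exact ⟨_, Or.inl (isStart_first hr), (st_eq hr).symm.trans h, rfl⟩
      · rcases en_cases hr with ⟨e, h3, h4, h5, h6, -⟩ | ⟨h3, -⟩
        · exact ⟨e, Or.inr h6, h3.symm.trans h, h5⟩
        · omega
    obtain ⟨p, h1, h2, h3⟩ := key r hr h
    obtain ⟨q, h4, h5, h6⟩ := key r' hr' h'
    obtain rfl := cnt_inj h1 h4 (h2.trans h5.symm)
    rw [letter_eq hr, letter_eq hr', ← h3, ← h6]

theorem match_cnt : (certOf w φ).Match w (cnt w φ) where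
  zero := Nat.count_zero _
  step p := by
    classical
    by_cases hp : IsMarker w φ p
    · exact Or.inl ⟨by simp [cnt, Nat.count_succ, hp], cnt_lt_k hp, mark hp⟩
    · obtain ⟨r, h⟩ := exists_in w φ p
      have hr := h.1
      refine Or.inr ⟨by simp [cnt, Nat.count_succ, hp], r, hr, by rw [letter_eq hr, h.2.2.1], ?_,
        le_en h⟩
      rw [st_eq hr]
      have hs : IsMarker w φ (first w φ r) := Or.inl (isStart_first hr)
      refine cnt_lt hs (lt_of_le_of_ne h.2.1 ?_)
      rintro rfl
      exact hp hs
  last := by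
    by_cases hk : (certOf w φ).k = 0
    · exact ⟨0, by rw [hk]; exact Nat.count_zero _⟩
    · obtain ⟨p, hp, hi⟩ := exists_marker (w := w) (φ := φ) (Nat.sub_one_lt hk)
      have := cnt_lt hp (Nat.lt_succ_self p)
      exact ⟨p + 1, le_antisymm cnt_le (by simp only [Nat.succ_eq_add_one] at this; omega)⟩
  often b := by
    rintro ⟨r, hr, hl, h1, h2⟩
    have hb : w (first w φ r) = b := Fin.ext ((letter_eq hr).symm.trans hl)
    rcases en_cases hr with ⟨e, h3, h4, h5, h6, -⟩ | ⟨-, h3⟩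
    · have := cnt_lt_k (Or.inr h6 : IsMarker w φ e)
      omega
    · have : ∀ N, ∃ p, N ≤ p ∧ first w φ r ≤ p ∧ w p = b := by
        intro N
        induction N with
        | zero => exact ⟨_, Nat.zero_le _, le_rfl, hb⟩
        | succ N ih =>
          obtain ⟨p, hp1, hp2, hp3⟩ := ih
          obtain ⟨q, hq, hw⟩ : ∃ q, p < q ∧ w q = w p := by
            by_contra! hcon
            exact h3 p hp2 (hp3.trans hb.symm) fun q hq hw => absurd hw (hcon q hq)
          exact ⟨q, by omega, by omega, hw.trans hp3⟩
      refine frequently_atTop.2 fun N => ?_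
      obtain ⟨p, h4, -, h5⟩ := this N
      exact ⟨p, h4, h5⟩

theorem on_of_in {r : ℕ} (h : In w φ r p) : (certOf w φ).On w (cnt w φ) p r :=
  ⟨h.1, by rw [letter_eq h.1, h.2.2.1], by rw [st_eq h.1]; exact cnt_mono h.2.1, le_en h⟩

theorem sameType_of_on {r : ℕ} (hp : (certOf w φ).On w (cnt w φ) p r)
    (hq : (certOf w φ).On w (cnt w φ) q r) : Formula.SameType w φ p q := by
  have key : ∀ p q, (certOf w φ).On w (cnt w φ) p r → (certOf w φ).On w (cnt w φ) q r → p ≤ q →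
      Formula.SameType w φ p q := by
    intro p q hp hq hpq
    have h1 := in_of_cnt hp.lt (Fin.ext (hp.letter.symm.trans (letter_eq hp.lt))) hp.st_le hp.le_en
    have h2 := in_of_cnt hq.lt (Fin.ext (hq.letter.symm.trans (letter_eq hq.lt))) hq.st_le hq.le_en
    exact sameType_of_no_start hpq (h1.2.2.1.trans h2.2.2.1.symm) fun y hy1 hy2 hy3 =>
      h2.2.2.2 y (h1.2.1.trans_lt hy1) hy2 (hy3.trans h2.2.2.1)
  rcases le_total p q with h | h
  · exact key p q hp hq h
  · exact (key q p hq hp h).symm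

theorem valid (hw : w ∈ φ.lang) : (certOf w φ).Valid φ := by
  have m := match_cnt (w := w) (φ := φ)
  obtain ⟨run, hrun⟩ := m.exists_run wf
  have H : ∀ p q, run p = run q → Formula.SameType w φ p q := fun p q h =>
    sameType_of_on (hrun p) (h ▸ hrun q)
  obtain ⟨h0, hag⟩ := Cert.agree_of_sameType m wf hrun H
  refine ⟨wf, fun e he r hr => Cert.const_of_sameType m wf hrun H he hr, ?_, ?_⟩
  · intro r hr r' hr' hl hlt hb
    have hl' : w (first w φ r) = w (first w φ r') := by
      rw [letter_eq hr, letter_eq hr'] at hl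
      exact Fin.ext hl
    rcases en_cases hr with ⟨e, h3, h4, h5, h6, -⟩ | ⟨h3, -⟩
    · obtain ⟨z, hz1, hz2, hz3, hz4, hz5⟩ := exists_isStart
        (lt_of_cnt_lt (w := w) (φ := φ) (p := e) (q := first w φ r') (h3 ▸ st_eq hr' ▸ hlt))
        (h5.trans hl') h6
      obtain ⟨t, ht, rfl⟩ := exists_run_of_isStart hz4
      have h7 : (certOf w φ).ℓ t = (certOf w φ).ℓ r := by
        rw [letter_eq ht, letter_eq hr, hz3, h5]
      have h8 := hb t ht h7 (by rw [h3, st_eq ht]; exact cnt_lt (Or.inr h6) hz1)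
      obtain rfl : t = r' := by
        by_contra hne
        rcases wf.disj t ht r' hr' hne (h7.trans hl) with h9 | h9
        · exact h8 h9
        · have := cnt_mono (w := w) (φ := φ) hz2
          have h10 := (wf.run r' hr').2.1
          rw [st_eq hr'] at h10
          rw [st_eq ht] at h9
          omega
      by_contra! hcon
      refine hz5 fun d hd => ?_
      have h9 := (hag d hd).2 e
      have h10 := (hag d hd).2 (first w φ t)
      have h11 : run e = r := Cert.On.unique wf (hrun e) ⟨hr, by rw [letter_eq hr, h5],
        by rw [st_eq hr]; exact cnt_mono h4, h3.ge⟩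
      have h12 : run (first w φ t) = t := Cert.On.unique wf (hrun _) (on_of_in (first_in ht))
      rw [h11] at h9
      rw [h12] at h10
      rw [← h9.1, ← h9.2, ← h10.1, ← h10.2]
      exact hcon d hd
    · have := (wf.run r' hr').2.2.1
      omega
  · refine ⟨run 0, (hrun 0).lt, ?_, h0.1 hw⟩
    have := (hrun 0).st_le
    rw [m.zero] at this
    omega

end certOf

end

/-! ### The description of the automaton, position by position -/

theorem getElem?_of_drop {x l rest : List Sym} {p : ℕ} (h : x.drop p = l ++ rest) {i : ℕ}
    (hi : i < l.length) : x[p + i]? = l[i]? := by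
  rw [← List.getElem?_drop, h, List.getElem?_append_left hi]

theorem drop_of_drop {x l rest : List Sym} {p : ℕ} (h : x.drop p = l ++ rest) :
    x.drop (p + l.length) = rest := by
  rw [← List.drop_drop, h, List.drop_left]

theorem drop_eq_append_iff {x l rest : List Sym} {p : ℕ} :
    x.drop p = l ++ rest ↔
      (∀ i < l.length, x[p + i]? = l[i]?) ∧ x.drop (p + l.length) = rest := by
  refine ⟨fun h => ⟨fun i hi => getElem?_of_drop h hi, drop_of_drop h⟩, ?_⟩
  rintro ⟨h1, rfl⟩
  have h2 : (x.drop p).take l.length = l := by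
    refine List.ext_getElem? fun i => ?_
    by_cases hi : i < l.length
    · rw [List.getElem?_take_of_lt hi, List.getElem?_drop, h1 i hi]
    · rw [List.getElem?_eq_none_iff.2 (by rw [List.length_take]; omega),
        List.getElem?_eq_none_iff.2 (by omega)]
  rw [← List.drop_drop]
  conv_lhs => rw [← List.take_append_drop l.length (x.drop p), h2]

theorem length_flatMap_const {m L : ℕ} {g : Fin m → List Sym} (hg : ∀ i, (g i).length = L) :
    ((List.finRange m).flatMap g).length = m * L := by
  rw [List.length_flatMap, List.map_congr_left fun i _ => hg i]
  simp

theorem getElem?_flatMap_finRange {m L : ℕ} (g : Fin m → List Sym) (hg : ∀ i, (g i).length = L)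
    (i : Fin m) {j : ℕ} (hj : j < L) : ((List.finRange m).flatMap g)[i * L + j]? = (g i)[j]? := by
  induction m with
  | zero => exact i.elim0
  | succ m ih =>
    rw [List.finRange_succ, List.flatMap_cons]
    cases i using Fin.cases with
    | zero => rw [Fin.val_zero, zero_mul, zero_add, List.getElem?_append_left (by rwa [hg])]
    | succ i =>
      have hi : ((i.succ : Fin (m + 1)) : ℕ) * L + j = L + ((i : ℕ) * L + j) := by
        rw [Fin.val_succ]; ring
      rw [hi, List.getElem?_append_right (by rw [hg]; omega), hg, Nat.add_sub_cancel_left,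
        List.flatMap_map, ih (fun i => g i.succ) (fun i => hg _) i]

/-- The symbol at the position `i` is the bit for `P`. -/
def IsBit (o : List Sym) (i : ℕ) (P : Prop) : Prop :=
  (P ∧ o[i]? = some Sym.one) ∨ (¬ P ∧ o[i]? = some Sym.zero)

theorem isBit_iff {o : List Sym} {i : ℕ} {P : Prop} {b : Bool} (h : b = true ↔ P) :
    IsBit o i P ↔ o[i]? = some (bitCode b) := by
  unfold IsBit
  cases b <;> simp [← h, bitCode]

/-- The word `o` is the description of the automaton of the certificate. -/
def Cert.IsCode (c : Cert) (n : ℕ) (o : List Sym) : Prop :=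
  (∀ i < c.k + 1 + n, o[i]? = some Sym.one) ∧ o[c.k + 1 + n]? = some Sym.sep ∧
  (∀ i < n, o[c.k + 1 + n + 1 + i]? = some Sym.one) ∧ o[c.k + 1 + n + 1 + n]? = some Sym.sep ∧
  (∀ s < c.k + 1 + n, IsBit o (c.k + 1 + n + 1 + n + 1 + s) (s = 0)) ∧
  (∀ s < c.k + 1 + n, ∀ a < n, ∀ t < c.k + 1 + n,
    IsBit o (c.k + 1 + n + 1 + n + 1 + (c.k + 1 + n) +
      (s * (n * (c.k + 1 + n)) + (a * (c.k + 1 + n) + t))) (c.Trans s a t)) ∧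
  (∀ j < n, ∀ s < c.k + 1 + n,
    IsBit o (c.k + 1 + n + 1 + n + 1 + (c.k + 1 + n) + (c.k + 1 + n) * (n * (c.k + 1 + n)) +
      (j * (c.k + 1 + n) + s)) (c.Acc j s)) ∧
  o.length = c.k + 1 + n + 1 + n + 1 + (c.k + 1 + n) + (c.k + 1 + n) * (n * (c.k + 1 + n)) +
      n * (c.k + 1 + n)

theorem drop_eq_replicate_iff {x rest : List Sym} {p m : ℕ} :
    x.drop p = List.replicate m Sym.one ++ Sym.sep :: rest ↔
      (∀ i < m, x[p + i]? = some Sym.one) ∧ x[p + m]? = some Sym.sep ∧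
        x.drop (p + m + 1) = rest := by
  rw [drop_eq_append_iff, List.length_replicate,
    show Sym.sep :: rest = [Sym.sep] ++ rest from rfl, drop_eq_append_iff]
  refine and_congr ?_ (and_congr ?_ Iff.rfl)
  · refine forall₂_congr fun i hi => ?_
    rw [List.getElem?_replicate_of_lt hi]
  · simp

theorem drop_eq_iff {x l : List Sym} {p : ℕ} (hp : p ≤ x.length) :
    x.drop p = l ↔ (∀ i < l.length, x[p + i]? = l[i]?) ∧ x.length = p + l.length := by
  rw [← List.append_nil l, drop_eq_append_iff, List.append_nil, List.drop_eq_nil_iff]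
  refine and_congr_right fun h => ⟨fun h' => ?_, fun h' => h'.le⟩
  refine le_antisymm h' ?_
  by_contra hlt
  have := h (x.length - p) (by omega)
  rw [List.getElem?_eq_none (by omega), List.getElem?_eq_getElem (by omega)] at this
  simp at this

/-- The description of an automaton, read position by position. -/
theorem eq_code_iff {S n : ℕ} (f : Fin S → Bool) (g : Fin S → Fin n → Fin S → Bool)
    (h : Fin n → Fin S → Bool) (o : List Sym) : o = (⟨S, n, f, g, h⟩ : GBA n).code ↔
      (∀ i < S, o[i]? = some Sym.one) ∧ o[S]? = some Sym.sep ∧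
      (∀ i < n, o[S + 1 + i]? = some Sym.one) ∧ o[S + 1 + n]? = some Sym.sep ∧
      (∀ s : Fin S, o[S + 1 + n + 1 + s]? = some (bitCode (f s))) ∧
      (∀ (s : Fin S) (a : Fin n) (t : Fin S),
        o[S + 1 + n + 1 + S + (s * (n * S) + (a * S + t))]? = some (bitCode (g s a t))) ∧
      (∀ (j : Fin n) (s : Fin S),
        o[S + 1 + n + 1 + S + S * (n * S) + (j * S + s)]? = some (bitCode (h j s))) ∧
      o.length = S + 1 + n + 1 + S + S * (n * S) + n * S := by
  have hA : ((List.finRange S).map fun s => bitCode (f s)).length = S := by simp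
  have hg : ∀ (s : Fin S) (a : Fin n),
      ((List.finRange S).map fun t => bitCode (g s a t)).length = S := by simp
  have hg' : ∀ s : Fin S, ((List.finRange n).flatMap fun a =>
      (List.finRange S).map fun t => bitCode (g s a t)).length = n * S :=
    fun s => length_flatMap_const (hg s)
  have hh : ∀ j : Fin n, ((List.finRange S).map fun s => bitCode (h j s)).length = S := by simp
  have hB := length_flatMap_const hg'
  have hC := length_flatMap_const hh
  have e1 : (∀ i < S, o[S + 1 + n + 1 + i]? = ((List.finRange S).map fun s => bitCode (f s))[i]?) ↔
      ∀ s : Fin S, o[S + 1 + n + 1 + s]? = some (bitCode (f s)) := by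
    rw [Fin.forall_iff]
    refine forall₂_congr fun i hi => ?_
    simp [hi]
  have e2 : (∀ i < S * (n * S), o[S + 1 + n + 1 + S + i]? =
        ((List.finRange S).flatMap fun s => (List.finRange n).flatMap fun a =>
          (List.finRange S).map fun t => bitCode (g s a t))[i]?) ↔
      ∀ (s : Fin S) (a : Fin n) (t : Fin S),
        o[S + 1 + n + 1 + S + (s * (n * S) + (a * S + t))]? = some (bitCode (g s a t)) := by
    have hlt : ∀ (s : Fin S) (a : Fin n) (t : Fin S), (a : ℕ) * S + t < n * S ∧
        (s : ℕ) * (n * S) + (a * S + t) < S * (n * S) := fun s a t => by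
      have h1 : (a : ℕ) * S + t < n * S := by
        have := Nat.mul_le_mul_right S (Nat.succ_le_of_lt a.2)
        rw [Nat.succ_mul] at this
        have := t.2
        omega
      have := Nat.mul_le_mul_right (n * S) (Nat.succ_le_of_lt s.2)
      rw [Nat.succ_mul] at this
      omega
    have hval : ∀ (s : Fin S) (a : Fin n) (t : Fin S),
        ((List.finRange S).flatMap fun s => (List.finRange n).flatMap fun a =>
          (List.finRange S).map fun t => bitCode (g s a t))[(s : ℕ) * (n * S) + (a * S + t)]? =
        some (bitCode (g s a t)) := fun s a t => by
      rw [getElem?_flatMap_finRange _ hg' s (hlt s a t).1,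
        getElem?_flatMap_finRange _ (hg s) a t.2]
      simp
    constructor
    · intro H s a t
      rw [H _ (hlt s a t).2, hval]
    · intro H i hi
      have hS : 0 < n * S := Nat.pos_of_ne_zero fun h0 => by simp [h0] at hi
      have hS' : 0 < S := Nat.pos_of_mul_pos_left hS
      have := H ⟨i / (n * S), (Nat.div_lt_iff_lt_mul hS).2 hi⟩
        ⟨i % (n * S) / S, (Nat.div_lt_iff_lt_mul hS').2 (Nat.mod_lt _ hS)⟩
        ⟨i % (n * S) % S, Nat.mod_lt _ hS'⟩
      rw [← hval] at this
      have h1 := Nat.div_add_mod' (i % (n * S)) S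
      have h2 := Nat.div_add_mod' i (n * S)
      simp only [h1, h2] at this
      exact this
  have e3 : (∀ i < n * S, o[S + 1 + n + 1 + S + S * (n * S) + i]? =
        ((List.finRange n).flatMap fun j =>
          (List.finRange S).map fun s => bitCode (h j s))[i]?) ↔
      ∀ (j : Fin n) (s : Fin S),
        o[S + 1 + n + 1 + S + S * (n * S) + (j * S + s)]? = some (bitCode (h j s)) := by
    have hval : ∀ (j : Fin n) (s : Fin S), ((List.finRange n).flatMap fun j =>
          (List.finRange S).map fun s => bitCode (h j s))[(j : ℕ) * S + s]? =
        some (bitCode (h j s)) := fun j s => by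
      rw [getElem?_flatMap_finRange _ hh j s.2]
      simp
    constructor
    · intro H j s
      rw [H, hval]
      have := Nat.mul_le_mul_right S (Nat.succ_le_of_lt j.2)
      rw [Nat.succ_mul] at this
      have := s.2
      omega
    · intro H i hi
      have hS : 0 < S := Nat.pos_of_ne_zero fun h0 => by simp [h0] at hi
      have := H ⟨i / S, (Nat.div_lt_iff_lt_mul hS).2 hi⟩ ⟨i % S, Nat.mod_lt _ hS⟩
      rw [← hval] at this
      have h1 := Nat.div_add_mod' i S
      simp only [h1] at this
      exact this
  have key : o = (⟨S, n, f, g, h⟩ : GBA n).code ↔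
      (∀ i < S, o[i]? = some Sym.one) ∧ o[S]? = some Sym.sep ∧
      (∀ i < n, o[S + 1 + i]? = some Sym.one) ∧ o[S + 1 + n]? = some Sym.sep ∧
      (∀ i < S, o[S + 1 + n + 1 + i]? = ((List.finRange S).map fun s => bitCode (f s))[i]?) ∧
      (∀ i < S * (n * S), o[S + 1 + n + 1 + S + i]? =
        ((List.finRange S).flatMap fun s => (List.finRange n).flatMap fun a =>
          (List.finRange S).map fun t => bitCode (g s a t))[i]?) ∧
      o.drop (S + 1 + n + 1 + S + S * (n * S)) = ((List.finRange n).flatMap fun j =>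
          (List.finRange S).map fun s => bitCode (h j s)) := by
    have : o = (⟨S, n, f, g, h⟩ : GBA n).code ↔ o.drop 0 = List.replicate S Sym.one ++
        Sym.sep :: (List.replicate n Sym.one ++
        Sym.sep :: (((List.finRange S).map fun s => bitCode (f s)) ++
          (((List.finRange S).flatMap fun s => (List.finRange n).flatMap fun a =>
            (List.finRange S).map fun t => bitCode (g s a t)) ++
          ((List.finRange n).flatMap fun j =>
            (List.finRange S).map fun s => bitCode (h j s))))) := by
      rw [List.drop_zero]; rfl
    rw [this, drop_eq_replicate_iff, drop_eq_replicate_iff, drop_eq_append_iff,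
      drop_eq_append_iff, hA, hB]
    simp only [zero_add]
  rw [key, e1, e2, ← e3]
  constructor
  · rintro ⟨h1, h2, h3, h4, h5, h6, h7⟩
    have hlen : o.length = S + 1 + n + 1 + S + S * (n * S) + n * S := by
      rw [key.2 ⟨h1, h2, h3, h4, e1.2 h5, e2.2 h6, h7⟩]
      simp only [GBA.code, List.length_append, List.length_cons, hA, hB, hC,
        List.length_replicate]
      omega
    rw [drop_eq_iff (by omega), hC] at h7
    exact ⟨h1, h2, h3, h4, h5, h6, h7.1, h7.2⟩
  · rintro ⟨h1, h2, h3, h4, h5, h6, h7, h8⟩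
    refine ⟨h1, h2, h3, h4, h5, h6, ?_⟩
    rw [drop_eq_iff (by omega), hC]
    exact ⟨h7, h8⟩

theorem isCode_iff {c : Cert} {n : ℕ} {o : List Sym} : c.IsCode n o ↔ o = (c.aut n).code := by
  classical
  unfold Cert.aut
  rw [eq_code_iff]
  simp only [← isBit_iff decide_eq_true_iff, Fin.forall_iff]
  exact Iff.rfl

/-! ### Occurrences of subformulas in the input -/

/-- The first symbol of a formula. -/
def Formula.head {n : ℕ} : Formula n → Sym
  | .pred _ _ => .pred
  | .lt _ _ => .lt
  | .eq _ _ => .eq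
  | .neg _ => .neg
  | .and _ _ => .and
  | .or _ _ => .or
  | .ex _ _ => .ex

theorem Formula.code_eq_cons {n : ℕ} (φ : Formula n) : ∃ l, φ.code = φ.head :: l := by
  cases φ <;> exact ⟨_, rfl⟩

theorem Var.code_injective : Function.Injective Var.code := by
  intro u v h
  cases u <;> cases v <;> simp_all [Var.code]

/-- Prefix notation is uniquely readable. -/
theorem Formula.code_append_inj {n : ℕ} {φ ψ : Formula n} {r r' : List Sym}
    (h : φ.code ++ r = ψ.code ++ r') : φ = ψ ∧ r = r' := by
  induction φ generalizing ψ r r' with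
  | pred a u =>
    cases ψ with
    | pred b v =>
      simp only [code, List.cons_append, List.append_assoc, List.nil_append, List.cons.injEq,
        true_and] at h
      obtain ⟨hu, h⟩ := h
      have h1 := drop_eq_replicate_iff (x := List.replicate a Sym.one ++ Sym.sep :: r) (p := 0)
        (m := a) (rest := r)
      have h2 := drop_eq_replicate_iff (x := List.replicate a Sym.one ++ Sym.sep :: r) (p := 0)
        (m := b) (rest := r')
      rw [List.drop_zero] at h1 h2
      obtain ⟨h3, h4, h5⟩ := h1.1 rfl
      obtain ⟨h6, h7, h8⟩ := h2.1 h
      have hab : a = b := by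
        rcases lt_trichotomy a b with hlt | hlt | hlt
        · rw [h6 a hlt] at h4; simp at h4
        · exact hlt
        · rw [h3 b hlt] at h7; simp at h7
      subst hab
      exact ⟨by rw [Var.code_injective hu], h5.symm.trans h8⟩
    | _ => simp [code] at h
  | lt u v =>
    cases ψ with
    | lt u' v' =>
      simp only [code, List.cons_append, List.nil_append, List.cons.injEq, true_and] at h
      exact ⟨by rw [Var.code_injective h.1, Var.code_injective h.2.1], h.2.2⟩
    | _ => simp [code] at h
  | eq u v =>
    cases ψ with
    | eq u' v' =>
      simp only [code, List.cons_append, List.nil_append, List.cons.injEq, true_and] at h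
      exact ⟨by rw [Var.code_injective h.1, Var.code_injective h.2.1], h.2.2⟩
    | _ => simp [code] at h
  | neg φ ih =>
    cases ψ with
    | neg ψ =>
      simp only [code, List.cons_append, List.cons.injEq, true_and] at h
      exact ⟨by rw [(ih h).1], (ih h).2⟩
    | _ => simp [code] at h
  | and φ φ' ih ih' =>
    cases ψ with
    | and ψ ψ' =>
      simp only [code, List.cons_append, List.append_assoc, List.cons.injEq, true_and] at h
      obtain ⟨rfl, h1⟩ := ih h
      obtain ⟨rfl, h2⟩ := ih' h1
      exact ⟨rfl, h2⟩
    | _ => simp [code] at h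
  | or φ φ' ih ih' =>
    cases ψ with
    | or ψ ψ' =>
      simp only [code, List.cons_append, List.append_assoc, List.cons.injEq, true_and] at h
      obtain ⟨rfl, h1⟩ := ih h
      obtain ⟨rfl, h2⟩ := ih' h1
      exact ⟨rfl, h2⟩
    | _ => simp [code] at h
  | ex u φ ih =>
    cases ψ with
    | ex v ψ =>
      simp only [code, List.cons_append, List.cons.injEq, true_and] at h
      obtain ⟨hu, h⟩ := h
      obtain ⟨rfl, h1⟩ := ih h
      exact ⟨by rw [Var.code_injective hu], h1⟩
    | _ => simp [code] at h

/-- The formula `ψ` occurs in the word `x` at the position `p`. -/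
def Occ {n : ℕ} (x : List Sym) (p : ℕ) (ψ : Formula n) : Prop :=
  ∃ rest, x.drop p = ψ.code ++ rest

namespace Occ

variable {n : ℕ} {x : List Sym} {p : ℕ} {φ ψ : Formula n} {u v : Var} {a : Fin n}

theorem unique (h : Occ x p φ) (h' : Occ x p ψ) : φ = ψ := by
  obtain ⟨r, h⟩ := h
  obtain ⟨r', h'⟩ := h'
  exact (Formula.code_append_inj (h.symm.trans h')).1

theorem head (h : Occ x p ψ) : x[p]? = some ψ.head := by
  obtain ⟨r, h⟩ := h
  obtain ⟨l, hl⟩ := ψ.code_eq_cons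
  have := getElem?_of_drop h (i := 0) (by rw [hl]; simp)
  rw [add_zero, hl] at this
  simpa using this

theorem le (h : Occ x p ψ) : p + ψ.code.length ≤ x.length := by
  obtain ⟨r, hr⟩ := h
  have h1 := congrArg List.length hr
  have h2 : p < x.length := (List.getElem?_eq_some_iff.1 (head ⟨r, hr⟩)).1
  simp only [List.length_drop, List.length_append] at h1
  omega

theorem neg (h : Occ x p (.neg ψ)) : Occ x (p + 1) ψ := by
  obtain ⟨r, h⟩ := h
  exact ⟨r, drop_of_drop (l := [Sym.neg]) h⟩

theorem and (h : Occ x p (.and φ ψ)) : Occ x (p + 1) φ ∧ Occ x (p + 1 + φ.code.length) ψ := by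
  obtain ⟨r, h⟩ := h
  rw [Formula.code, List.cons_append, List.append_assoc] at h
  have := drop_of_drop (l := [Sym.and]) h
  exact ⟨⟨_, this⟩, r, drop_of_drop this⟩

theorem or (h : Occ x p (.or φ ψ)) : Occ x (p + 1) φ ∧ Occ x (p + 1 + φ.code.length) ψ := by
  obtain ⟨r, h⟩ := h
  rw [Formula.code, List.cons_append, List.append_assoc] at h
  have := drop_of_drop (l := [Sym.or]) h
  exact ⟨⟨_, this⟩, r, drop_of_drop this⟩

theorem ex (h : Occ x p (.ex u ψ)) : x[p + 1]? = some u.code ∧ Occ x (p + 2) ψ := by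
  obtain ⟨r, h⟩ := h
  exact ⟨getElem?_of_drop h (i := 1) (by simp [Formula.code]), r,
    drop_of_drop (l := [Sym.ex, u.code]) h⟩

theorem pred (h : Occ x p (.pred a u)) : x[p + 1]? = some u.code ∧
    (∀ i < (a : ℕ), x[p + 2 + i]? = some Sym.one) ∧ x[p + 2 + a]? = some Sym.sep := by
  obtain ⟨r, h⟩ := h
  refine ⟨getElem?_of_drop h (i := 1) (by simp [Formula.code]), ?_⟩
  have := drop_of_drop (l := [Sym.pred, u.code]) (rest := List.replicate a Sym.one ++ Sym.sep :: r)
    (by simpa [Formula.code] using h)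
  exact ⟨(drop_eq_replicate_iff.1 this).1, (drop_eq_replicate_iff.1 this).2.1⟩

theorem lt (h : Occ x p (.lt u v : Formula n)) :
    x[p + 1]? = some u.code ∧ x[p + 2]? = some v.code := by
  obtain ⟨r, h⟩ := h
  exact ⟨getElem?_of_drop h (i := 1) (by simp [Formula.code]),
    getElem?_of_drop h (i := 2) (by simp [Formula.code])⟩

theorem eq (h : Occ x p (.eq u v : Formula n)) :
    x[p + 1]? = some u.code ∧ x[p + 2]? = some v.code := by
  obtain ⟨r, h⟩ := h
  exact ⟨getElem?_of_drop h (i := 1) (by simp [Formula.code]),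
    getElem?_of_drop h (i := 2) (by simp [Formula.code])⟩

theorem of_mem_exs {e : Var × Formula n} (h : Occ x p ψ) (he : e ∈ ψ.exs) :
    ∃ q, Occ x q (.ex e.1 e.2) := by
  induction ψ generalizing p with
  | ex u ψ ih =>
    rcases List.mem_cons.1 he with rfl | he
    exacts [⟨p, h⟩, ih h.ex.2 he]
  | neg ψ ih => exact ih h.neg he
  | and φ ψ ih ih' =>
    rcases List.mem_append.1 he with he | he
    exacts [ih h.and.1 he, ih' h.and.2 he]
  | or φ ψ ih ih' =>
    rcases List.mem_append.1 he with he | he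
    exacts [ih h.or.1 he, ih' h.or.2 he]
  | _ => simp [Formula.exs] at he

theorem lt_length (h : Occ x p ψ) : p < x.length := (List.getElem?_eq_some_iff.1 h.head).1

/-- Every position of a formula with a symbol that can start a formula does start a subformula. -/
theorem exists_occ {i : ℕ} (h : Occ x p ψ) (hi : i < ψ.code.length) {s : Sym}
    (hs : x[p + i]? = some s) (hs' : s ≠ .one ∧ s ≠ .sep ∧ s ≠ .varX ∧ s ≠ .varY) :
    ∃ χ : Formula n, Occ x (p + i) χ ∧ ∀ e ∈ χ.exs, e ∈ ψ.exs := by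
  have hv : ∀ u : Var, u.code ≠ s := fun u => by
    cases u
    exacts [hs'.2.2.1.symm, hs'.2.2.2.symm]
  induction ψ generalizing p i with
  | pred a u =>
    obtain ⟨h1, h2, h3⟩ := h.pred
    simp only [Formula.code, List.length_cons, List.length_append, List.length_replicate,
      List.length_nil] at hi
    rcases i with _ | _ | i
    · exact ⟨_, h, fun _ h => h⟩
    · exact absurd (Option.some.inj (h1.symm.trans hs)) (hv u)
    · rw [show p + (i + 1 + 1) = p + 2 + i by ring] at hs
      rcases lt_or_eq_of_le (show i ≤ a by omega) with h4 | h4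
      · exact absurd (Option.some.inj (hs.symm.trans (h2 i h4))) hs'.1
      · subst h4
        exact absurd (Option.some.inj (hs.symm.trans h3)) hs'.2.1
  | lt u v =>
    obtain ⟨h1, h2⟩ := h.lt
    simp only [Formula.code, List.length_cons, List.length_nil] at hi
    rcases i with _ | _ | _ | i
    · exact ⟨_, h, fun _ h => h⟩
    · exact absurd (Option.some.inj (h1.symm.trans hs)) (hv u)
    · exact absurd (Option.some.inj (h2.symm.trans hs)) (hv v)
    · omega
  | eq u v =>
    obtain ⟨h1, h2⟩ := h.eq
    simp only [Formula.code, List.length_cons, List.length_nil] at hi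
    rcases i with _ | _ | _ | i
    · exact ⟨_, h, fun _ h => h⟩
    · exact absurd (Option.some.inj (h1.symm.trans hs)) (hv u)
    · exact absurd (Option.some.inj (h2.symm.trans hs)) (hv v)
    · omega
  | neg ψ ih =>
    simp only [Formula.code, List.length_cons] at hi
    rcases i with _ | i
    · exact ⟨_, h, fun _ h => h⟩
    · rw [show p + (i + 1) = p + 1 + i by ring] at hs ⊢
      exact ih h.neg (by omega) hs
  | and φ ψ ih ih' =>
    simp only [Formula.code, List.length_cons, List.length_append] at hi
    rcases i with _ | i
    · exact ⟨_, h, fun _ h => h⟩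
    · by_cases h1 : i < φ.code.length
      · rw [show p + (i + 1) = p + 1 + i by ring] at hs ⊢
        obtain ⟨χ, h2, h3⟩ := ih h.and.1 h1 hs
        exact ⟨χ, h2, fun e he => List.mem_append_left _ (h3 e he)⟩
      · obtain ⟨j, rfl⟩ := Nat.exists_eq_add_of_le (not_lt.1 h1)
        rw [show p + (φ.code.length + j + 1) = p + 1 + φ.code.length + j by ring] at hs ⊢
        obtain ⟨χ, h2, h3⟩ := ih' h.and.2 (by omega) hs
        exact ⟨χ, h2, fun e he => List.mem_append_right _ (h3 e he)⟩
  | or φ ψ ih ih' =>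
    simp only [Formula.code, List.length_cons, List.length_append] at hi
    rcases i with _ | i
    · exact ⟨_, h, fun _ h => h⟩
    · by_cases h1 : i < φ.code.length
      · rw [show p + (i + 1) = p + 1 + i by ring] at hs ⊢
        obtain ⟨χ, h2, h3⟩ := ih h.or.1 h1 hs
        exact ⟨χ, h2, fun e he => List.mem_append_left _ (h3 e he)⟩
      · obtain ⟨j, rfl⟩ := Nat.exists_eq_add_of_le (not_lt.1 h1)
        rw [show p + (φ.code.length + j + 1) = p + 1 + φ.code.length + j by ring] at hs ⊢
        obtain ⟨χ, h2, h3⟩ := ih' h.or.2 (by omega) hs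
        exact ⟨χ, h2, fun e he => List.mem_append_right _ (h3 e he)⟩
  | ex u ψ ih =>
    simp only [Formula.code, List.length_cons] at hi
    rcases i with _ | _ | i
    · exact ⟨_, h, fun _ h => h⟩
    · exact absurd (Option.some.inj (h.ex.1.symm.trans hs)) (hv u)
    · rw [show p + (i + 1 + 1) = p + 2 + i by ring] at hs ⊢
      obtain ⟨χ, h2, h3⟩ := ih h.ex.2 (by omega) hs
      exact ⟨χ, h2, fun e he => List.mem_cons_of_mem _ (h3 e he)⟩

end Occ

/-! ### The consistency of a certificate, checked symbol by symbol -/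

/-- The condition `f u` for the variable `u` at the position `p` of the input. -/
def ByVar (x : List Sym) (p : ℕ) (f : Var → Prop) : Prop :=
  (x[p]? = some Sym.varX ∧ f .x) ∨ (x[p]? = some Sym.varY ∧ f .y)

theorem byVar_iff {x : List Sym} {p : ℕ} {f : Var → Prop} {u : Var} (h : x[p]? = some u.code) :
    ByVar x p f ↔ f u := by
  unfold ByVar
  rw [h]
  cases u <;> simp [Var.code]

namespace Cert

variable (c : Cert)

/-- For a subformula that begins at the position `p` of the input `x`, the entry `E p` is its end,
and `T p` is its truth value computed from the certificate; the conditions for `E p` and `T p` refer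
to the immediate subformulas. -/
def LocalOk (x : List Sym) (E : ℕ → ℕ) (T : ℕ → ℕ → ℕ → ℕ → Prop) (p : ℕ) : Prop :=
  (x[p]? = some Sym.pred → ∃ a < x.length, (∀ i < a, x[p + 2 + i]? = some Sym.one) ∧
    x[p + 2 + a]? = some Sym.sep ∧ E p = p + 3 + a ∧
    ∀ r < c.R, ∀ s < c.R, ∀ o < 3, (T p r s o ↔ ByVar x (p + 1) fun u => c.ℓ (u.pick r s) = a)) ∧
  (x[p]? = some Sym.lt → E p = p + 3 ∧ ∀ r < c.R, ∀ s < c.R, ∀ o < 3, (T p r s o ↔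
    ByVar x (p + 1) fun u => ByVar x (p + 2) fun v =>
      (u = .x ∧ v = .y ∧ o = 1) ∨ (u = .y ∧ v = .x ∧ o = 2))) ∧
  (x[p]? = some Sym.eq → E p = p + 3 ∧ ∀ r < c.R, ∀ s < c.R, ∀ o < 3, (T p r s o ↔
    ByVar x (p + 1) fun u => ByVar x (p + 2) fun v => u = v ∨ o = 0)) ∧
  (x[p]? = some Sym.neg → E p = E (p + 1) ∧ ∀ r < c.R, ∀ s < c.R, ∀ o < 3,
    (T p r s o ↔ ¬ T (p + 1) r s o)) ∧
  (x[p]? = some Sym.and → E p = E (E (p + 1)) ∧ ∀ r < c.R, ∀ s < c.R, ∀ o < 3,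
    (T p r s o ↔ T (p + 1) r s o ∧ T (E (p + 1)) r s o)) ∧
  (x[p]? = some Sym.or → E p = E (E (p + 1)) ∧ ∀ r < c.R, ∀ s < c.R, ∀ o < 3,
    (T p r s o ↔ T (p + 1) r s o ∨ T (E (p + 1)) r s o)) ∧
  (x[p]? = some Sym.ex → E p = E (p + 2) ∧ ∀ r < c.R, ∀ s < c.R, ∀ o < 3,
    (T p r s o ↔ ByVar x (p + 1) fun u => c.fut u (T (p + 2)) (u.other.pick r s) ∨
      c.past u (T (p + 2)) (u.other.pick r s) ∨
      T (p + 2) (u.other.pick r s) (u.other.pick r s) 0))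

/-- The conditions on the existential subformula at `p` that make the witnesses constant on runs. -/
def ConstOk (x : List Sym) (T : ℕ → ℕ → ℕ → ℕ → Prop) (p : ℕ) : Prop :=
  ∀ r < c.R, ByVar x (p + 1) fun u => (c.fut u (T (p + 2)) r → c.futLast u (T (p + 2)) r) ∧
    (c.past u (T (p + 2)) r → c.pastFirst u (T (p + 2)) r)

/-- The runs `r` and `r'` differ in the witnesses for the existential subformula at `p`. -/
def Differ (x : List Sym) (T : ℕ → ℕ → ℕ → ℕ → Prop) (p r r' : ℕ) : Prop :=
  ByVar x (p + 1) fun u => ¬ ((c.fut u (T (p + 2)) r ↔ c.fut u (T (p + 2)) r') ∧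
    (c.past u (T (p + 2)) r ↔ c.past u (T (p + 2)) r'))

/-- The conditions under which the word `o` is accepted as an output for the input `x`. -/
def Check (x o : List Sym) (n : ℕ) (E : ℕ → ℕ) (T : ℕ → ℕ → ℕ → ℕ → Prop) : Prop :=
  (∀ i < n, x[i]? = some Sym.one) ∧ x[n]? = some Sym.sep ∧ c.Wf n ∧
  (∀ p < x.length, c.LocalOk x E T p) ∧
  (∀ p < x.length, x[p]? = some Sym.ex → c.ConstOk x T p) ∧
  (∀ r < c.R, ∀ r' < c.R, c.ℓ r = c.ℓ r' → c.en r < c.st r' →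
    (∀ s < c.R, c.ℓ s = c.ℓ r → c.en r < c.st s → ¬ c.en s < c.st r') →
    ∃ p < x.length, x[p]? = some Sym.ex ∧ c.Differ x T p r r') ∧
  (∃ r < c.R, c.st r = 0 ∧ T (n + 1) r r 0) ∧ c.IsCode n o

variable {c}

theorem orient_congr {B B' : ℕ → ℕ → ℕ → Prop}
    (h : ∀ r < c.R, ∀ s < c.R, ∀ o < 3, (B r s o ↔ B' r s o)) (u : Var) {r s o : ℕ} (hr : r < c.R)
    (hs : s < c.R) (ho : o < 3) : orient u B r s o ↔ orient u B' r s o := by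
  have : swapOrd o < 3 := by unfold swapOrd; split_ifs <;> omega
  cases u
  exacts [h s hs r hr _ this, h r hr s hs o ho]

section

variable {B B' : ℕ → ℕ → ℕ → Prop} (h : ∀ r < c.R, ∀ s < c.R, ∀ o < 3, (B r s o ↔ B' r s o))
  (u : Var) {r : ℕ} (hr : r < c.R)

include h hr

theorem fut_congr : c.fut u B r ↔ c.fut u B' r :=
  exists_congr fun _ => and_congr_right fun hs => and_congr_right fun _ =>
    orient_congr h u hr hs (by omega)

theorem past_congr : c.past u B r ↔ c.past u B' r :=
  exists_congr fun _ => and_congr_right fun hs => and_congr_right fun _ =>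
    orient_congr h u hr hs (by omega)

theorem futLast_congr : c.futLast u B r ↔ c.futLast u B' r :=
  exists_congr fun _ => and_congr_right fun hs => and_congr_right fun _ =>
    orient_congr h u hr hs (by omega)

theorem pastFirst_congr : c.pastFirst u B r ↔ c.pastFirst u B' r :=
  exists_congr fun _ => and_congr_right fun hs => and_congr_right fun _ =>
    orient_congr h u hr hs (by omega)

end

theorem pick_lt {u : Var} {r s R : ℕ} (hr : r < R) (hs : s < R) : u.pick r s < R := by
  cases u
  exacts [hr, hs]

variable {n : ℕ} {φ : Formula n} {x o : List Sym} {E : ℕ → ℕ} {T : ℕ → ℕ → ℕ → ℕ → Prop}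

/-- The local conditions determine the tables at the occurrences of formulas. -/
theorem tables_of_localOk (H : ∀ p < x.length, c.LocalOk x E T p) {p : ℕ} {ψ : Formula n}
    (h : Occ x p ψ) : E p = p + ψ.code.length ∧
      ∀ r < c.R, ∀ s < c.R, ∀ o < 3, (T p r s o ↔ c.Abs ψ r s o) := by
  have L : ∀ {p} {ψ : Formula n}, Occ x p ψ → c.LocalOk x E T p := fun {p ψ} h => H p h.lt_length
  induction ψ generalizing p with
  | pred a u =>
    obtain ⟨h1, h2, h3⟩ := h.pred
    obtain ⟨b, -, h4, h5, h6, h7⟩ := (L h).1 h.head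
    have hab : b = a := by
      rcases lt_trichotomy b a with hlt | hlt | hlt
      · rw [h2 b hlt] at h5; simp at h5
      · exact hlt
      · rw [h4 a hlt] at h3; simp at h3
    subst hab
    refine ⟨by rw [h6]; simp [Formula.code]; ring, fun r hr s hs o ho => ?_⟩
    rw [h7 r hr s hs o ho, byVar_iff h1]
    exact Iff.rfl
  | lt u v =>
    obtain ⟨h1, h2⟩ := h.lt
    obtain ⟨h3, h4⟩ := (L h).2.1 h.head
    refine ⟨h3, fun r hr s hs o ho => ?_⟩
    rw [h4 r hr s hs o ho, byVar_iff h1, byVar_iff h2]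
    exact Iff.rfl
  | eq u v =>
    obtain ⟨h1, h2⟩ := h.eq
    obtain ⟨h3, h4⟩ := (L h).2.2.1 h.head
    refine ⟨h3, fun r hr s hs o ho => ?_⟩
    rw [h4 r hr s hs o ho, byVar_iff h1, byVar_iff h2]
    exact Iff.rfl
  | neg ψ ih =>
    obtain ⟨h3, h4⟩ := (L h).2.2.2.1 h.head
    obtain ⟨h5, h6⟩ := ih h.neg
    refine ⟨by rw [h3, h5]; simp only [Formula.code, List.length_cons]; ring,
      fun r hr s hs o ho => ?_⟩
    rw [h4 r hr s hs o ho, h6 r hr s hs o ho]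
    exact Iff.rfl
  | and φ ψ ih ih' =>
    obtain ⟨h3, h4⟩ := (L h).2.2.2.2.1 h.head
    obtain ⟨h5, h6⟩ := ih h.and.1
    obtain ⟨h7, h8⟩ := ih' h.and.2
    rw [h5] at h3 h4
    refine ⟨by rw [h3, h7]; simp only [Formula.code, List.length_cons, List.length_append]; ring,
      fun r hr s hs o ho => ?_⟩
    rw [h4 r hr s hs o ho, h6 r hr s hs o ho, h8 r hr s hs o ho]
    exact Iff.rfl
  | or φ ψ ih ih' =>
    obtain ⟨h3, h4⟩ := (L h).2.2.2.2.2.1 h.head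
    obtain ⟨h5, h6⟩ := ih h.or.1
    obtain ⟨h7, h8⟩ := ih' h.or.2
    rw [h5] at h3 h4
    refine ⟨by rw [h3, h7]; simp only [Formula.code, List.length_cons, List.length_append]; ring,
      fun r hr s hs o ho => ?_⟩
    rw [h4 r hr s hs o ho, h6 r hr s hs o ho, h8 r hr s hs o ho]
    exact Iff.rfl
  | ex u ψ ih =>
    obtain ⟨h3, h4⟩ := (L h).2.2.2.2.2.2 h.head
    obtain ⟨h5, h6⟩ := ih h.ex.2
    refine ⟨by rw [h3, h5]; simp only [Formula.code, List.length_cons]; ring,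
      fun r hr s hs o ho => ?_⟩
    have hu := pick_lt (u := u.other) hr hs
    rw [h4 r hr s hs o ho, byVar_iff h.ex.1, fut_congr h6 u hu, past_congr h6 u hu,
      h6 _ hu _ hu 0 (by omega)]
    exact Iff.rfl

theorem inputCode_drop (φ : Formula n) : Occ (inputCode φ) (n + 1) φ := by
  refine ⟨[], ?_⟩
  have h := drop_eq_replicate_iff (x := inputCode φ) (p := 0) (m := n) (rest := φ.code)
  rw [List.drop_zero] at h
  have := (h.1 rfl).2.2
  rwa [zero_add, ← List.append_nil φ.code] at this

theorem inputCode_prefix (φ : Formula n) :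
    (∀ i < n, (inputCode φ)[i]? = some Sym.one) ∧ (inputCode φ)[n]? = some Sym.sep := by
  have h := drop_eq_replicate_iff (x := inputCode φ) (p := 0) (m := n) (rest := φ.code)
  rw [List.drop_zero] at h
  have := h.1 rfl
  simp only [zero_add] at this
  exact ⟨this.1, this.2.1⟩

/-- The formula that occurs at a position of the input with a symbol that can start a formula. -/
theorem exists_occ_input (φ : Formula n) {p : ℕ} {s : Sym} (hs : (inputCode φ)[p]? = some s)
    (hs' : s ≠ .one ∧ s ≠ .sep ∧ s ≠ .varX ∧ s ≠ .varY) :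
    ∃ χ : Formula n, Occ (inputCode φ) p χ ∧ ∀ e ∈ χ.exs, e ∈ φ.exs := by
  have hp := (List.getElem?_eq_some_iff.1 hs).1
  obtain ⟨h1, h2⟩ := inputCode_prefix φ
  have hle : n + 1 ≤ p := by
    by_contra hlt
    rcases lt_or_eq_of_le (show p ≤ n by omega) with h | rfl
    · exact hs'.1 (Option.some.inj (hs.symm.trans (h1 p h)))
    · exact hs'.2.1 (Option.some.inj (hs.symm.trans h2))
  obtain ⟨i, rfl⟩ := Nat.exists_eq_add_of_le hle
  refine (inputCode_drop φ).exists_occ ?_ hs hs'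
  simp only [inputCode, List.length_append, List.length_replicate, List.length_cons] at hp
  omega

/-- The local conditions determine the tables at the positions where subformulas begin, whatever
their other entries are. So the check does not depend on guessing the right tables. -/
theorem Check.sound {m : ℕ} (h : c.Check (inputCode φ) o m E T) :
    c.Valid φ ∧ o = (c.aut n).code := by
  obtain ⟨h1, h2, h3, h4, h5, h6, h7, h8⟩ := h
  obtain ⟨h1', h2'⟩ := inputCode_prefix φ
  have hm : m = n := by
    rcases lt_trichotomy m n with hlt | hlt | hlt
    · rw [h1' m hlt] at h2; simp at h2
    · exact hlt
    · rw [h1 n hlt] at h2'; simp at h2'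
  subst hm
  have key : ∀ {p} {u : Var} {χ : Formula m}, Occ (inputCode φ) p (.ex u χ) →
      p < (inputCode φ).length
      ∧ (inputCode φ)[p + 1]? = some u.code ∧
      ∀ r < c.R, ∀ s < c.R, ∀ o < 3, (T (p + 2) r s o ↔ c.Abs χ r s o) := fun h =>
    ⟨h.lt_length, h.ex.1, (tables_of_localOk h4 h.ex.2).2⟩
  refine ⟨⟨h3, ?_, ?_, ?_⟩, isCode_iff.1 h8⟩
  · rintro ⟨u, χ⟩ he r hr
    obtain ⟨q, hq⟩ := (inputCode_drop φ).of_mem_exs he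
    obtain ⟨hlt, hu, hT⟩ := key hq
    have := h5 q hlt hq.head r hr
    rwa [byVar_iff hu, fut_congr hT u hr, past_congr hT u hr, futLast_congr hT u hr,
      pastFirst_congr hT u hr] at this
  · intro r hr r' hr' hl hlt hb
    obtain ⟨p, hp, hs, hd⟩ := h6 r hr r' hr' hl hlt hb
    obtain ⟨χ, hχ, hsub⟩ := exists_occ_input φ hs (by simp)
    have hhead := Option.some.inj (hs.symm.trans hχ.head)
    cases χ with
    | ex u χ =>
      obtain ⟨-, hu, hT⟩ := key hχ
      refine ⟨(u, χ), hsub _ (by simp [Formula.exs]), ?_⟩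
      rwa [Differ, byVar_iff hu, fut_congr hT u hr, past_congr hT u hr, fut_congr hT u hr',
        past_congr hT u hr'] at hd
    | _ => simp [Formula.head] at hhead
  · obtain ⟨r, hr, h9, h10⟩ := h7
    exact ⟨r, hr, h9, ((tables_of_localOk h4 (inputCode_drop φ)).2 r hr r hr 0 (by omega)).1 h10⟩

open Classical in
/-- The table of the ends of the subformulas. -/
noncomputable def endTable (n : ℕ) (x : List Sym) (p : ℕ) : ℕ :=
  if h : ∃ ψ : Formula n, Occ x p ψ then p + h.choose.code.length else 0

/-- The table of the truth values of the subformulas. -/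
def truthTable (c : Cert) (n : ℕ) (x : List Sym) (p r s o : ℕ) : Prop :=
  ∃ ψ : Formula n, Occ x p ψ ∧ c.Abs ψ r s o

theorem endTable_eq {p : ℕ} {ψ : Formula n} (h : Occ x p ψ) :
    endTable n x p = p + ψ.code.length := by
  have hex : ∃ ψ : Formula n, Occ x p ψ := ⟨ψ, h⟩
  rw [endTable, dif_pos hex, hex.choose_spec.unique h]

theorem endTable_le (n : ℕ) (x : List Sym) (p : ℕ) : endTable n x p ≤ x.length := by
  by_cases h : ∃ ψ : Formula n, Occ x p ψ
  · obtain ⟨ψ, h⟩ := h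
    rw [endTable_eq h]
    exact h.le
  · rw [endTable, dif_neg h]
    exact Nat.zero_le _

theorem truthTable_iff {p r s i : ℕ} {ψ : Formula n} (h : Occ x p ψ) :
    c.truthTable n x p r s i ↔ c.Abs ψ r s i :=
  ⟨fun ⟨_, h1, h2⟩ => h1.unique h ▸ h2, fun h' => ⟨ψ, h, h'⟩⟩

/-- The tables with the actual ends and truth values satisfy the local conditions. -/
theorem localOk_tables (φ : Formula n) (hT : ∀ p, ∀ r < c.R, ∀ s < c.R, ∀ i < 3,
      (T p r s i ↔ c.truthTable n (inputCode φ) p r s i)) (p : ℕ) :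
    c.LocalOk (inputCode φ) (endTable n (inputCode φ)) T p := by
  have hT' : ∀ {p} {ψ : Formula n}, Occ (inputCode φ) p ψ → ∀ r < c.R, ∀ s < c.R, ∀ i < 3,
      (T p r s i ↔ c.Abs ψ r s i) := fun h r hr s hs i hi =>
    (hT _ r hr s hs i hi).trans (truthTable_iff h)
  refine ⟨fun hs => ?_, fun hs => ?_, fun hs => ?_, fun hs => ?_, fun hs => ?_, fun hs => ?_,
    fun hs => ?_⟩
  all_goals
    obtain ⟨χ, hχ, -⟩ := exists_occ_input φ hs (by simp)
    have hhead := Option.some.inj (hs.symm.trans hχ.head)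
    rw [endTable_eq hχ]
    cases χ
    all_goals first
      | (exfalso; simp [Formula.head] at hhead; done)
      | skip
  · obtain ⟨h1, h2, h3⟩ := hχ.pred
    refine ⟨_, ?_, h2, h3, by simp [Formula.code]; ring, fun r hr s hs i hi => ?_⟩
    · have := (List.getElem?_eq_some_iff.1 h3).1
      omega
    · rw [hT' hχ r hr s hs i hi, byVar_iff h1]
      exact Iff.rfl
  · refine ⟨rfl, fun r hr s hs i hi => ?_⟩
    rw [hT' hχ r hr s hs i hi, byVar_iff hχ.lt.1, byVar_iff hχ.lt.2]
    exact Iff.rfl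
  · refine ⟨rfl, fun r hr s hs i hi => ?_⟩
    rw [hT' hχ r hr s hs i hi, byVar_iff hχ.eq.1, byVar_iff hχ.eq.2]
    exact Iff.rfl
  · refine ⟨by rw [endTable_eq hχ.neg]; simp only [Formula.code, List.length_cons]; ring,
      fun r hr s hs i hi => ?_⟩
    rw [hT' hχ r hr s hs i hi, hT' hχ.neg r hr s hs i hi]
    exact Iff.rfl
  · rw [endTable_eq hχ.and.1, endTable_eq hχ.and.2]
    refine ⟨by simp only [Formula.code, List.length_cons, List.length_append]; ring,
      fun r hr s hs i hi => ?_⟩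
    rw [hT' hχ r hr s hs i hi, hT' hχ.and.1 r hr s hs i hi, hT' hχ.and.2 r hr s hs i hi]
    exact Iff.rfl
  · rw [endTable_eq hχ.or.1, endTable_eq hχ.or.2]
    refine ⟨by simp only [Formula.code, List.length_cons, List.length_append]; ring,
      fun r hr s hs i hi => ?_⟩
    rw [hT' hχ r hr s hs i hi, hT' hχ.or.1 r hr s hs i hi, hT' hχ.or.2 r hr s hs i hi]
    exact Iff.rfl
  · refine ⟨by rw [endTable_eq hχ.ex.2]; simp only [Formula.code, List.length_cons]; ring,
      fun r hr s hs i hi => ?_⟩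
    have hu := fun u : Var => pick_lt (u := u) hr hs
    rw [hT' hχ r hr s hs i hi, byVar_iff hχ.ex.1, fut_congr (hT' hχ.ex.2) _ (hu _),
      past_congr (hT' hχ.ex.2) _ (hu _), hT' hχ.ex.2 _ (hu _) _ (hu _) 0 (by omega)]
    exact Iff.rfl

/-- A valid certificate passes the check with the actual tables. -/
theorem Valid.check (hv : c.Valid φ) (hT : ∀ p, ∀ r < c.R, ∀ s < c.R, ∀ i < 3,
      (T p r s i ↔ c.truthTable n (inputCode φ) p r s i)) :
    c.Check (inputCode φ) (c.aut n).code n (endTable n (inputCode φ)) T := by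
  have hT' : ∀ {p} {ψ : Formula n}, Occ (inputCode φ) p ψ → ∀ r < c.R, ∀ s < c.R, ∀ i < 3,
      (T p r s i ↔ c.Abs ψ r s i) := fun h r hr s hs i hi =>
    (hT _ r hr s hs i hi).trans (truthTable_iff h)
  refine ⟨(inputCode_prefix φ).1, (inputCode_prefix φ).2, hv.wf, fun p _ => localOk_tables φ hT p,
    fun p hp hs r hr => ?_, fun r hr r' hr' hl hlt hb => ?_, ?_, isCode_iff.2 rfl⟩
  · obtain ⟨χ, hχ, hsub⟩ := exists_occ_input φ hs (by simp)
    have hhead := Option.some.inj (hs.symm.trans hχ.head)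
    cases χ with
    | ex u χ =>
      rw [byVar_iff hχ.ex.1, fut_congr (hT' hχ.ex.2) u hr, past_congr (hT' hχ.ex.2) u hr,
        futLast_congr (hT' hχ.ex.2) u hr, pastFirst_congr (hT' hχ.ex.2) u hr]
      exact hv.const (u, χ) (hsub _ (by simp [Formula.exs])) r hr
    | _ => simp [Formula.head] at hhead
  · obtain ⟨⟨u, χ⟩, he, hd⟩ := hv.maximal r hr r' hr' hl hlt hb
    obtain ⟨q, hq⟩ := (inputCode_drop φ).of_mem_exs he
    refine ⟨q, hq.lt_length, hq.head, ?_⟩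
    rwa [Differ, byVar_iff hq.ex.1, fut_congr (hT' hq.ex.2) u hr, past_congr (hT' hq.ex.2) u hr,
      fut_congr (hT' hq.ex.2) u hr', past_congr (hT' hq.ex.2) u hr']
  · obtain ⟨r, hr, h1, h2⟩ := hv.root
    exact ⟨r, hr, h1, (hT' (inputCode_drop φ) r hr r hr 0 (by omega)).2 h2⟩

end Cert

/-! ### Certificates on tapes -/

/-- A bound on the numbers that occur in the certificates of words. The exponent exceeds that of the
number of markers, which is of the order `n * |φ| ^ 4`, so that constant factors are absorbed. -/
def width (τ : Store) : ℕ := ((τ 0).length + 2) ^ 8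

open Classical in
/-- The function on the tape `t`: the value at `i` is the number of ones in row `i`. -/
noncomputable def tapeFn (τ : Store) (t i : ℕ) : ℕ :=
  ∑ q ∈ Finset.range (width τ), if (τ t)[i * width τ + q]? = some Sym.one then 1 else 0

/-- The certificate on the tapes `2`, `3` and `4`. -/
noncomputable def tapeCert (τ : Store) (R k : ℕ) : Cert :=
  ⟨R, k, tapeFn τ 2, tapeFn τ 3, tapeFn τ 4⟩

/-- The table of truth values on the tape `6`. -/
def tapeTable (τ : Store) (R p r s o : ℕ) : Prop :=
  (τ 6)[((p * R + r) * R + s) * 3 + o]? = some Sym.one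

/-- The tapes hold a consistent certificate for the input on tape `0` and the description of its
automaton on tape `1`. -/
def TapeCheck (τ : Store) : Prop :=
  ∃ n, n < width τ ∧ ∃ R, R < width τ ∧ ∃ k, k < width τ ∧
    (tapeCert τ R k).Check (τ 0) (τ 1) n (tapeFn τ 5) (tapeTable τ R)

theorem DP.prop {m : ℕ} (P : Prop) : DP m fun _ _ => P := by
  by_cases h : P
  · exact (DP.eq (Dn.const 0) (Dn.const 0)).congr fun _ _ => by simp [h]
  · exact (DP.lt (Dn.const 0) (Dn.const 0)).congr fun _ _ => by simp [h]

theorem Dn.width {m : ℕ} (hm : 0 < m) : Dn m fun τ _ => width τ :=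
  ((Dn.len hm).add (Dn.const 2)).pow 8

theorem Dn.tapeFn {m t : ℕ} (ht : t < m) {a : Store → (ℕ → ℕ) → ℕ} (ha : Dn m a) :
    Dn m fun τ ρ => tapeFn τ t (a τ ρ) := by
  have hm : 0 < m := by omega
  classical
  refine Dn.sum (Dn.width hm) (f := fun τ ρ q =>
    if (τ t)[a τ ρ * FO2Aut.width τ + q]? = some Sym.one then 1 else 0) ?_
  convert Dn.ind (DP.rd ht Sym.one (((ha.rename fun i => i + 1).mul (Dn.width hm)).add (Dn.var 0)))

theorem Cert.wf_iff {c : Cert} {n : ℕ} : c.Wf n ↔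
    (∀ r < c.R, c.ℓ r < n ∧ c.st r ≤ c.en r ∧ c.st r < c.k ∧ c.en r ≤ c.k) ∧
    (∀ r < c.R, ∀ r' < c.R, ¬ r = r' → c.ℓ r = c.ℓ r' → c.en r < c.st r' ∨ c.en r' < c.st r) ∧
    (∀ i < c.k, ∃ r < c.R, c.st r = i ∨ c.en r = i) ∧
    (∀ r < c.R, ∀ r' < c.R, ∀ i < c.k, (c.st r = i ∨ c.en r = i) →
      (c.st r' = i ∨ c.en r' = i) → c.ℓ r = c.ℓ r') :=
  ⟨fun h => ⟨h.1, h.2, h.3, h.4⟩, fun h => ⟨h.1, h.2.1, h.2.2.1, h.2.2.2⟩⟩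

theorem definable_tapeCheck : DP 7 fun τ _ => TapeCheck τ := by
  unfold TapeCheck Cert.Check Cert.LocalOk Cert.ConstOk Cert.Differ Cert.IsCode
  simp only [Cert.wf_iff, ByVar, Cert.fut, Cert.past, Cert.futLast, Cert.pastFirst, tapeCert,
    orient, Var.pick, Var.other, Cert.Trans, Cert.Acc, Cert.Opn, Cert.Mark, IsBit, tapeTable]
  repeat' first
    | with_reducible exact DP.prop _
    | with_reducible exact Dn.var _
    | with_reducible exact Dn.const _
    | with_reducible exact Dn.width (by decide)
    | with_reducible exact Dn.len (by decide)
    | with_reducible apply Dn.tapeFn (by decide)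
    | with_reducible apply DP.bex
    | with_reducible apply DP.and
    | with_reducible apply DP.or
    | with_reducible apply DP.not
    | with_reducible apply DP.ball
    | with_reducible apply DP.rd (by decide)
    | with_reducible apply DP.imp
    | with_reducible apply DP.iff
    | with_reducible apply DP.eq
    | with_reducible apply DP.le
    | with_reducible apply DP.lt
    | with_reducible apply Dn.add
    | with_reducible apply Dn.mul

/-! ### The machine that guesses certificates -/

theorem card_filter_lt {m W : ℕ} (h : m ≤ W) : ((Finset.range W).filter (· < m)).card = m := by
  have : (Finset.range W).filter (· < m) = Finset.range m := by
    ext q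
    simp only [Finset.mem_filter, Finset.mem_range]
    omega
  rw [this, Finset.card_range]

open Classical in
/-- The word of length `L` with the bit for `P q` at the position `q`. -/
noncomputable def bits (L : ℕ) (P : ℕ → Prop) : List Sym :=
  (List.range L).map fun q => bitCode (decide (P q))

theorem guessable_bits {L b : ℕ} (h : L ≤ b) (P : ℕ → Prop) : Guessable b (bits L P) := by
  refine ⟨by simpa [bits] using h, fun x hx => ?_⟩
  obtain ⟨q, -, rfl⟩ := List.mem_map.1 hx
  unfold bitCode
  split_ifs
  exacts [Or.inr (Or.inl rfl), Or.inl rfl]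

theorem getElem?_bits {L q : ℕ} {P : ℕ → Prop} :
    (bits L P)[q]? = some Sym.one ↔ q < L ∧ P q := by
  classical
  unfold bits
  by_cases hq : q < L
  · by_cases hP : P q <;> simp [hq, hP, bitCode]
  · simp [hq]

/-- The table of a function on the numbers below `X`. -/
noncomputable def fnTable (W X : ℕ) (f : ℕ → ℕ) : List Sym :=
  bits (X * W) fun q => q % W < f (q / W)

theorem tapeFn_fnTable {τ : Store} {t X : ℕ} {f : ℕ → ℕ} (ht : τ t = fnTable (width τ) X f)
    (hf : ∀ i < X, f i ≤ width τ) (h0 : ∀ i, X ≤ i → f i = 0) : tapeFn τ t = f := by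
  classical
  funext i
  unfold tapeFn
  rw [Finset.sum_boole, Nat.cast_id]
  have hiff : ∀ q ∈ Finset.range (width τ),
      ((τ t)[i * width τ + q]? = some Sym.one ↔ q < f i) := by
    intro q hq
    rw [Finset.mem_range] at hq
    have h1 : (i * width τ + q) % width τ = q := by
      rw [mul_comm, Nat.mul_add_mod, Nat.mod_eq_of_lt hq]
    have h2 : (i * width τ + q) / width τ = i := by
      rw [mul_comm, Nat.mul_add_div (by omega), Nat.div_eq_of_lt hq, add_zero]
    rw [ht, fnTable, getElem?_bits, h1, h2, and_iff_right_iff_imp]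
    intro hqf
    have hi : i < X := not_le.1 fun h => by
      rw [h0 i h] at hqf
      omega
    have := Nat.mul_le_mul_right (width τ) (Nat.succ_le_of_lt hi)
    rw [Nat.succ_mul] at this
    omega
  rw [Finset.filter_congr hiff]
  by_cases hi : i < X
  · exact card_filter_lt (hf i hi)
  · rw [h0 i (not_lt.1 hi)]; simp

/-- The table of a predicate of the position `p`, the runs `r` and `s`, and the order `o`. -/
noncomputable def predTable (N R : ℕ) (Q : ℕ → ℕ → ℕ → ℕ → Prop) : List Sym :=
  bits (N * R * R * 3) fun q => Q (q / 3 / R / R) (q / 3 / R % R) (q / 3 % R) (q % 3)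

theorem tapeTable_predTable {τ : Store} {N R : ℕ} {Q : ℕ → ℕ → ℕ → ℕ → Prop}
    (ht : τ 6 = predTable N R Q) (hQ : ∀ p, N ≤ p → ∀ r s o, ¬ Q p r s o) {p r s o : ℕ} (hr : r < R)
    (hs : s < R) (ho : o < 3) : tapeTable τ R p r s o ↔ Q p r s o := by
  unfold tapeTable
  have hR : 0 < R := by omega
  have e1 : (((p * R + r) * R + s) * 3 + o) / 3 = (p * R + r) * R + s := by omega
  have e2 : (((p * R + r) * R + s) * 3 + o) % 3 = o := by omega
  have e3 : ((p * R + r) * R + s) / R = p * R + r := by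
    rw [mul_comm, Nat.mul_add_div hR, Nat.div_eq_of_lt hs, add_zero]
  have e4 : ((p * R + r) * R + s) % R = s := by
    rw [mul_comm, Nat.mul_add_mod, Nat.mod_eq_of_lt hs]
  have e5 : (p * R + r) / R = p := by
    rw [mul_comm, Nat.mul_add_div hR, Nat.div_eq_of_lt hr, add_zero]
  have e6 : (p * R + r) % R = r := by
    rw [mul_comm, Nat.mul_add_mod, Nat.mod_eq_of_lt hr]
  rw [ht, predTable, getElem?_bits, e2, e1, e3, e4, e5, e6, and_iff_right_iff_imp]
  intro h
  have hp : p < N := not_le.1 fun h' => hQ p h' r s o h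
  have h1 : p * R + r < N * R := by
    have := Nat.mul_le_mul_right R (Nat.succ_le_of_lt hp)
    rw [Nat.succ_mul] at this
    omega
  have h2 : (p * R + r) * R + s < N * R * R := by
    have := Nat.mul_le_mul_right R (Nat.succ_le_of_lt h1)
    rw [Nat.succ_mul] at this
    omega
  omega

/-- The tapes with a certificate, the tables, and the description of the automaton. -/
noncomputable def tapes {n : ℕ} (c : Cert) (x : List Sym) (W : ℕ) : Store
  | 0 => x
  | 1 => (c.aut n).code
  | 2 => fnTable W c.R c.ℓ
  | 3 => fnTable W c.R c.st
  | 4 => fnTable W c.R c.en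
  | 5 => fnTable W x.length (Cert.endTable n x)
  | 6 => predTable x.length c.R (c.truthTable n x)
  | _ => []

/-- The bound on the lengths of the tapes for an input of length `N`: the fourth power of the width.
The description of an automaton with `S` states has at most `O(S ^ 3)` symbols, and the table of
truth values has an entry for every position of the input, every pair of runs and every order. -/
def tapeBound (N : ℕ) : ℕ := ((N + 2) ^ 8) ^ 4

theorem guessable_code {n : ℕ} (A : GBA n) {b : ℕ} (h : A.code.length ≤ b) :
    Guessable b A.code := by
  refine ⟨h, fun x hx => ?_⟩
  have hb : ∀ b, bitCode b = Sym.zero ∨ bitCode b = Sym.one ∨ bitCode b = Sym.sep := by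
    intro b; cases b <;> simp [bitCode]
  simp only [GBA.code, List.mem_append, List.mem_cons, List.mem_map, List.mem_flatMap,
    List.mem_replicate] at hx
  rcases hx with ⟨-, rfl⟩ | rfl | ⟨-, rfl⟩ | rfl | ⟨_, -, rfl⟩ | ⟨_, -, _, -, _, -, rfl⟩ |
    ⟨_, -, _, -, rfl⟩
  all_goals first | exact hb _ | simp

/-- A valid certificate of small size can be written on guessed tapes that pass the check. -/
theorem exists_tapes {n : ℕ} {φ : Formula n} {c : Cert} (hv : c.Valid φ)
    (hR : c.R < ((inputCode φ).length + 2) ^ 8)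
    (hk : c.k + 1 + n < ((inputCode φ).length + 2) ^ 8)
    (h0 : ∀ r, c.R ≤ r → c.ℓ r = 0 ∧ c.st r = 0 ∧ c.en r = 0) :
    ∃ τ ∈ GuessedTapes (inputCode φ) (tapeBound (inputCode φ).length) 6,
      TapeCheck τ ∧ τ 1 = (c.aut n).code := by
  set x := inputCode φ with hx
  set W := (x.length + 2) ^ 8 with hW
  have hN : x.length + 2 ≤ W := Nat.le_self_pow (by omega) _
  have hlen : n + 1 < x.length := (Cert.inputCode_drop φ).lt_length
  have hsq : W * W ≤ W ^ 4 := by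
    have := Nat.pow_le_pow_right (show 0 < W by omega) (show 2 ≤ 4 by omega)
    rwa [pow_two] at this
  have hfn : ∀ {X} f, X ≤ W → Guessable (tapeBound x.length) (fnTable W X f) := fun f hX =>
    guessable_bits ((Nat.mul_le_mul_right W hX).trans hsq) _
  refine ⟨tapes (n := n) c x W, ⟨rfl, ?_, ?_⟩, ?_, rfl⟩
  · intro t ht1 ht6
    interval_cases t
    · refine guessable_code _ ?_
      rw [(isCode_iff.2 (rfl : (c.aut n).code = _)).2.2.2.2.2.2.2]
      generalize hS : c.k + 1 + n = S at hk
      have hnS : n ≤ S := by omega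
      show _ ≤ W ^ 4
      have h1 : S * (n * S) ≤ W * (W * W) :=
        Nat.mul_le_mul hk.le (Nat.mul_le_mul (by omega) hk.le)
      have h2 : n * S ≤ W * W := Nat.mul_le_mul (by omega) hk.le
      have h3 : 3 * (W * (W * W)) ≤ W ^ 4 := by
        have := Nat.mul_le_mul_right (W * (W * W)) (show 3 ≤ W by omega)
        linarith [show W * (W * (W * W)) = W ^ 4 by ring]
      have h4 : 3 * W ≤ W * W := Nat.mul_le_mul_right W (by omega)
      have h5 : 3 * (W * W) ≤ W * (W * W) := Nat.mul_le_mul_right (W * W) (by omega)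
      omega
    · exact hfn _ hR.le
    · exact hfn _ hR.le
    · exact hfn _ hR.le
    · exact hfn _ (by omega)
    · refine guessable_bits ?_ _
      calc x.length * c.R * c.R * 3 ≤ W * W * W * W :=
            Nat.mul_le_mul (Nat.mul_le_mul (Nat.mul_le_mul (by omega) hR.le) hR.le) (by omega)
        _ = W ^ 4 := by ring
  · intro t ht
    match t, ht with
    | t + 7, _ => rfl
  · refine ⟨n, by show n < W; omega, c.R, hR, c.k, by show c.k < W; omega, ?_⟩
    have hwf := hv.wf.run
    have h1 : tapeFn (tapes (n := n) c x W) 2 = c.ℓ := tapeFn_fnTable rfl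
      (fun i hi => by have := hwf i hi; show _ ≤ W; omega) fun i hi => (h0 i hi).1
    have h2 : tapeFn (tapes (n := n) c x W) 3 = c.st := tapeFn_fnTable rfl
      (fun i hi => by have := hwf i hi; show _ ≤ W; omega) fun i hi => (h0 i hi).2.1
    have h3 : tapeFn (tapes (n := n) c x W) 4 = c.en := tapeFn_fnTable rfl
      (fun i hi => by have := hwf i hi; show _ ≤ W; omega) fun i hi => (h0 i hi).2.2
    have h4 : tapeFn (tapes (n := n) c x W) 5 = Cert.endTable n x := tapeFn_fnTable rfl
      (fun i hi => (Cert.endTable_le n x i).trans (by show _ ≤ W; omega)) fun i hi => by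
        refine dif_neg ?_
        rintro ⟨ψ, hψ⟩
        exact absurd hψ.lt_length (by omega)
    have h5 : tapeCert (tapes (n := n) c x W) c.R c.k = c := by
      unfold tapeCert
      rw [h1, h2, h3]
    rw [h4, h5]
    refine hv.check fun p r hr s hs i hi => tapeTable_predTable rfl ?_ hr hs hi
    rintro p hp r s o ⟨ψ, hψ, -⟩
    exact absurd hψ.lt_length (not_lt.2 hp)

theorem length_inputCode_le {n : ℕ} (φ : Formula n) :
    (inputCode φ).length ≤ (φ.size + n) ^ 2 + 4 * (φ.size + n) + 1 := by
  have h : φ.code.length ≤ φ.size * (n + 3) := by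
    induction φ with
    | pred a u =>
      have := a.2
      simp only [Formula.code, Formula.size, List.length_cons, List.length_append,
        List.length_replicate, List.length_nil]
      omega
    | lt u v => simp [Formula.code, Formula.size]
    | eq u v => simp [Formula.code, Formula.size]
    | neg φ ih =>
      simp only [Formula.code, Formula.size, List.length_cons, Nat.succ_mul]
      omega
    | and φ ψ ih ih' =>
      simp only [Formula.code, Formula.size, List.length_cons, List.length_append, Nat.succ_mul,
        Nat.add_mul] at *
      omega
    | or φ ψ ih ih' =>
      simp only [Formula.code, Formula.size, List.length_cons, List.length_append, Nat.succ_mul,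
        Nat.add_mul] at *
      omega
    | ex u φ ih =>
      simp only [Formula.code, Formula.size, List.length_cons, Nat.succ_mul]
      omega
  simp only [inputCode, List.length_append, List.length_replicate, List.length_cons]
  nlinarith [Nat.zero_le (φ.size * n), Nat.zero_le (φ.size ^ 2), Nat.zero_le (n ^ 2)]

theorem size_lt_length_inputCode {n : ℕ} (φ : Formula n) :
    φ.size + n < (inputCode φ).length := by
  have h : φ.size ≤ φ.code.length := by
    induction φ with
    | and φ ψ ih ih' =>
      simp only [Formula.code, Formula.size, List.length_cons, List.length_append]; omega
    | or φ ψ ih ih' =>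
      simp only [Formula.code, Formula.size, List.length_cons, List.length_append]; omega
    | ex u φ ih => simp only [Formula.code, Formula.size, List.length_cons]; omega
    | _ => simp_all [Formula.code, Formula.size]
  simp only [inputCode, List.length_append, List.length_replicate, List.length_cons]
  omega

/-- The certificates of words are small enough for the tapes. -/
theorem certOf_small {n : ℕ} (w : ℕ → Fin n) (φ : Formula n) :
    (certOf w φ).R < ((inputCode φ).length + 2) ^ 8 ∧
      (certOf w φ).k + 1 + n < ((inputCode φ).length + 2) ^ 8 := by
  have hs := size_lt_length_inputCode φ
  have hR := certOf.R_le (w := w) (φ := φ)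
  have hk := certOf.k_le (w := w) (φ := φ)
  set N := (inputCode φ).length + 2 with hN
  have h1 : n * (4 * φ.size ^ 4 + 1) ≤ N * (5 * N ^ 4) := by
    refine Nat.mul_le_mul (by omega) ?_
    have h2 : φ.size ^ 4 ≤ N ^ 4 := Nat.pow_le_pow_left (by omega) 4
    have h3 : 1 ≤ N ^ 4 := Nat.one_le_pow _ _ (by omega)
    omega
  have h2 : N * (5 * N ^ 4) = 5 * N ^ 5 := by ring
  have h3 : 27 * N ^ 5 ≤ N ^ 8 := by
    have : 3 ^ 3 ≤ N ^ 3 := Nat.pow_le_pow_left (by omega) 3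
    calc 27 * N ^ 5 ≤ N ^ 3 * N ^ 5 := Nat.mul_le_mul_right _ this
      _ = N ^ 8 := by ring
  have h4 : N ≤ N ^ 5 := Nat.le_self_pow (by omega) _
  omega

/-- An automaton with `n` accepting sets is determined by its description. -/
theorem GBA.eq_of_code_eq {n S S' : ℕ} {f : Fin S → Bool} {g : Fin S → Fin n → Fin S → Bool}
    {h : Fin n → Fin S → Bool} {f' : Fin S' → Bool} {g' : Fin S' → Fin n → Fin S' → Bool}
    {h' : Fin n → Fin S' → Bool}
    (H : (⟨S, n, f, g, h⟩ : GBA n).code = (⟨S', n, f', g', h'⟩ : GBA n).code) :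
    (⟨S, n, f, g, h⟩ : GBA n) = ⟨S', n, f', g', h'⟩ := by
  obtain ⟨a1, a2, -, -, a5, a6, a7, -⟩ := (eq_code_iff f g h _).1 rfl
  obtain ⟨b1, b2, -, -, b5, b6, b7, -⟩ := (eq_code_iff f' g' h' _).1 H
  have hS : S = S' := by
    rcases lt_trichotomy S S' with hlt | hlt | hlt
    · rw [b1 S hlt] at a2; simp at a2
    · exact hlt
    · rw [a1 S' hlt] at b2; simp at b2
  subst hS
  have hbit : ∀ {b b' : Bool}, bitCode b = bitCode b' → b = b' := by
    intro b b' hb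
    cases b <;> cases b' <;> simp_all [bitCode]
  have h1 : f = f' := funext fun s => hbit (Option.some.inj ((a5 s).symm.trans (b5 s)))
  have h2 : g = g' := funext fun s => funext fun a => funext fun t =>
    hbit (Option.some.inj ((a6 s a t).symm.trans (b6 s a t)))
  have h3 : h = h' := funext fun j => funext fun s =>
    hbit (Option.some.inj ((a7 j s).symm.trans (b7 j s)))
  rw [h1, h2, h3]

theorem aut_eq_of_code_eq {n : ℕ} {c c' : Cert} (h : (c.aut n).code = (c'.aut n).code) :
    c.aut n = c'.aut n :=
  GBA.eq_of_code_eq h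

/-- There are at most `16 ^ L` words of length at most `L`: such a word is a function from `Fin L`
to the twelve symbols and `none`. -/
theorem finite_words {O : Set (List Sym)} {L : ℕ} (h : ∀ o ∈ O, o.length ≤ L) :
    O.Finite ∧ O.ncard ≤ 2 ^ (4 * L) := by
  have hc : Nat.card (Option Sym) ≤ 2 ^ 4 := by
    have h1 : Nat.card Sym ≤ Nat.card (Fin 12) := Nat.card_le_card_of_surjective
      (![.zero, .one, .sep, .varX, .varY, .pred, .lt, .eq, .neg, .and, .or, .ex] : Fin 12 → Sym)
      fun s => by
        cases s
        exacts [⟨0, rfl⟩, ⟨1, rfl⟩, ⟨2, rfl⟩, ⟨3, rfl⟩, ⟨4, rfl⟩, ⟨5, rfl⟩, ⟨6, rfl⟩, ⟨7, rfl⟩,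
          ⟨8, rfl⟩, ⟨9, rfl⟩, ⟨10, rfl⟩, ⟨11, rfl⟩]
    rw [Nat.card_fin] at h1
    rw [Finite.card_option]
    omega
  let f : List Sym → Fin L → Option Sym := fun o i => o[(i : ℕ)]?
  have hinj : Set.InjOn f O := fun o ho o' ho' hf => by
    refine List.ext_getElem? fun i => ?_
    by_cases hi : i < L
    · exact congrFun hf ⟨i, hi⟩
    · have h1 := h o ho
      have h2 := h o' ho'
      rw [List.getElem?_eq_none (by omega), List.getElem?_eq_none (by omega)]
  have hfin : O.Finite := Set.Finite.of_finite_image (Set.toFinite _) hinj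
  refine ⟨hfin, ?_⟩
  calc O.ncard = (f '' O).ncard := hinj.ncard_image.symm
    _ ≤ Nat.card (Fin L → Option Sym) := Set.ncard_le_card _
    _ = Nat.card (Option Sym) ^ L := by rw [Nat.card_fun, Nat.card_fin]
    _ ≤ (2 ^ 4) ^ L := Nat.pow_le_pow_left hc L
    _ = 2 ^ (4 * L) := by rw [← pow_mul]

/-- The machine that guesses the tapes and checks them: its outputs are descriptions of automata of
certificates that are consistent with the formula, among them the certificates of all words in the
language. -/
theorem exists_machine_for_certificates : ∃ (c : Cmd) (B : ℕ) (_ : NeZero B) (p : Polynomial ℕ),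
    ∀ (n : ℕ) (φ : Formula n),
      (c.machine B).RunsInTime (inputCode φ) (p.eval (inputCode φ).length) ∧
      (∀ o ∈ (c.machine B).outputs (inputCode φ), List.length (α := Sym) o ≤
          p.eval (inputCode φ).length ∧ ∃ d : Cert, d.Valid φ ∧ o = (d.aut n).code) ∧
      ∀ w ∈ φ.lang, ((certOf w φ).aut n).code ∈ (c.machine B).outputs (inputCode φ) := by
  obtain ⟨e, he, heval⟩ := definable_tapeCheck
  obtain ⟨b, hb, hbeval⟩ : Dn 7 fun τ _ => tapeBound (τ 0).length :=
    (((Dn.len (by decide)).add (Dn.const 2)).pow 8).pow 4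
  obtain ⟨c, B, hB, p, h⟩ := exists_machine (j := 6) (by decide) hb he fun τ => hbeval τ _
  refine ⟨c, B, hB, p, fun n φ => ?_⟩
  obtain ⟨h1, h2, h3⟩ := h (inputCode φ)
  refine ⟨h2, ?_, ?_⟩
  · rw [h3]
    rintro o ⟨τ, hτ, hc, rfl⟩
    refine ⟨((hτ.2.1 1 le_rfl (by decide)).1).trans h1, ?_⟩
    obtain ⟨m, -, R, -, k, -, hch⟩ := (heval _ _).1 hc
    rw [hτ.1] at hch
    exact ⟨_, hch.sound⟩
  · intro w hw
    rw [h3]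
    obtain ⟨τ, hτ, h4, h5⟩ := exists_tapes (certOf.valid hw) (certOf_small w φ).1
      (certOf_small w φ).2 fun r hr => certOf.eq_zero hr
    exact ⟨τ, hτ, (heval _ _).2 h4, h5⟩

end FO2Aut

theorem mainTheorem2 :
    ∃ (p : Polynomial ℕ) (M : FO2Aut.NTM FO2Aut.Sym),
      ∀ (n : ℕ) (φ : FO2Aut.Formula n), φ.freeVars.card ≤ 1 →
        ∃ (N : ℕ) (A : Fin N → FO2Aut.GBA n),
          N ≤ 2 ^ p.eval (φ.size + n) ∧
          (∀ i, (A i).size ≤ p.eval (φ.size + n)) ∧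
          (∀ i j, i ≠ j → Disjoint (A i).lang (A j).lang) ∧
          (⋃ i, (A i).lang) = φ.lang ∧
          (∀ i, (A i).Unambiguous ∧ (A i).DeterministicInLimit) ∧
          M.RunsInTime (FO2Aut.inputCode φ) (p.eval (φ.size + n)) ∧
          M.outputs (FO2Aut.inputCode φ) = Set.range (fun i => (A i).code.map M.sym) := by
  obtain ⟨c, B, hB, q, h⟩ := FO2Aut.exists_machine_for_certificates
  -- the inputs have quadratic length, and a word of length `L` is one out of `2 ^ (4 * L)`
  refine ⟨4 * q.comp (Polynomial.X ^ 2 + 4 * Polynomial.X + 1), c.machine B, fun n φ _ => ?_⟩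
  obtain ⟨h1, h2, h3⟩ := h n φ
  set O : Set (List FO2Aut.Sym) := (c.machine B).outputs (FO2Aut.inputCode φ) with hO
  set L := q.eval (FO2Aut.inputCode φ).length with hL
  have hp : 4 * L ≤ (4 * q.comp (Polynomial.X ^ 2 + 4 * Polynomial.X + 1)).eval (φ.size + n) := by
    simp only [Polynomial.eval_mul, Polynomial.eval_comp, Polynomial.eval_add, Polynomial.eval_pow,
      Polynomial.eval_X, Polynomial.eval_ofNat, Polynomial.eval_one]
    exact Nat.mul_le_mul_left 4 (FO2Aut.eval_mono_nat q (FO2Aut.length_inputCode_le φ))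
  generalize (4 * q.comp (Polynomial.X ^ 2 + 4 * Polynomial.X + 1)).eval (φ.size + n) = P at hp
  obtain ⟨hfin, hcard⟩ := FO2Aut.finite_words fun o ho => (h2 o ho).1
  have : Finite O := hfin
  let ε : O ≃ Fin (Nat.card O) := Finite.equivFin O
  have h2' : ∀ o : O, ∃ d : FO2Aut.Cert, d.Valid φ ∧ (d.aut n).code = (o : List FO2Aut.Sym) :=
    fun o => (h2 o.1 o.2).2.imp fun _ hd => ⟨hd.1, hd.2.symm⟩
  choose d hv hd using h2'
  have hmap : ∀ l : List FO2Aut.Sym, l.map (c.machine B).sym = l := List.map_id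
  refine ⟨Nat.card O, fun i => (d (ε.symm i)).aut n, ?_, fun i => ?_, fun i j hij => ?_, ?_,
    fun i => ⟨(hv _).unambiguous, FO2Aut.Cert.deterministicInLimit⟩, fun t d ht => ?_, ?_⟩
  · exact hcard.trans (Nat.pow_le_pow_right (by decide) hp)
  · have := (h2 _ (ε.symm i).2).1
    rw [FO2Aut.GBA.size, hd]
    omega
  · rw [Set.disjoint_left]
    intro w hw hw'
    obtain ⟨_, m⟩ := FO2Aut.Cert.mem_lang_aut.1 hw
    obtain ⟨_, m'⟩ := FO2Aut.Cert.mem_lang_aut.1 hw'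
    have heq := congrArg FO2Aut.GBA.code ((hv _).aut_unique m (hv _) m')
    rw [hd, hd] at heq
    exact hij (ε.symm.injective (Subtype.ext heq))
  · refine Set.Subset.antisymm (Set.iUnion_subset fun i => (hv _).lang_subset) fun w hw => ?_
    let o : O := ⟨_, h3 w hw⟩
    refine Set.mem_iUnion.2 ⟨ε o, ?_⟩
    simp only [Equiv.symm_apply_apply]
    rw [FO2Aut.aut_eq_of_code_eq (hd o)]
    exact FO2Aut.Cert.mem_lang_aut.2 ⟨_, FO2Aut.certOf.match_cnt⟩
  · exact (h1 t d ht).trans (by omega)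
  · ext o
    simp only [hmap, hd]
    constructor
    · intro ho
      exact ⟨ε ⟨o, ho⟩, by simp only [Equiv.symm_apply_apply]; rfl⟩
    · rintro ⟨i, rfl⟩
      exact (ε.symm i).2
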